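/- Let $\alpha,\beta\in(0,1)$ with $\min\{\alpha,\beta\}<\tfrac12$, let $\mu,\nu>0$, and put $s=\max\{2-2\alpha,\,2-2\beta\}$. Consider the anisotropic quasi-geostrophic equation for a real-valued function $\theta=\theta(x,t)$, $$\text{(AQG)}\qquad \partial_t\theta+u_\theta\cdot\nabla\theta+\mu|\partial_1|^{2\alpha}\theta+\nu|\partial_2|^{2\beta}\theta=0,\qquad u_\theta=(-\mathcal R_2\theta,\mathcal R_1\theta),\qquad t>0,\ x\in\mathbb R^2,$$ with $\theta(\cdot,0)=\theta^0$, where $|\partial_j|^{r}$ and $\mathcal R_j$ are the Fourier multipliers with symbols $|\xi_j|^{r}$ and $i\xi_j/|\xi|$, and $\|f\|_{H^s}=\|(1+|\nabla|^2)^{s/2}f\|_{L^2(\mathbb R^2)}$, $\|f\|_{\dot H^s}=\||\nabla|^sf\|_{L^2(\mathbb R^2)}$, $|\nabla|^s$ being the multiplier with symbol $|\xi|^s$. Then there exists a constant $c>0$, depending only on $\alpha,\beta,\mu,\nu$, such that for every global solution $\theta\in C([0,\infty);H^s(\mathbb R^2))$ of (AQG) (in the sense of tempered distributions, with $u_\theta\cdot\nabla\theta=\operatorname{div}(\theta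 u_\theta)$) whose initial value satisfies $\|\theta^0\|_{\dot H^s}<c$, $$\lim_{t\to+\infty}\|\theta(t)\|_{H^s}=0.$$ -/

import Mathlib

open MeasureTheory Filter Topology FourierTransform
open scoped ENNReal SchwartzMap

noncomputable section

namespace AQG

/-- The plane with its Euclidean norm; the coordinates `ξ₁, ξ₂` are `ξ 0, ξ 1`. -/
abbrev Plane : Type := EuclideanSpace ℝ (Fin 2)

/-- The complex Hilbert space of square-integrable functions on the plane. Its Fourier transform
`𝓕` is the unitary extension of `f ↦ (ξ ↦ ∫ exp (-2πi x·ξ) f x dx)`. With this normalization the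
frequency variable of the transform with kernel `exp (-i x·ξ)` is `2πξ`, so the operator usually
written with symbol `m ξ` has symbol `m (2πξ)` here. -/
abbrev L2 : Type := Lp ℂ 2 (volume : Measure Plane)

/-- The inhomogeneous Sobolev norm `‖(1 + |∇|²)^{s/2} f‖_{L²}`, equal to `∞` if `f ∉ H^s`. -/
def sobolevNorm (s : ℝ) (f : L2) : ℝ≥0∞ :=
  eLpNorm (fun ξ : Plane => (((1 + (2 * Real.pi * ‖ξ‖) ^ 2) ^ (s / 2) : ℝ) : ℂ) * (𝓕 f : L2) ξ)
    2 volume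

/-- The homogeneous Sobolev norm `‖|∇|^s f‖_{L²}`, equal to `∞` if it is not finite. -/
def homSobolevNorm (s : ℝ) (f : L2) : ℝ≥0∞ :=
  eLpNorm (fun ξ : Plane => (((2 * Real.pi * ‖ξ‖) ^ s : ℝ) : ℂ) * (𝓕 f : L2) ξ) 2 volume

/-- The symbol `i ξⱼ / |ξ|` of the Riesz transform. -/
def rieszSymbol (j : Fin 2) (ξ : Plane) : ℂ := Complex.I * (ξ j : ℂ) / (‖ξ‖ : ℂ)

theorem memLp_rieszSymbol (j : Fin 2) : MemLp (rieszSymbol j) ∞ (volume : Measure Plane) := by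
  refine memLp_top_of_bound (C := 1) ?_ (Eventually.of_forall fun ξ => ?_)
  · have hm : Measurable (rieszSymbol j) := by
      unfold rieszSymbol
      fun_prop
    exact hm.aestronglyMeasurable
  · have h : ‖ξ j‖ ≤ ‖ξ‖ := PiLp.norm_apply_le ξ j
    simp only [rieszSymbol, norm_div, norm_mul, Complex.norm_I, one_mul, Complex.norm_real,
      norm_norm]
    exact div_le_one_of_le₀ h (norm_nonneg _)

/-- The Riesz transform `Rⱼ f = 𝓕⁻¹ (i ξⱼ / |ξ| · 𝓕 f)` on `L²`. -/
def riesz (j : Fin 2) (f : L2) : L2 :=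
  𝓕⁻ ((memLp_rieszSymbol j).toLp (rieszSymbol j) • (𝓕 f : L2) : L2)

/-- The velocity `u_θ = R^⊥ θ = (-R₂ θ, R₁ θ)`. -/
def velocity (θ : L2) : Fin 2 → L2 := ![-riesz 1 θ, riesz 0 θ]

/-- The function `|∂ⱼ|^r φ = 𝓕⁻¹ (|ξⱼ|^r 𝓕 φ)` for a Schwartz function `φ` (and `r ≥ 0`). -/
def fracDeriv (j : Fin 2) (r : ℝ) (φ : 𝓢(Plane, ℂ)) : Plane → ℂ :=
  𝓕⁻ (fun ξ : Plane => ((|2 * Real.pi * ξ j| ^ r : ℝ) : ℂ) * (𝓕 φ : 𝓢(Plane, ℂ)) ξ)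

/-- The value at the test function `φ` of the tempered distribution
`-(u_θ·∇θ + μ|∂₁|^{2α}θ + ν|∂₂|^{2β}θ)`. As `u_θ` is divergence free, `u_θ·∇θ = div (θ u_θ)`, and
all derivatives are moved to `φ`. -/
def weakRHS (μ ν α β : ℝ) (θ : L2) (φ : 𝓢(Plane, ℂ)) : ℂ :=
  (∑ j : Fin 2, ∫ x : Plane, θ x * velocity θ j x * fderiv ℝ φ x (EuclideanSpace.single j 1))
    - (μ : ℂ) * (∫ x : Plane, θ x * fracDeriv 0 (2 * α) φ x)
    - (ν : ℂ) * (∫ x : Plane, θ x * fracDeriv 1 (2 * β) φ x)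

/-- `θ` (restricted to `t ≥ 0`) is a real-valued global solution, in `C([0,∞), H^s)`, of
`∂ₜθ + u_θ·∇θ + μ|∂₁|^{2α}θ + ν|∂₂|^{2β}θ = 0`, `u_θ = R^⊥ θ`, with initial value `θ 0`. The
equation holds in the sense of tempered distributions at every time `t > 0`. -/
structure IsGlobalSolution (μ ν α β s : ℝ) (θ : ℝ → L2) : Prop where
  real_valued : ∀ t, 0 ≤ t → ∀ᵐ x : Plane, (θ t x).im = 0
  mem_sobolev : ∀ t, 0 ≤ t → sobolevNorm s (θ t) < ∞
  continuous_sobolev : ∀ t₀, 0 ≤ t₀ →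
    Tendsto (fun t => sobolevNorm s (θ t - θ t₀)) (𝓝[Set.Ici 0] t₀) (𝓝 0)
  equation : ∀ (φ : 𝓢(Plane, ℂ)) (t : ℝ), 0 < t →
    HasDerivAt (fun τ => ∫ x : Plane, θ τ x * φ x) (weakRHS μ ν α β (θ t) φ) t

end AQG

end

/-! Put a = min α β, so that s = 2 - 2a lies in (1, 2), and work with ψ = 𝓕 θ. For a bounded weight
w ≥ 0 the energy E_w = ∫ w|ψ|² satisfies, in integrated form, E_w' = 2(T_w - D_w), where T_w is the
cubic transport term (`tri`) and D_w = ∫ w · dissip · |ψ|² (`energy_eq`). Three choices of w give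
the theorem.

For w = 1 the transport term vanishes, so the time integral of D_1 is at most E_1(0).

For w = min(|ξ|, R)^{2s} the energy is a truncated Ḣ^s norm. The truncation keeps the weight
bounded, so the identity is legitimate for a solution that is merely in H^s, and R is sent to
infinity only at the end. The heart of the proof is |T_w| ≤ K √E_w D_w with K independent of R
(`exists_tri_profWeight_le`). Real-valuedness and incompressibility replace w(ξ) by the difference
w(ξ) - w(ξ - η). In the triangle with sides ξ, η, ξ - η the resulting kernel is then controlled by
|x ∧ y| / |y|, with x the shortest side. Both products in x ∧ y contain an i-th coordinate, i being
the direction of the weaker dissipation, so two factors |·_i|^a can be extracted and absorbed by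
D_w. What is left is square integrable in x uniformly in y, by scaling, exactly because s = 2 - 2a
(`exists_lowKer_bound`), and Cauchy–Schwarz concludes.

For small data this makes E_w nonincreasing with D_w integrable in time. Since E_w ≤ C (D_1 + D_w)
and E_w is monotone, t E_w(t) stays bounded. Letting R → ∞, the squared Ḣ^s norm is O(1/t).

It remains to treat the L² norm. Frequencies |ξ| ≥ δ are controlled by the Ḣ^s norm. For w = 1_{|ξ|
< δ}, |T_w| ≤ ε(δ) √E_1 D_1 with ε(δ) → 0, because max α β < 1 makes |ξ|^{-max α β} locally square
integrable. Integrating in time, the low-frequency mass is small uniformly in t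
(`energy_lowWeight_le`). Choosing first δ, then t, finishes the proof. -/

noncomputable section

namespace AQG

/-! ### Duality and the Fourier transform on L² -/

/-- The bilinear pairing `∫ f g` on `L²`. -/
def pair : L2 →L[ℂ] L2 →L[ℂ] ℂ :=
  ContinuousLinearMap.lpPairing volume 2 2 (ContinuousLinearMap.mul ℂ ℂ)

theorem pair_apply (f g : L2) : pair f g = ∫ x, f x * g x := by
  simp [pair, ContinuousLinearMap.lpPairing_eq_integral]

theorem pair_comm (f g : L2) : pair f g = pair g f := by
  simp [pair_apply, mul_comm]

/-- A Schwartz function as an element of `L²`. -/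
abbrev sl (χ : 𝓢(Plane, ℂ)) : L2 := χ.toLp 2

theorem pair_schwartz (f : L2) (χ : 𝓢(Plane, ℂ)) : pair f (sl χ) = ∫ x, f x * χ x := by
  rw [pair_apply]
  refine integral_congr_ae ?_
  filter_upwards [χ.coeFn_toLp 2 volume] with x hx
  rw [hx]

theorem dense_sl : DenseRange (fun χ : 𝓢(Plane, ℂ) => (sl χ)) :=
  SchwartzMap.denseRange_toLpCLM (E := Plane) (F := ℂ) (p := 2) ENNReal.ofNat_ne_top

theorem eq_of_pair_schwartz {f g : L2} (h : ∀ χ : 𝓢(Plane, ℂ), pair f (sl χ) = pair g (sl χ)) :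
    f = g := by
  have h1 : ∀ k : L2, pair f k = pair g k := by
    intro k
    refine dense_sl.induction_on (p := fun k => pair f k = pair g k) k
      (isClosed_eq (pair f).continuous (pair g).continuous) h
  have h2 : ∀ k : L2, inner ℂ k (f - g) = 0 := by
    intro k
    -- Conjugating the test function turns the bilinear pairing into the inner product.
    have h3 := h1 (star k)
    rw [pair_apply, pair_apply] at h3
    rw [inner_sub_right, L2.inner_def, L2.inner_def, sub_eq_zero]
    have e : ∀ f : L2, ∫ x, inner ℂ (k x) (f x) = ∫ x, f x * (star k : L2) x := by
      intro f
      refine integral_congr_ae ?_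
      filter_upwards [Lp.coeFn_star k] with x hx
      simp [hx, RCLike.inner_apply]
    rw [e, e, h3]
  have := h2 (f - g)
  rwa [inner_self_eq_zero, sub_eq_zero] at this

/-- For Schwartz g this is the duality defining the distributional transform, which agrees with the
unitary one on L²; density and continuity in g give the rest. -/
theorem pair_fourier (f g : L2) : pair (𝓕 f : L2) g = pair f (𝓕 g : L2) := by
  have hc : Continuous (fun g : L2 => (𝓕 g : L2)) := (Lp.fourierTransformₗᵢ Plane ℂ).continuous
  refine dense_sl.induction_on (p := fun g => pair (𝓕 f : L2) g = pair f (𝓕 g : L2)) g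
      (isClosed_eq (pair _).continuous ((pair f).continuous.comp hc)) ?_
  intro χ
  have h := Lp.fourier_toTemperedDistribution_eq f
  have h2 : (𝓕 (f : 𝓢'(Plane, ℂ)) : 𝓢'(Plane, ℂ)) χ = ((𝓕 f : L2) : 𝓢'(Plane, ℂ)) χ := by rw [h]
  rw [TemperedDistribution.fourier_apply, Lp.toTemperedDistribution_apply,
    Lp.toTemperedDistribution_apply] at h2
  rw [pair_schwartz, SchwartzMap.toLp_fourier_eq, pair_schwartz]
  simpa [mul_comm] using h2.symm

theorem fourier_toLp_ae {h : Plane → ℂ} (h1 : Integrable h) (h2 : MemLp h 2) :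
    (𝓕 (h2.toLp h) : L2) =ᵐ[volume] 𝓕 h := by
  refine ae_eq_of_integral_contDiff_smul_eq ((Lp.memLp _).locallyIntegrable one_le_two) ?_ ?_
  · have : Continuous (𝓕 h) := VectorFourier.fourierIntegral_continuous
      Real.continuous_fourierChar (by exact continuous_inner) h1
    exact this.locallyIntegrable
  · intro g hg hc
    have hc' : HasCompactSupport (fun x => (g x : ℂ)) := hc.comp_left (g := fun r : ℝ => (r : ℂ)) rfl
    have hg' : ContDiff ℝ ((⊤ : ℕ∞) : WithTop ℕ∞) (fun x => (g x : ℂ)) := Complex.ofRealCLM.contDiff.comp hg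
    set χ : 𝓢(Plane, ℂ) := hc'.toSchwartzMap hg' with hχ
    have e : ∀ x, χ x = g x := fun x => rfl
    have h3 := pair_fourier (h2.toLp h) (sl χ)
    rw [pair_schwartz, SchwartzMap.toLp_fourier_eq, pair_schwartz] at h3
    have h4 : ∫ x, 𝓕 h x * χ x = ∫ x, h x * (𝓕 χ : 𝓢(Plane, ℂ)) x := by
      have := VectorFourier.integral_fourierIntegral_smul_eq_flip (μ := volume) (ν := volume)
        (e := Real.fourierChar) (L := innerₗ Plane) (f := h) (g := χ)
        Real.continuous_fourierChar (by exact continuous_inner) h1 χ.integrable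
      rw [flip_innerₗ] at this
      simp only [smul_eq_mul] at this
      exact this
    calc ∫ x, g x • (𝓕 (h2.toLp h) : L2) x = ∫ x, (𝓕 (h2.toLp h) : L2) x * χ x := by
          simp [e, mul_comm]
      _ = ∫ x, (h2.toLp h) x * (𝓕 χ : 𝓢(Plane, ℂ)) x := h3
      _ = ∫ x, h x * (𝓕 χ : 𝓢(Plane, ℂ)) x := by
          refine integral_congr_ae ?_
          filter_upwards [h2.coeFn_toLp] with x hx
          rw [hx]
      _ = ∫ x, 𝓕 h x * χ x := h4.symm
      _ = _ := by simp [e, mul_comm]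

/-- Needed for h = |2πξ_j|^r X(ξ), which is continuous with compact support but in general not
smooth, so that duality with Schwartz functions does not suffice. -/
theorem integral_mul_fourier (f : L2) {h : Plane → ℂ} (h1 : Integrable h) (h2 : MemLp h 2) :
    ∫ x, f x * 𝓕 h x = ∫ x, (𝓕 f : L2) x * h x := by
  have := pair_fourier f (h2.toLp h)
  rw [pair_apply, pair_apply] at this
  calc ∫ x, f x * 𝓕 h x = ∫ x, f x * (𝓕 (h2.toLp h) : L2) x := by
        refine integral_congr_ae ?_
        filter_upwards [fourier_toLp_ae h1 h2] with x hx
        rw [hx]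
    _ = _ := this.symm
    _ = _ := by
        refine integral_congr_ae ?_
        filter_upwards [h2.coeFn_toLp] with x hx
        rw [hx]

/-- Tested against real bump functions g: the transform of g(-·) is the conjugate of the transform
of g, and f equals its own conjugate. -/
theorem fourier_hermitian {f : L2} (hf : ∀ᵐ x : Plane, (f x).im = 0) :
    ∀ᵐ ξ : Plane, (𝓕 f : L2) (-ξ) = star ((𝓕 f : L2) ξ) := by
  have key : ∀ ⦃g : Plane → ℝ⦄, ContDiff ℝ ((⊤ : ℕ∞) : WithTop ℕ∞) g → HasCompactSupport g →
      ∫ x, (𝓕 f : L2) x * (g x : ℂ) = ∫ x, f x * 𝓕 (fun x => (g x : ℂ)) x := by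
    intro g hg hc
    have hc' : HasCompactSupport (fun x => (g x : ℂ)) := hc.comp_left (g := fun r : ℝ => (r : ℂ)) rfl
    have hg' : ContDiff ℝ ((⊤ : ℕ∞) : WithTop ℕ∞) (fun x => (g x : ℂ)) := Complex.ofRealCLM.contDiff.comp hg
    exact (integral_mul_fourier f (hg'.continuous.integrable_of_hasCompactSupport hc')
      (hg'.continuous.memLp_of_hasCompactSupport hc')).symm
  refine ae_eq_of_integral_contDiff_smul_eq ?_ ?_ ?_
  · exact (((Lp.memLp (𝓕 f : L2)).comp_measurePreserving
      (Measure.measurePreserving_neg volume)).locallyIntegrable one_le_two)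
  · exact (((Lp.memLp (𝓕 f : L2)).star).locallyIntegrable one_le_two)
  · intro g hg hc
    have hn : ContDiff ℝ ((⊤ : ℕ∞) : WithTop ℕ∞) (fun x => g (-x)) := hg.comp contDiff_neg
    have hcn : HasCompactSupport (fun x => g (-x)) := hc.comp_homeomorph (Homeomorph.neg Plane)
    calc ∫ x, g x • (𝓕 f : L2) (-x) = ∫ x, (fun y => (𝓕 f : L2) y * (g (-y) : ℂ)) (-x) := by
          simp [mul_comm]
      _ = ∫ y, (𝓕 f : L2) y * (g (-y) : ℂ) := 
          integral_neg_eq_self (fun y => (𝓕 f : L2) y * (g (-y) : ℂ)) volume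
      _ = ∫ x, f x * 𝓕 (fun x => (g (-x) : ℂ)) x := key hn hcn
      _ = ∫ x, star (f x * 𝓕 (fun x => (g x : ℂ)) x) := by
          refine integral_congr_ae ?_
          filter_upwards [hf] with x hx
          have h1 : star (f x) = f x := Complex.conj_eq_iff_im.2 hx
          rw [star_mul', h1]
          congr 1
          rw [← Real.fourierInv_eq_fourier_comp_neg (fun x => (g x : ℂ)), Real.fourierInv_eq',
            Real.fourier_eq']
          rw [Complex.star_def, ← integral_conj]
          congr 1
          ext v
          simp [← Complex.exp_conj, Complex.conj_ofNat]
      _ = star (∫ x, f x * 𝓕 (fun x => (g x : ℂ)) x) := integral_conj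
      _ = star (∫ x, (𝓕 f : L2) x * (g x : ℂ)) := by rw [key hg hc]
      _ = ∫ x, star ((𝓕 f : L2) x * (g x : ℂ)) := integral_conj.symm
      _ = _ := by
        congr 1
        ext x
        simp [mul_comm]


/-! ### Bounded multipliers and the convolution theorem -/

theorem norm_pair_le (f g : L2) : ‖pair f g‖ ≤ ‖f‖ * ‖g‖ := by
  have h : pair f g = inner ℂ (star f) g := by
    rw [pair_apply, L2.inner_def]
    refine integral_congr_ae ?_
    filter_upwards [Lp.coeFn_star f] with x hx
    simp [hx, RCLike.inner_apply, mul_comm]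
  rw [h]
  exact (norm_inner_le_norm _ _).trans_eq (by
    congr 1
    rw [Lp.norm_def, Lp.norm_def]
    congr 1
    refine eLpNorm_congr_norm_ae ?_
    filter_upwards [Lp.coeFn_star f] with x hx
    simp [hx])

/-- Multiplication by a bounded function on `L²`. -/
def mulOp {h : Plane → ℂ} (hh : MemLp h ∞ volume) : L2 →L[ℂ] L2 :=
  (ContinuousLinearMap.mul ℂ ℂ).holderL volume ∞ 2 2 (hh.toLp h)

theorem mulOp_coeFn {h : Plane → ℂ} (hh : MemLp h ∞ volume) (f : L2) :
    mulOp hh f =ᵐ[volume] fun x => h x * f x := by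
  filter_upwards [(ContinuousLinearMap.mul ℂ ℂ).coeFn_holder (r := 2) (hh.toLp h) f,
    hh.coeFn_toLp] with x hx h2
  rw [mulOp]
  exact hx.trans (by simp [h2])

theorem pair_mulOp {h : Plane → ℂ} (hh : MemLp h ∞ volume) (f g : L2) :
    pair (mulOp hh f) g = ∫ x, h x * f x * g x := by
  rw [pair_apply]
  refine integral_congr_ae ?_
  filter_upwards [mulOp_coeFn hh f] with x hx
  rw [hx]

theorem measurePreserving_sub_left' (ξ : Plane) :
    MeasurePreserving (fun η : Plane => ξ - η) volume volume :=
  Measure.measurePreserving_sub_left volume ξ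

/-- The reflected translate `η ↦ g (ξ - η)`. -/
def reflect (ξ : Plane) : L2 →ₗᵢ[ℂ] L2 :=
  Lp.compMeasurePreservingₗᵢ ℂ (fun η : Plane => ξ - η) (measurePreserving_sub_left' ξ)

theorem reflect_coeFn (ξ : Plane) (g : L2) : reflect ξ g =ᵐ[volume] fun η => g (ξ - η) :=
  Lp.coeFn_compMeasurePreserving g (measurePreserving_sub_left' ξ)

/-- The convolution of two square-integrable functions. -/
def convF (f g : L2) (ξ : Plane) : ℂ := ∫ η, f η * g (ξ - η)

theorem convF_eq_pair (f g : L2) (ξ : Plane) : convF f g ξ = pair f (reflect ξ g) := by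
  rw [pair_apply]
  refine integral_congr_ae ?_
  filter_upwards [reflect_coeFn ξ g] with η hη
  rw [hη]

theorem norm_convF_le (f g : L2) (ξ : Plane) : ‖convF f g ξ‖ ≤ ‖f‖ * ‖g‖ := by
  rw [convF_eq_pair]
  exact (norm_pair_le _ _).trans_eq (by rw [LinearIsometry.norm_map])

theorem stronglyMeasurable_convF (f g : L2) : StronglyMeasurable (convF f g) := by
  have : StronglyMeasurable (fun p : Plane × Plane => f p.2 * g (p.1 - p.2)) :=
    ((Lp.stronglyMeasurable f).comp_measurable measurable_snd).mul
      ((Lp.stronglyMeasurable g).comp_measurable (measurable_fst.sub measurable_snd))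
  exact this.integral_prod_right'

/-- The convolution of two L² functions is bounded but need not be square integrable; a factor κ in
L² restores this. With κ a frequency cutoff, the quadratic nonlinearity becomes a continuous map on
L². -/
theorem memLp_mul_convF {κ : Plane → ℂ} (hκ : MemLp κ 2 volume) (f g : L2) :
    MemLp (fun ξ => κ ξ * convF f g ξ) 2 volume := by
  refine (hκ.const_mul ((‖f‖ * ‖g‖ : ℝ) : ℂ)).mono
    (hκ.1.mul (stronglyMeasurable_convF f g).aestronglyMeasurable) (Eventually.of_forall fun ξ => ?_)
  rw [norm_mul, norm_mul, mul_comm]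
  gcongr
  rw [Complex.norm_real, Real.norm_of_nonneg (by positivity)]
  exact norm_convF_le f g ξ

/-- The bilinear map `(f, g) ↦ κ · (f * g)` from `L² × L²` to `L²`. -/
def convL {κ : Plane → ℂ} (hκ : MemLp κ 2 volume) : L2 →L[ℂ] L2 →L[ℂ] L2 :=
  LinearMap.mkContinuous₂
    (LinearMap.mk₂ ℂ (fun f g => (memLp_mul_convF hκ f g).toLp _)
      (fun f f' g => by
        rw [← MemLp.toLp_add, MemLp.toLp_eq_toLp_iff]
        refine Eventually.of_forall fun ξ => ?_
        simp [convF_eq_pair, mul_add])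
      (fun c f g => by
        rw [← MemLp.toLp_const_smul, MemLp.toLp_eq_toLp_iff]
        refine Eventually.of_forall fun ξ => ?_
        simp [convF_eq_pair, mul_left_comm])
      (fun f g g' => by
        rw [← MemLp.toLp_add, MemLp.toLp_eq_toLp_iff]
        refine Eventually.of_forall fun ξ => ?_
        simp [convF_eq_pair, mul_add])
      (fun c f g => by
        rw [← MemLp.toLp_const_smul, MemLp.toLp_eq_toLp_iff]
        refine Eventually.of_forall fun ξ => ?_
        simp [convF_eq_pair, mul_left_comm]))
    ‖hκ.toLp κ‖ (fun f g => by
      rw [LinearMap.mk₂_apply, mul_assoc, mul_comm]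
      refine Lp.norm_le_mul_norm_of_ae_le_mul ?_
      filter_upwards [(memLp_mul_convF hκ f g).coeFn_toLp, hκ.coeFn_toLp] with ξ h1 h2
      rw [h1, h2, norm_mul, mul_comm]
      gcongr
      exact norm_convF_le f g ξ)

theorem convL_coeFn {κ : Plane → ℂ} (hκ : MemLp κ 2 volume) (f g : L2) :
    convL hκ f g =ᵐ[volume] fun ξ => κ ξ * convF f g ξ :=
  (memLp_mul_convF hκ f g).coeFn_toLp

/-- The character `x ↦ exp (-2πi x·ξ)`. -/
theorem memLp_char (ξ : Plane) :
    MemLp (fun x : Plane => (Real.fourierChar (-(inner ℝ x ξ)) : ℂ)) ∞ volume := by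
  refine memLp_top_of_bound (C := 1) ?_ (Eventually.of_forall fun x => (Circle.norm_coe _).le)
  refine Continuous.aestronglyMeasurable ?_
  exact (show Continuous (fun z : Circle => (z : ℂ)) from continuous_subtype_val).comp (Real.continuous_fourierChar.comp (by fun_prop))

theorem fourier_mul_eq_pair (f g : L2) (ξ : Plane) :
    𝓕 (fun x => f x * g x) ξ = pair f (mulOp (memLp_char ξ) g) := by
  rw [pair_comm, pair_mulOp, Real.fourier_eq]
  refine integral_congr_ae (Eventually.of_forall fun x => ?_)
  simp only [Circle.smul_def, smul_eq_mul]
  ring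

/-- For fixed ξ both sides are jointly continuous in (f, g), so Schwartz functions suffice; there
the identity follows by Fourier inversion of the convolution of the two transforms. -/
theorem fourier_mul_eq_convF (f g : L2) (ξ : Plane) :
    𝓕 (fun x => f x * g x) ξ = convF (𝓕 f : L2) (𝓕 g : L2) ξ := by
  have hc : Continuous (fun g : L2 => (𝓕 g : L2)) := (Lp.fourierTransformₗᵢ Plane ℂ).continuous
  rw [fourier_mul_eq_pair, convF_eq_pair]
  refine dense_sl.induction_on₂ (p := fun f g : L2 => pair f (mulOp (memLp_char ξ) g) =
    pair (𝓕 f : L2) (reflect ξ (𝓕 g : L2))) (isClosed_eq ?_ ?_) ?_ f g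
  · fun_prop
  · have h1 : Continuous (fun q : L2 × L2 => reflect ξ (𝓕 q.2 : L2)) :=
      (reflect ξ).continuous.comp (hc.comp continuous_snd)
    exact (pair.continuous.comp (hc.comp continuous_fst)).clm_apply h1
  · intro φ γ
    rw [← fourier_mul_eq_pair, ← convF_eq_pair, SchwartzMap.toLp_fourier_eq,
      SchwartzMap.toLp_fourier_eq]
    have e1 : 𝓕 (fun x => sl φ x * sl γ x) ξ = 𝓕 (fun x => φ x * γ x) ξ := by
      rw [Real.fourier_eq, Real.fourier_eq]
      refine integral_congr_ae ?_
      filter_upwards [φ.coeFn_toLp 2 volume, γ.coeFn_toLp 2 volume] with x h1 h2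
      rw [h1, h2]
    have e2 : convF (sl (𝓕 φ)) (sl (𝓕 γ)) ξ = ∫ η, (𝓕 φ : 𝓢(Plane, ℂ)) η * (𝓕 γ : 𝓢(Plane, ℂ)) (ξ - η) := by
      refine integral_congr_ae ?_
      filter_upwards [(𝓕 φ : 𝓢(Plane, ℂ)).coeFn_toLp 2 volume,
        (measurePreserving_sub_left' ξ).quasiMeasurePreserving.ae
          ((𝓕 γ : 𝓢(Plane, ℂ)).coeFn_toLp 2 volume)] with x h1 h2
      rw [h1, h2]
    rw [e1, e2]
    have h3 := SchwartzMap.convolution_apply (ContinuousLinearMap.mul ℂ ℂ) (𝓕 φ : 𝓢(Plane, ℂ))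
      (𝓕 γ : 𝓢(Plane, ℂ)) ξ
    have h4 := SchwartzMap.fourier_convolution (ContinuousLinearMap.mul ℂ ℂ) (𝓕 φ : 𝓢(Plane, ℂ))
      (𝓕 γ : 𝓢(Plane, ℂ))
    set Γ := SchwartzMap.convolution (ContinuousLinearMap.mul ℂ ℂ) (𝓕 φ : 𝓢(Plane, ℂ))
      (𝓕 γ : 𝓢(Plane, ℂ))
    have h5 : ∀ (φ : 𝓢(Plane, ℂ)) (x : Plane), (𝓕 (𝓕 φ : 𝓢(Plane, ℂ)) : 𝓢(Plane, ℂ)) (-x) = φ x := by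
      intro φ x
      have : (𝓕⁻ (𝓕 φ : 𝓢(Plane, ℂ)) : 𝓢(Plane, ℂ)) x = φ x := by
        rw [FourierTransform.fourierInv_fourier_eq]
      rw [← this, SchwartzMap.fourierInv_coe, Real.fourierInv_eq_fourier_neg, SchwartzMap.fourier_coe]
    have h6 : (𝓕⁻ (𝓕 Γ : 𝓢(Plane, ℂ)) : 𝓢(Plane, ℂ)) ξ = Γ ξ := by
      rw [FourierTransform.fourierInv_fourier_eq]
    rw [SchwartzMap.fourierInv_coe, Real.fourierInv_eq_fourier_comp_neg, h4] at h6
    simp only [SchwartzMap.pairing_apply_apply, h5] at h6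
    rw [h3] at h6
    simpa [MeasureTheory.convolution] using h6

theorem integral_mul_mul_fourier (f g : L2) {h : Plane → ℂ} (hh : Integrable h) :
    ∫ x, f x * g x * 𝓕 h x = ∫ ξ, convF (𝓕 f : L2) (𝓕 g : L2) ξ * h ξ := by
  have hfg : Integrable (fun x => f x * g x) := (Lp.memLp f).integrable_mul (Lp.memLp g)
  have := VectorFourier.integral_fourierIntegral_smul_eq_flip (μ := volume) (ν := volume)
    (e := Real.fourierChar) (L := innerₗ Plane) (f := fun x => f x * g x) (g := h)
    Real.continuous_fourierChar (by exact continuous_inner) hfg hh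
  rw [flip_innerₗ] at this
  simp only [smul_eq_mul] at this
  refine this.symm.trans (integral_congr_ae (Eventually.of_forall fun ξ => ?_))
  simp only
  rw [← fourier_mul_eq_convF]
  rfl


/-! ### The equation on the Fourier side -/

/-- The symbol of the map `θ ↦ (u_θ)ⱼ`. -/
def velSymbol : Fin 2 → Plane → ℂ := ![-rieszSymbol 1, rieszSymbol 0]

theorem memLp_velSymbol (j : Fin 2) : MemLp (velSymbol j) ∞ (volume : Measure Plane) := by
  fin_cases j
  · exact (memLp_rieszSymbol 1).neg
  · exact memLp_rieszSymbol 0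

theorem fourier_riesz (j : Fin 2) (θ : L2) :
    (𝓕 (riesz j θ) : L2) = mulOp (memLp_rieszSymbol j) (𝓕 θ : L2) := by
  rw [riesz, FourierTransform.fourier_fourierInv_eq]
  rfl

theorem fourier_velocity (θ : L2) (j : Fin 2) :
    (𝓕 (velocity θ j) : L2) = mulOp (memLp_velSymbol j) (𝓕 θ : L2) := by
  fin_cases j
  · have h : (𝓕 (-riesz 1 θ) : L2) = -(𝓕 (riesz 1 θ) : L2) :=
      (Lp.fourierTransformₗᵢ Plane ℂ).map_neg _
    refine Eq.trans h ?_
    rw [fourier_riesz]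
    refine Lp.ext ?_
    filter_upwards [Lp.coeFn_neg (mulOp (memLp_rieszSymbol 1) (𝓕 θ : L2)),
      mulOp_coeFn (memLp_rieszSymbol 1) (𝓕 θ : L2),
      mulOp_coeFn (memLp_velSymbol 0) (𝓕 θ : L2)] with ξ h1 h2 h3
    rw [h1]
    refine Eq.trans ?_ h3.symm
    simp [velSymbol, h2]
  · exact fourier_riesz 0 θ

/-- The two-dimensional cross product. -/
def wedge (a b : Plane) : ℝ := a 0 * b 1 - a 1 * b 0

/-- The symbol of the dissipation. -/
def dissip (μ ν α β : ℝ) (ξ : Plane) : ℝ :=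
  μ * |2 * Real.pi * ξ 0| ^ (2 * α) + ν * |2 * Real.pi * ξ 1| ^ (2 * β)

/-- The Fourier transform of `-u_θ·∇θ` in terms of the transform `ψ` of `θ`. -/
def nonlin (ψ : L2) (ξ : Plane) : ℂ :=
  2 * Real.pi * ∫ η, ((wedge η ξ / ‖η‖ : ℝ) : ℂ) * (ψ η * ψ (ξ - η))

theorem integrable_mul_reflect (f g : L2) (ξ : Plane) : Integrable (fun η => f η * g (ξ - η)) := by
  refine ((Lp.memLp f).integrable_mul (Lp.memLp (reflect ξ g))).congr ?_
  filter_upwards [reflect_coeFn ξ g] with η hη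
  simp [hη]

/-- The term -div(θ u_θ) has symbol -2πi ξ · û(η), and û(η) = i(-η₂, η₁)/|η| · ψ(η), which leaves 2π
(η ∧ ξ)/|η|. Here η is the frequency of the velocity and ξ - η that of the advected factor. -/
theorem nonlin_eq_sum (ψ : L2) (ξ : Plane) :
    nonlin ψ ξ = ∑ j, -(2 * Real.pi * Complex.I) * (ξ j) *
      convF (mulOp (memLp_velSymbol j) ψ) ψ ξ := by
  rw [nonlin, Fin.sum_univ_two, convF, convF, ← integral_const_mul, ← integral_const_mul,
    ← integral_const_mul, ← integral_add ((integrable_mul_reflect _ _ _).const_mul _)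
      ((integrable_mul_reflect _ _ _).const_mul _)]
  refine integral_congr_ae ?_
  filter_upwards [mulOp_coeFn (memLp_velSymbol 0) ψ, mulOp_coeFn (memLp_velSymbol 1) ψ]
    with η h0 h1
  rw [h0, h1]
  simp only [velSymbol, rieszSymbol, wedge, Matrix.cons_val_zero,
    Matrix.cons_val_one, Pi.neg_apply]
  push_cast
  linear_combination (2 * Real.pi * ψ η * ψ (ξ - η) * (ξ 1 * η 0 / ‖η‖ - ξ 0 * η 1 / ‖η‖)) *
    Complex.I_mul_I

theorem continuous_dissip {μ ν α β : ℝ} (hα : 0 ≤ α) (hβ : 0 ≤ β) :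
    Continuous (dissip μ ν α β) := by
  unfold dissip
  have h0 : ∀ j : Fin 2, Continuous (fun ξ : Plane => |2 * Real.pi * ξ j|) := fun j => by fun_prop
  exact (continuous_const.mul ((h0 0).rpow_const fun _ => Or.inr (by positivity))).add
    (continuous_const.mul ((h0 1).rpow_const fun _ => Or.inr (by positivity)))

theorem integrable_convF_mul (f g : L2) {h : Plane → ℂ} (hh : Integrable h) :
    Integrable (fun ξ => convF f g ξ * h ξ) :=
  hh.bdd_mul (stronglyMeasurable_convF f g).aestronglyMeasurable
    (Eventually.of_forall (norm_convF_le f g))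

theorem fderiv_fourier (X : 𝓢(Plane, ℂ)) (j : Fin 2) (x : Plane) :
    fderiv ℝ (𝓕 X : 𝓢(Plane, ℂ)) x (EuclideanSpace.single j 1) =
      𝓕 (fun ξ : Plane => -(2 * Real.pi * Complex.I) * (ξ j) * X ξ) x := by
  have h := SchwartzMap.lineDerivOp_fourier_eq X (EuclideanSpace.single j (1 : ℝ))
  have h2 := congrArg (fun F : 𝓢(Plane, ℂ) => F x) h
  rw [SchwartzMap.lineDerivOp_apply_eq_fderiv, SchwartzMap.fourier_coe] at h2
  rw [SchwartzMap.fourier_coe, h2]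
  refine congrArg (fun F : Plane → ℂ => 𝓕 F x) (funext fun ξ => ?_)
  rw [smul_apply, SchwartzMap.smulLeftCLM_apply_apply (by fun_prop)]
  simp [EuclideanSpace.inner_single_right, mul_assoc]

/-- Applying the transform twice is a reflection, and the symbol |2πξ_j|^r is even, so no reflection
survives. -/
theorem fracDeriv_fourier (X : 𝓢(Plane, ℂ)) (j : Fin 2) (r : ℝ) :
    fracDeriv j r (𝓕 X) = 𝓕 (fun ξ : Plane => ((|2 * Real.pi * ξ j| ^ r : ℝ) : ℂ) * X ξ) := by
  have h5 : ∀ x : Plane, (𝓕 (𝓕 X : 𝓢(Plane, ℂ)) : 𝓢(Plane, ℂ)) (-x) = X x := by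
    intro x
    have : (𝓕⁻ (𝓕 X : 𝓢(Plane, ℂ)) : 𝓢(Plane, ℂ)) x = X x := by
      rw [FourierTransform.fourierInv_fourier_eq]
    rw [← this, SchwartzMap.fourierInv_coe, Real.fourierInv_eq_fourier_neg, SchwartzMap.fourier_coe]
  rw [fracDeriv, Real.fourierInv_eq_fourier_comp_neg]
  simp only [h5]
  congr 1
  ext ξ
  simp

/-- Testing with 𝓕 X, where X has compact support, confines all integrals to bounded frequencies, so
that the unbounded symbols cause no integrability problem. -/
theorem weakRHS_fourier {μ ν α β : ℝ} (hα : 0 ≤ α) (hβ : 0 ≤ β) (θ : L2) (X : 𝓢(Plane, ℂ))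
    (hX : HasCompactSupport X) :
    weakRHS μ ν α β θ (𝓕 X) =
      ∫ ξ, (nonlin (𝓕 θ) ξ - dissip μ ν α β ξ * (𝓕 θ : L2) ξ) * X ξ := by
  have hcont : ∀ (j : Fin 2), ∀ {r : ℝ}, 0 ≤ r →
      Continuous (fun ξ : Plane => ((|2 * Real.pi * ξ j| ^ r : ℝ) : ℂ) * X ξ) := by
    intro j r hr
    have h0 : Continuous (fun ξ : Plane => |2 * Real.pi * ξ j|) := by fun_prop
    exact (Complex.continuous_ofReal.comp (h0.rpow_const fun _ => Or.inr hr)).mul X.continuous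
  have hcont' : ∀ (j : Fin 2),
      Continuous (fun ξ : Plane => -(2 * Real.pi * Complex.I) * (ξ j) * X ξ) := by
    intro j
    have := X.continuous
    fun_prop
  have hfrac : ∀ (j : Fin 2), ∀ {r : ℝ}, 0 ≤ r → ∫ x, θ x * fracDeriv j r (𝓕 X) x =
      ∫ ξ, (𝓕 θ : L2) ξ * (((|2 * Real.pi * ξ j| ^ r : ℝ) : ℂ) * X ξ) := by
    intro j r hr
    rw [fracDeriv_fourier]
    exact integral_mul_fourier θ ((hcont j hr).integrable_of_hasCompactSupport hX.mul_left)
      ((hcont j hr).memLp_of_hasCompactSupport hX.mul_left)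
  have hint : ∀ (j : Fin 2), ∀ {r : ℝ}, 0 ≤ r →
      Integrable (fun ξ => (𝓕 θ : L2) ξ * (((|2 * Real.pi * ξ j| ^ r : ℝ) : ℂ) * X ξ)) :=
    fun j r hr => (Lp.memLp (𝓕 θ : L2)).integrable_mul
      (show MemLp _ 2 volume from (hcont j hr).memLp_of_hasCompactSupport hX.mul_left)
  have hadv : ∀ j : Fin 2,
      ∫ x, θ x * velocity θ j x * fderiv ℝ (𝓕 X : 𝓢(Plane, ℂ)) x (EuclideanSpace.single j 1) =
      ∫ ξ, convF (mulOp (memLp_velSymbol j) (𝓕 θ)) (𝓕 θ) ξ *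
        (-(2 * Real.pi * Complex.I) * (ξ j) * X ξ) := by
    intro j
    rw [← fourier_velocity, ← integral_mul_mul_fourier _ _
      ((hcont' j).integrable_of_hasCompactSupport hX.mul_left)]
    simp only [fderiv_fourier]
    congr 1
    ext x
    ring
  have hintA : ∀ j : Fin 2, Integrable (fun ξ => convF (mulOp (memLp_velSymbol j) (𝓕 θ)) (𝓕 θ) ξ *
        (-(2 * Real.pi * Complex.I) * (ξ j) * X ξ)) :=
    fun j => integrable_convF_mul _ _ ((hcont' j).integrable_of_hasCompactSupport hX.mul_left)
  have h2α : 0 ≤ 2 * α := by positivity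
  have h2β : 0 ≤ 2 * β := by positivity
  have hI : Integrable (fun ξ => ∑ j, convF (mulOp (memLp_velSymbol j) (𝓕 θ)) (𝓕 θ) ξ *
        (-(2 * Real.pi * Complex.I) * (ξ j) * X ξ)) := integrable_finsetSum _ (fun j _ => hintA j)
  have hI2 : Integrable (fun ξ => ∑ j, convF (mulOp (memLp_velSymbol j) (𝓕 θ)) (𝓕 θ) ξ *
        (-(2 * Real.pi * Complex.I) * (ξ j) * X ξ) -
        μ * ((𝓕 θ : L2) ξ * (((|2 * Real.pi * ξ 0| ^ (2 * α) : ℝ) : ℂ) * X ξ))) :=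
    hI.sub ((hint 0 h2α).const_mul _)
  rw [weakRHS, hfrac 0 h2α, hfrac 1 h2β]
  simp only [hadv]
  rw [← integral_finsetSum _ (fun j _ => hintA j), ← integral_const_mul, ← integral_const_mul,
    ← integral_sub hI ((hint 0 h2α).const_mul _), ← integral_sub hI2 ((hint 1 h2β).const_mul _)]
  congr 1
  ext ξ
  simp only [nonlin_eq_sum, dissip, Fin.sum_univ_two]
  push_cast
  ring

/-- The right-hand side of the equation on the Fourier side, localized by `κ`. -/
def localRHS (μ ν α β : ℝ) (hα : 0 ≤ α) (hβ : 0 ≤ β) (κ : 𝓢(Plane, ℂ)) (hκ : HasCompactSupport κ)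
    (ψ : L2) : L2 :=
  (∑ j : Fin 2, convL (κ := fun ξ : Plane => -(2 * Real.pi * Complex.I) * (ξ j) * κ ξ)
    (Continuous.memLp_of_hasCompactSupport (by have := κ.continuous; fun_prop) hκ.mul_left)
      (mulOp (memLp_velSymbol j) ψ) ψ)
  - mulOp (h := fun ξ => (dissip μ ν α β ξ : ℂ) * κ ξ)
    (Continuous.memLp_of_hasCompactSupport
      ((Complex.continuous_ofReal.comp (continuous_dissip hα hβ)).mul κ.continuous) hκ.mul_left) ψ

theorem continuous_localRHS (μ ν α β : ℝ) (hα : 0 ≤ α) (hβ : 0 ≤ β) (κ : 𝓢(Plane, ℂ))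
    (hκ : HasCompactSupport κ) : Continuous (localRHS μ ν α β hα hβ κ hκ) := by
  unfold localRHS
  fun_prop

theorem localRHS_coeFn (μ ν α β : ℝ) (hα : 0 ≤ α) (hβ : 0 ≤ β) (κ : 𝓢(Plane, ℂ))
    (hκ : HasCompactSupport κ) (ψ : L2) : localRHS μ ν α β hα hβ κ hκ ψ =ᵐ[volume]
      fun ξ => κ ξ * (nonlin ψ ξ - dissip μ ν α β ξ * ψ ξ) := by
  have hκ1 : ∀ j : Fin 2, MemLp (fun ξ : Plane => -(2 * Real.pi * Complex.I) * (ξ j) * κ ξ) 2 volume :=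
    fun j => Continuous.memLp_of_hasCompactSupport (by have := κ.continuous; fun_prop) hκ.mul_left
  have hκ2 : MemLp (fun ξ => (dissip μ ν α β ξ : ℂ) * κ ξ) ∞ volume :=
    Continuous.memLp_of_hasCompactSupport
      ((Complex.continuous_ofReal.comp (continuous_dissip hα hβ)).mul κ.continuous) hκ.mul_left
  rw [localRHS, Fin.sum_univ_two]
  filter_upwards [convL_coeFn (hκ1 0) (mulOp (memLp_velSymbol 0) ψ) ψ,
    convL_coeFn (hκ1 1) (mulOp (memLp_velSymbol 1) ψ) ψ, mulOp_coeFn hκ2 ψ,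
    Lp.coeFn_add (convL (hκ1 0) (mulOp (memLp_velSymbol 0) ψ) ψ)
      (convL (hκ1 1) (mulOp (memLp_velSymbol 1) ψ) ψ),
    Lp.coeFn_sub (convL (hκ1 0) (mulOp (memLp_velSymbol 0) ψ) ψ +
      convL (hκ1 1) (mulOp (memLp_velSymbol 1) ψ) ψ) (mulOp hκ2 ψ)] with ξ h0 h1 h2 h3 h4
  rw [h4, Pi.sub_apply, h3, Pi.add_apply, h0, h1, h2, nonlin_eq_sum, Fin.sum_univ_two]
  ring


/-! ### Frequency-localized evolution and energy -/

theorem enorm_le_sobolevNorm {s : ℝ} (hs : 0 ≤ s) (f : L2) : ‖f‖ₑ ≤ sobolevNorm s f := by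
  have h1 : ‖f‖ₑ = ‖(𝓕 f : L2)‖ₑ := by
    rw [← ofReal_norm, ← ofReal_norm, Lp.norm_fourier_eq]
  rw [h1, Lp.enorm_def, sobolevNorm]
  refine eLpNorm_mono fun ξ => ?_
  rw [norm_mul, Complex.norm_real, Real.norm_of_nonneg (by positivity)]
  refine le_mul_of_one_le_left (norm_nonneg _) (Real.one_le_rpow ?_ (by positivity))
  nlinarith [sq_nonneg (2 * Real.pi * ‖ξ‖)]

theorem IsGlobalSolution.continuousOn {μ ν α β s : ℝ} {θ : ℝ → L2} (hs : 0 ≤ s)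
    (h : IsGlobalSolution μ ν α β s θ) : ContinuousOn θ (Set.Ici 0) := by
  intro t₀ ht₀
  rw [ContinuousWithinAt, tendsto_iff_edist_tendsto_0]
  refine tendsto_of_tendsto_of_tendsto_of_le_of_le tendsto_const_nhds
    (h.continuous_sobolev t₀ ht₀) (fun _ => zero_le) fun t => ?_
  rw [edist_eq_enorm_sub]
  exact enorm_le_sobolevNorm hs _

theorem IsGlobalSolution.continuousOn_fourier {μ ν α β s : ℝ} {θ : ℝ → L2} (hs : 0 ≤ s)
    (h : IsGlobalSolution μ ν α β s θ) : ContinuousOn (fun t => (𝓕 (θ t) : L2)) (Set.Ici 0) :=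
  (Lp.fourierTransformₗᵢ Plane ℂ).continuous.comp_continuousOn (h.continuousOn hs)

variable {μ ν α β s : ℝ} {θ : ℝ → L2}

/-- The equation is known only after testing. Once frequencies are cut off by κ, the right-hand side
is a continuous curve in L², so the scalar identities for all test functions assemble into one
identity between L²-valued integrals. -/
theorem IsGlobalSolution.localized_integral (hs : 0 ≤ s) (h : IsGlobalSolution μ ν α β s θ)
    (hα : 0 ≤ α) (hβ : 0 ≤ β) (κ : 𝓢(Plane, ℂ)) (hκ : HasCompactSupport κ)
    (hκ' : MemLp κ ∞ volume) {t₀ t : ℝ} (ht₀ : 0 ≤ t₀) (ht : t₀ ≤ t) :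
    mulOp hκ' (𝓕 (θ t)) - mulOp hκ' (𝓕 (θ t₀)) =
      ∫ τ in t₀..t, localRHS μ ν α β hα hβ κ hκ (𝓕 (θ τ)) := by
  have hψ := h.continuousOn_fourier hs
  have hsub : Set.Icc t₀ t ⊆ Set.Ici 0 := fun τ hτ => ht₀.trans hτ.1
  have hG : ContinuousOn (fun τ => localRHS μ ν α β hα hβ κ hκ (𝓕 (θ τ))) (Set.Icc t₀ t) :=
    (continuous_localRHS μ ν α β hα hβ κ hκ).comp_continuousOn (hψ.mono hsub)
  refine eq_of_pair_schwartz fun χ => ?_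
  set ev : L2 →L[ℂ] ℂ := pair.flip (sl χ) with hev
  have hevdef : ∀ f : L2, pair f (sl χ) = ev f := fun f => rfl
  have hGi : IntervalIntegrable (fun τ => localRHS μ ν α β hα hβ κ hκ (𝓕 (θ τ))) volume t₀ t :=
    ContinuousOn.intervalIntegrable (by rwa [Set.uIcc_of_le ht])
  rw [hevdef, hevdef, ← ContinuousLinearMap.intervalIntegral_comp_comm _ hGi, map_sub]
  -- Pairing κ 𝓕 θ with χ is the same as testing θ with 𝓕 (κχ), so the weak equation applies with
  -- this test function.
  set X : 𝓢(Plane, ℂ) := SchwartzMap.pairing (ContinuousLinearMap.mul ℂ ℂ) κ χ with hX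
  have hXa : ∀ ξ, X ξ = κ ξ * χ ξ := fun ξ => by simp [hX, SchwartzMap.pairing_apply_apply]
  have hXc : HasCompactSupport X := by
    have : (X : Plane → ℂ) = κ * χ := funext hXa
    rw [this]
    exact hκ.mul_right
  have e1 : ∀ τ, ev (mulOp hκ' (𝓕 (θ τ))) = ∫ x, θ τ x * (𝓕 X : 𝓢(Plane, ℂ)) x := by
    intro τ
    have hX' : sl (𝓕 X) = (𝓕 (sl X) : L2) := (SchwartzMap.toLp_fourier_eq X).symm
    rw [← pair_schwartz, hX', ← pair_fourier, pair_schwartz, ← hevdef, pair_schwartz]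
    refine integral_congr_ae ?_
    filter_upwards [mulOp_coeFn hκ' (𝓕 (θ τ))] with ξ hξ
    rw [hξ, hXa]
    ring
  have e2 : ∀ τ, ev (localRHS μ ν α β hα hβ κ hκ (𝓕 (θ τ))) = weakRHS μ ν α β (θ τ) (𝓕 X) := by
    intro τ
    rw [weakRHS_fourier hα hβ _ _ hXc, ← hevdef, pair_schwartz]
    refine integral_congr_ae ?_
    filter_upwards [localRHS_coeFn μ ν α β hα hβ κ hκ (𝓕 (θ τ))] with ξ hξ
    rw [hξ, hXa]
    ring
  symm
  refine intervalIntegral.integral_eq_sub_of_hasDerivAt_of_le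
    (f := fun τ => ev (mulOp hκ' (𝓕 (θ τ)))) ht ?_ ?_ ?_
  · exact (ev.continuous.comp (mulOp hκ').continuous).comp_continuousOn (hψ.mono hsub)
  · intro τ hτ
    simp only [e1, e2]
    exact h.equation _ τ (ht₀.trans_lt hτ.1)
  · refine ContinuousOn.intervalIntegrable ?_
    rw [Set.uIcc_of_le ht]
    exact ev.continuous.comp_continuousOn hG

theorem IsGlobalSolution.localized_hasDerivAt (hs : 0 ≤ s) (h : IsGlobalSolution μ ν α β s θ)
    (hα : 0 ≤ α) (hβ : 0 ≤ β) (κ : 𝓢(Plane, ℂ)) (hκ : HasCompactSupport κ)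
    (hκ' : MemLp κ ∞ volume) {t : ℝ} (ht : 0 < t) :
    HasDerivAt (fun τ => mulOp hκ' (𝓕 (θ τ))) (localRHS μ ν α β hα hβ κ hκ (𝓕 (θ t))) t := by
  have hψ := h.continuousOn_fourier hs
  have hG : ContinuousOn (fun τ => localRHS μ ν α β hα hβ κ hκ (𝓕 (θ τ))) (Set.Ici 0) :=
    (continuous_localRHS μ ν α β hα hβ κ hκ).comp_continuousOn hψ
  have hGi : IntervalIntegrable (fun τ => localRHS μ ν α β hα hβ κ hκ (𝓕 (θ τ))) volume 0 t :=
    ContinuousOn.intervalIntegrable (by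
      rw [Set.uIcc_of_le ht.le]
      exact hG.mono fun τ hτ => hτ.1)
  have h1 := intervalIntegral.integral_hasDerivAt_right hGi
    ((hG.mono Set.Ioi_subset_Ici_self).stronglyMeasurableAtFilter isOpen_Ioi t ht)
    (hG.continuousAt (Ici_mem_nhds ht))
  refine (h1.const_add (mulOp hκ' (𝓕 (θ 0)))).congr_of_eventuallyEq ?_
  filter_upwards [Ioi_mem_nhds ht] with τ hτ
  rw [← h.localized_integral hs hα hβ κ hκ hκ' le_rfl (le_of_lt hτ)]
  abel

/-- A smooth cutoff κ equal to 1 on the support of w provides strong differentiability in L²; the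
weight itself, only bounded and measurable, is then inserted as a fixed bounded multiplier. -/
theorem IsGlobalSolution.energy_local (hs : 0 ≤ s) (h : IsGlobalSolution μ ν α β s θ)
    (hα : 0 ≤ α) (hβ : 0 ≤ β) {w : Plane → ℝ} (hw : Measurable w) (hw0 : ∀ ξ, 0 ≤ w ξ)
    {C K : ℝ} (hwC : ∀ ξ, w ξ ≤ C) (hwK : ∀ ξ, K < ‖ξ‖ → w ξ = 0) {t₀ t : ℝ} (ht₀ : 0 ≤ t₀)
    (ht : t₀ ≤ t) :
    ContinuousOn (fun τ => ∫ ξ, w ξ * inner ℝ ((𝓕 (θ τ) : L2) ξ)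
      (nonlin (𝓕 (θ τ)) ξ - dissip μ ν α β ξ * (𝓕 (θ τ) : L2) ξ)) (Set.Icc t₀ t) ∧
    (∫ ξ, w ξ * ‖(𝓕 (θ t) : L2) ξ‖ ^ 2) - ∫ ξ, w ξ * ‖(𝓕 (θ t₀) : L2) ξ‖ ^ 2 =
      ∫ τ in t₀..t, 2 * ∫ ξ, w ξ * inner ℝ ((𝓕 (θ τ) : L2) ξ)
        (nonlin (𝓕 (θ τ)) ξ - dissip μ ν α β ξ * (𝓕 (θ τ) : L2) ξ) := by
  obtain ⟨K', hK', hKK'⟩ : ∃ K' : ℝ, 0 < K' ∧ K ≤ K' := ⟨max K 1, by positivity, le_max_left _ _⟩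
  let b : ContDiffBump (0 : Plane) := ⟨K', K' + 1, hK', by linarith⟩
  have hbc : HasCompactSupport (fun ξ => (b ξ : ℂ)) :=
    b.hasCompactSupport.comp_left (g := fun r : ℝ => (r : ℂ)) rfl
  have hbs : ContDiff ℝ ((⊤ : ℕ∞) : WithTop ℕ∞) (fun ξ => (b ξ : ℂ)) :=
    Complex.ofRealCLM.contDiff.comp b.contDiff
  set κ : 𝓢(Plane, ℂ) := hbc.toSchwartzMap hbs with hκdef
  have hκ : HasCompactSupport κ := hbc
  have hκ' : MemLp κ ∞ volume := κ.continuous.memLp_of_hasCompactSupport hκ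
  have hκ1 : ∀ ξ, w ξ ≠ 0 → κ ξ = 1 := by
    intro ξ hξ
    have : ξ ∈ Metric.closedBall (0 : Plane) K' := by
      rw [mem_closedBall_zero_iff]
      by_contra hc
      exact hξ (hwK ξ (hKK'.trans_lt (not_le.1 hc)))
    have h2 : b ξ = 1 := b.one_of_mem_closedBall this
    show ((b ξ : ℝ) : ℂ) = 1
    rw [h2, Complex.ofReal_one]
  have hv : MemLp (fun ξ => (Real.sqrt (w ξ) : ℂ)) ∞ (volume : Measure Plane) := by
    refine memLp_top_of_bound (C := Real.sqrt C) ?_ (Eventually.of_forall fun ξ => ?_)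
    · exact (Complex.measurable_ofReal.comp hw.sqrt).aestronglyMeasurable
    · rw [Complex.norm_real, Real.norm_of_nonneg (Real.sqrt_nonneg _)]
      exact Real.sqrt_le_sqrt (hwC ξ)
  have hψ := h.continuousOn_fourier hs
  have hsub : Set.Icc t₀ t ⊆ Set.Ici 0 := fun τ hτ => ht₀.trans hτ.1
  -- Splitting w as √w · √w makes ‖Y‖² the weighted energy and ⟨Y, G⟩ half of its derivative.
  set Y : ℝ → L2 := fun τ => mulOp hv (mulOp hκ' (𝓕 (θ τ))) with hY
  set G : ℝ → L2 := fun τ => mulOp hv (localRHS μ ν α β hα hβ κ hκ (𝓕 (θ τ))) with hG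
  have hYc : ContinuousOn Y (Set.Icc t₀ t) :=
    ((mulOp hv).continuous.comp (mulOp hκ').continuous).comp_continuousOn (hψ.mono hsub)
  have hGc : ContinuousOn G (Set.Icc t₀ t) :=
    ((mulOp hv).continuous.comp (continuous_localRHS μ ν α β hα hβ κ hκ)).comp_continuousOn
      (hψ.mono hsub)
  have hYcoe : ∀ τ, Y τ =ᵐ[volume] fun ξ => (Real.sqrt (w ξ) : ℂ) * (κ ξ * (𝓕 (θ τ) : L2) ξ) := by
    intro τ
    filter_upwards [mulOp_coeFn hv (mulOp hκ' (𝓕 (θ τ))), mulOp_coeFn hκ' (𝓕 (θ τ))] with ξ h1 h2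
    rw [h1, h2]
  have hE : ∀ τ, ‖Y τ‖ ^ 2 = ∫ ξ, w ξ * ‖(𝓕 (θ τ) : L2) ξ‖ ^ 2 := by
    intro τ
    rw [← real_inner_self_eq_norm_sq, L2.inner_def]
    refine integral_congr_ae ?_
    filter_upwards [hYcoe τ] with ξ h1
    rw [h1, real_inner_self_eq_norm_sq]
    by_cases h0 : w ξ = 0
    · simp [h0]
    · rw [hκ1 ξ h0, one_mul, norm_mul, mul_pow, Complex.norm_real,
        Real.norm_of_nonneg (Real.sqrt_nonneg _), Real.sq_sqrt (hw0 ξ)]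
  have hI : ∀ τ, inner ℝ (Y τ) (G τ) = ∫ ξ, w ξ * inner ℝ ((𝓕 (θ τ) : L2) ξ)
      (nonlin (𝓕 (θ τ)) ξ - dissip μ ν α β ξ * (𝓕 (θ τ) : L2) ξ) := by
    intro τ
    rw [L2.inner_def]
    refine integral_congr_ae ?_
    filter_upwards [hYcoe τ, mulOp_coeFn hv (localRHS μ ν α β hα hβ κ hκ (𝓕 (θ τ))),
      localRHS_coeFn μ ν α β hα hβ κ hκ (𝓕 (θ τ))] with ξ h1 h2 h3
    rw [h1, h2, h3]
    by_cases h0 : w ξ = 0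
    · simp [h0]
    · rw [hκ1 ξ h0, one_mul, one_mul, ← Complex.real_smul, ← Complex.real_smul,
        real_inner_smul_left, real_inner_smul_right, ← mul_assoc, Real.mul_self_sqrt (hw0 ξ)]
  simp only [← hI]
  rw [← hE t, ← hE t₀]
  have hIc : ContinuousOn (fun τ => inner ℝ (Y τ) (G τ)) (Set.Icc t₀ t) := hYc.inner hGc
  refine ⟨hIc, ?_⟩
  symm
  refine intervalIntegral.integral_eq_sub_of_hasDerivAt_of_le (f := fun τ => ‖Y τ‖ ^ 2) ht
    (hYc.norm.pow 2) ?_ ?_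
  · intro τ hτ
    have h1 := h.localized_hasDerivAt hs hα hβ κ hκ hκ' (ht₀.trans_lt hτ.1)
    have h2 : HasDerivAt Y (G τ) τ :=
      ((mulOp hv).restrictScalars ℝ).hasFDerivAt.comp_hasDerivAt τ h1
    exact h2.norm_sq
  · refine ContinuousOn.intervalIntegrable ?_
    rw [Set.uIcc_of_le ht]
    exact continuousOn_const.mul hIc


/-! ### Absolute convergence of the transport term in H^s -/

theorem lintegral_mul_sq_le {X : Type*} [MeasurableSpace X] {μ : Measure X} {f g : X → ℝ≥0∞}
    (hf : AEMeasurable f μ) (hg : AEMeasurable g μ) :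
    (∫⁻ x, f x * g x ∂μ) ^ 2 ≤ (∫⁻ x, f x ^ 2 ∂μ) * ∫⁻ x, g x ^ 2 ∂μ := by
  have h := ENNReal.lintegral_mul_le_Lp_mul_Lq μ Real.HolderConjugate.two_two hf hg
  have h2 : ∀ a : ℝ≥0∞, (a ^ (1 / (2 : ℝ))) ^ 2 = a := by
    intro a
    rw [← ENNReal.rpow_natCast, ← ENNReal.rpow_mul]
    norm_num
  calc (∫⁻ x, f x * g x ∂μ) ^ 2
      ≤ ((∫⁻ x, f x ^ (2 : ℝ) ∂μ) ^ (1 / (2 : ℝ)) * (∫⁻ x, g x ^ (2 : ℝ) ∂μ) ^ (1 / (2 : ℝ))) ^ 2 := by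
        gcongr
        exact h
    _ = _ := by
        rw [mul_pow, h2, h2]
        simp only [ENNReal.rpow_two]

theorem measurable_enorm_L2 (ψ : L2) : Measurable (fun ξ => ‖ψ ξ‖ₑ) :=
  (Lp.stronglyMeasurable ψ).enorm

theorem abs_wedge_le (a b : Plane) : |wedge a b| ≤ ‖a‖ * ‖b‖ := by
  refine abs_le_of_sq_le_sq ?_ (by positivity)
  rw [mul_pow, EuclideanSpace.norm_sq_eq, EuclideanSpace.norm_sq_eq]
  simp only [Fin.sum_univ_two, Real.norm_eq_abs, sq_abs, wedge]
  nlinarith [sq_nonneg (a 0 * b 0 + a 1 * b 1)]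

theorem wedge_sub_right (a b : Plane) : wedge a (b - a) = wedge a b := by
  simp only [wedge, PiLp.sub_apply]
  ring

/-- Since η ∧ η = 0, η ∧ ξ = η ∧ (ξ - η): by incompressibility the derivative falls on the advected
factor. -/
theorem abs_wedge_div_le (η ξ : Plane) : |wedge η ξ / ‖η‖| ≤ ‖ξ - η‖ := by
  rw [abs_div, abs_norm]
  refine div_le_of_le_mul₀ (norm_nonneg _) (norm_nonneg _) ?_
  rw [← wedge_sub_right, mul_comm]
  exact abs_wedge_le _ _

theorem abs_wedge_div_le' (η ξ : Plane) : |wedge η ξ / ‖η‖| ≤ ‖ξ‖ := by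
  rw [abs_div, abs_norm]
  refine div_le_of_le_mul₀ (norm_nonneg _) (norm_nonneg _) ?_
  rw [mul_comm]
  exact abs_wedge_le _ _

theorem measurable_wedge : Measurable (fun p : Plane × Plane => wedge p.2 p.1) := by
  unfold wedge
  fun_prop

/-- The squared Sobolev norm on the Fourier side. -/
def sob (s : ℝ) (ψ : L2) : ℝ≥0∞ := ∫⁻ ξ, ENNReal.ofReal ((1 + ‖ξ‖ ^ 2) ^ s) * ‖ψ ξ‖ₑ ^ 2

theorem eLpNorm_two_sq {f : Plane → ℂ} : eLpNorm f 2 volume ^ 2 = ∫⁻ ξ, ‖f ξ‖ₑ ^ 2 := by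
  rw [eLpNorm_eq_lintegral_rpow_enorm_toReal (by norm_num) (by norm_num), ← ENNReal.rpow_natCast,
    ← ENNReal.rpow_mul]
  simp

theorem sobolevNorm_sq (s : ℝ) (f : L2) : sobolevNorm s f ^ 2 =
    ∫⁻ ξ, ENNReal.ofReal ((1 + (2 * Real.pi * ‖ξ‖) ^ 2) ^ s) * ‖(𝓕 f : L2) ξ‖ₑ ^ 2 := by
  rw [sobolevNorm, eLpNorm_two_sq]
  refine lintegral_congr fun ξ => ?_
  rw [enorm_mul, mul_pow]
  congr 1
  have h0 : 0 ≤ (1 + (2 * Real.pi * ‖ξ‖) ^ 2) ^ (s / 2) := by positivity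
  rw [← ofReal_norm, Complex.norm_real, Real.norm_of_nonneg h0, ← ENNReal.ofReal_pow h0,
    ← Real.rpow_natCast, ← Real.rpow_mul (by positivity)]
  norm_num

theorem sob_le_sobolevNorm_sq {s : ℝ} (hs : 0 ≤ s) (f : L2) :
    sob s (𝓕 f) ≤ sobolevNorm s f ^ 2 := by
  rw [sobolevNorm_sq, sob]
  refine lintegral_mono fun ξ => ?_
  dsimp only
  gcongr ENNReal.ofReal (?_ ^ s) * _
  have h1 : ‖ξ‖ ≤ 2 * Real.pi * ‖ξ‖ := by
    nlinarith [norm_nonneg ξ, Real.pi_gt_three]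
  nlinarith [norm_nonneg ξ]

theorem sobolevNorm_sub_triangle (s : ℝ) (f g : L2) :
    sobolevNorm s f ≤ sobolevNorm s (f - g) + sobolevNorm s g := by
  have hm : Measurable (fun ξ : Plane => (((1 + (2 * Real.pi * ‖ξ‖) ^ 2) ^ (s / 2) : ℝ) : ℂ)) := by
    fun_prop
  have h1 : (𝓕 (f - g) : L2) = 𝓕 f - 𝓕 g := (Lp.fourierTransformₗᵢ Plane ℂ).map_sub f g
  unfold sobolevNorm
  refine le_trans (le_of_eq ?_) (eLpNorm_add_le ?_ ?_ one_le_two)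
  · refine eLpNorm_congr_ae ?_
    filter_upwards [Lp.coeFn_sub (𝓕 f : L2) (𝓕 g : L2)] with ξ h2
    rw [Pi.add_apply, h1, h2, Pi.sub_apply]
    ring
  · exact hm.aestronglyMeasurable.mul (Lp.aestronglyMeasurable _)
  · exact hm.aestronglyMeasurable.mul (Lp.aestronglyMeasurable _)

/-- Continuity into H^s bounds the norm near each time, and compactness of [0, T] makes the bound
uniform. It supplies the dominating constants when frequency cutoffs are removed. -/
theorem IsGlobalSolution.exists_sobolev_bound {μ ν α β s : ℝ} {θ : ℝ → L2}
    (h : IsGlobalSolution μ ν α β s θ) (hs : 0 ≤ s) (T : ℝ) :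
    ∃ M : ℝ≥0∞, M < ∞ ∧ ∀ τ ∈ Set.Icc 0 T, sob s (𝓕 (θ τ)) ≤ M := by
  refine isCompact_Icc.induction_on (p := fun S => ∃ M : ℝ≥0∞, M < ∞ ∧ ∀ τ ∈ S, sob s (𝓕 (θ τ)) ≤ M)
    ⟨0, by simp, by simp⟩ ?_ ?_ ?_
  · rintro S S' hSS' ⟨M, hM, hM'⟩
    exact ⟨M, hM, fun τ hτ => hM' τ (hSS' hτ)⟩
  · rintro S S' ⟨M, hM, hM'⟩ ⟨N, hN, hN'⟩
    refine ⟨max M N, max_lt hM hN, ?_⟩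
    rintro τ (hτ | hτ)
    · exact (hM' τ hτ).trans (le_max_left _ _)
    · exact (hN' τ hτ).trans (le_max_right _ _)
  · intro t₀ ht₀
    have h1 := (h.continuous_sobolev t₀ ht₀.1).eventually (gt_mem_nhds zero_lt_one)
    refine ⟨_, nhdsWithin_mono _ Set.Icc_subset_Ici_self h1, (1 + sobolevNorm s (θ t₀)) ^ 2, ?_, ?_⟩
    · exact ENNReal.pow_lt_top (ENNReal.add_lt_top.2 ⟨ENNReal.one_lt_top, h.mem_sobolev t₀ ht₀.1⟩)
    · intro τ hτ
      refine (sob_le_sobolevNorm_sq hs _).trans ?_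
      gcongr
      refine (sobolevNorm_sub_triangle s _ (θ t₀)).trans ?_
      gcongr
      exact le_of_lt hτ

theorem lintegral_enorm_sq_le_sob {s : ℝ} (hs : 0 ≤ s) (ψ : L2) : ∫⁻ ξ, ‖ψ ξ‖ₑ ^ 2 ≤ sob s ψ := by
  refine lintegral_mono fun ξ => ?_
  refine le_mul_of_one_le_left zero_le ?_
  rw [ENNReal.one_le_ofReal]
  exact Real.one_le_rpow (by nlinarith [sq_nonneg ‖ξ‖]) hs

theorem lintegral_norm_mul_sq_le_sob {s : ℝ} (hs : 1 ≤ s) (ψ : L2) :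
    ∫⁻ ξ, (‖ξ‖ₑ * ‖ψ ξ‖ₑ) ^ 2 ≤ sob s ψ := by
  refine lintegral_mono fun ξ => ?_
  dsimp only
  rw [mul_pow]
  gcongr
  rw [← ofReal_norm, ← ENNReal.ofReal_pow (norm_nonneg _)]
  refine ENNReal.ofReal_le_ofReal ?_
  have := Real.rpow_le_rpow_of_exponent_le (x := 1 + ‖ξ‖ ^ 2) (by nlinarith [sq_nonneg ‖ξ‖]) hs
  rw [Real.rpow_one] at this
  linarith

theorem lintegral_bracket_lt_top {s : ℝ} (hs : 1 < s) :
    ∫⁻ ξ : Plane, ENNReal.ofReal ((1 + ‖ξ‖ ^ 2) ^ (-s)) < ∞ := by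
  have h := integrable_rpow_neg_one_add_norm_sq (E := Plane) (μ := volume) (r := 2 * s)
    (by simp; linarith)
  have h2 := h.lintegral_lt_top
  convert h2 using 5
  ring

/-- Cauchy–Schwarz against the weight (1 + |ξ|²)^{-s}, whose integral over the plane is finite for s
> 1: this is the embedding of H^s into functions with integrable transform. -/
theorem lintegral_enorm_sq_le {s : ℝ} (ψ : L2) :
    (∫⁻ ξ, ‖ψ ξ‖ₑ) ^ 2 ≤ (∫⁻ ξ : Plane, ENNReal.ofReal ((1 + ‖ξ‖ ^ 2) ^ (-s))) * sob s ψ := by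
  have hp : ∀ ξ : Plane, 0 < 1 + ‖ξ‖ ^ 2 := fun ξ => by positivity
  have h := lintegral_mul_sq_le (μ := (volume : Measure Plane))
    (f := fun ξ => ENNReal.ofReal ((1 + ‖ξ‖ ^ 2) ^ (-s / 2)))
    (g := fun ξ => ENNReal.ofReal ((1 + ‖ξ‖ ^ 2) ^ (s / 2)) * ‖ψ ξ‖ₑ)
    (by fun_prop) (by have := measurable_enorm_L2 ψ; fun_prop)
  have e : ∀ (ξ : Plane) (r : ℝ), ENNReal.ofReal ((1 + ‖ξ‖ ^ 2) ^ (r / 2)) ^ 2 =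
      ENNReal.ofReal ((1 + ‖ξ‖ ^ 2) ^ r) := by
    intro ξ r
    rw [← ENNReal.ofReal_pow (by positivity), ← Real.rpow_natCast, ← Real.rpow_mul (hp ξ).le]
    norm_num
  simp only [mul_pow, e] at h
  refine le_trans (le_of_eq ?_) h
  congr 1
  refine lintegral_congr fun ξ => ?_
  rw [← mul_assoc, ← ENNReal.ofReal_mul (by positivity), ← Real.rpow_add (hp ξ)]
  simp [neg_div]

/-- The trilinear integral that controls the transport term absolutely. -/
def absTri (ψ : L2) : ℝ≥0∞ := ∫⁻ ξ, ∫⁻ η, ‖ψ ξ‖ₑ * (‖ψ η‖ₑ * (‖ξ - η‖ₑ * ‖ψ (ξ - η)‖ₑ))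

/-- By Tonelli, ψ(η) is integrated last; for fixed η, Cauchy–Schwarz in ξ pairs ‖ψ‖ with the
translation-invariant norm of |·|ψ. -/
theorem absTri_le {s : ℝ} (hs : 1 ≤ s) (ψ : L2) : absTri ψ ≤ (∫⁻ ξ, ‖ψ ξ‖ₑ) * sob s ψ := by
  have hm := measurable_enorm_L2 ψ
  have hm2 : Measurable (fun p : Plane × Plane => ‖ψ (p.1 - p.2)‖ₑ) :=
    hm.comp (measurable_fst.sub measurable_snd)
  rw [absTri, lintegral_lintegral_swap]
  · rw [← lintegral_mul_const _ hm]
    refine lintegral_mono fun η => ?_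
    dsimp only
    have e : ∀ ξ, ‖ψ ξ‖ₑ * (‖ψ η‖ₑ * (‖ξ - η‖ₑ * ‖ψ (ξ - η)‖ₑ)) =
        ‖ψ η‖ₑ * (‖ψ ξ‖ₑ * (‖ξ - η‖ₑ * ‖ψ (ξ - η)‖ₑ)) := fun ξ => by ring
    simp only [e]
    have hm3 : Measurable (fun ξ => ‖ξ - η‖ₑ * ‖ψ (ξ - η)‖ₑ) :=
      (by fun_prop : Measurable (fun ξ : Plane => ‖ξ - η‖ₑ)).mul
        (hm.comp (measurable_id.sub_const η))
    rw [lintegral_const_mul _ (show Measurable (fun ξ => ‖ψ ξ‖ₑ * (‖ξ - η‖ₑ * ‖ψ (ξ - η)‖ₑ)) from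
      hm.mul hm3)]
    gcongr
    rw [← ENNReal.pow_le_pow_left_iff (n := 2) two_ne_zero]
    refine (lintegral_mul_sq_le hm.aemeasurable hm3.aemeasurable).trans ?_
    rw [sq]
    gcongr
    · exact lintegral_enorm_sq_le_sob (by linarith) ψ
    · rw [lintegral_sub_right_eq_self (fun ξ => (‖ξ‖ₑ * ‖ψ ξ‖ₑ) ^ 2) η]
      exact lintegral_norm_mul_sq_le_sob hs ψ
  · refine Measurable.aemeasurable ?_
    have h1 : Measurable (fun p : Plane × Plane => ‖p.1 - p.2‖ₑ) := by fun_prop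
    exact (hm.comp measurable_fst).mul ((hm.comp measurable_snd).mul (h1.mul hm2))

theorem absTri_lt_top {s : ℝ} (hs : 1 < s) (ψ : L2) (h : sob s ψ < ∞) : absTri ψ < ∞ := by
  refine (absTri_le hs.le ψ).trans_lt (ENNReal.mul_lt_top ?_ h)
  have h1 := (lintegral_enorm_sq_le (s := s) ψ).trans_lt
    (ENNReal.mul_lt_top (lintegral_bracket_lt_top hs) h)
  by_contra hc
  rw [not_lt, top_le_iff] at hc
  simp [hc] at h1

theorem absTri_sq_le {s : ℝ} (hs : 1 < s) (ψ : L2) : absTri ψ ^ 2 ≤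
    (∫⁻ ξ : Plane, ENNReal.ofReal ((1 + ‖ξ‖ ^ 2) ^ (-s))) * sob s ψ ^ 3 := by
  calc absTri ψ ^ 2 ≤ ((∫⁻ ξ, ‖ψ ξ‖ₑ) * sob s ψ) ^ 2 := by
        gcongr
        exact absTri_le hs.le ψ
    _ = (∫⁻ ξ, ‖ψ ξ‖ₑ) ^ 2 * sob s ψ ^ 2 := mul_pow _ _ _
    _ ≤ ((∫⁻ ξ : Plane, ENNReal.ofReal ((1 + ‖ξ‖ ^ 2) ^ (-s))) * sob s ψ) * sob s ψ ^ 2 := by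
        gcongr
        exact lintegral_enorm_sq_le ψ
    _ = _ := by ring

theorem dissip_nonneg {μ ν α β : ℝ} (hμ : 0 ≤ μ) (hν : 0 ≤ ν) (ξ : Plane) :
    0 ≤ dissip μ ν α β ξ := by
  unfold dissip
  positivity

theorem exists_dissip_le {μ ν α β s : ℝ} (hμ : 0 ≤ μ) (hν : 0 ≤ ν) (hα : 0 ≤ α) (hβ : 0 ≤ β)
    (hαs : α ≤ s) (hβs : β ≤ s) :
    ∃ C : ℝ, 0 ≤ C ∧ ∀ ξ, dissip μ ν α β ξ ≤ C * (1 + ‖ξ‖ ^ 2) ^ s := by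
  have key : ∀ (j : Fin 2) (a : ℝ), 0 ≤ a → a ≤ s → ∀ ξ : Plane, |2 * Real.pi * ξ j| ^ (2 * a) ≤
      (2 * Real.pi) ^ (2 * a) * (1 + ‖ξ‖ ^ 2) ^ s := by
    intro j a ha has ξ
    rw [abs_mul, Real.mul_rpow (abs_nonneg _) (abs_nonneg _), abs_of_pos (by positivity)]
    gcongr
    have h1 : |ξ j| ^ (2 * a) ≤ (1 + ‖ξ‖ ^ 2) ^ a := by
      rw [Real.rpow_mul (abs_nonneg _)]
      gcongr
      have h2 : |ξ j| ≤ ‖ξ‖ := PiLp.norm_apply_le ξ j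
      rw [Real.rpow_two]
      nlinarith [abs_nonneg (ξ j)]
    exact h1.trans (Real.rpow_le_rpow_of_exponent_le (by nlinarith [sq_nonneg ‖ξ‖]) has)
  refine ⟨μ * (2 * Real.pi) ^ (2 * α) + ν * (2 * Real.pi) ^ (2 * β), by positivity, fun ξ => ?_⟩
  have h0 := mul_le_mul_of_nonneg_left (key 0 α hα hαs ξ) hμ
  have h1 := mul_le_mul_of_nonneg_left (key 1 β hβ hβs ξ) hν
  rw [dissip]
  linarith


/-! ### The energy identity for bounded weights -/

theorem stronglyMeasurable_nonlin (ψ : L2) : StronglyMeasurable (nonlin ψ) := by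
  have h : StronglyMeasurable (fun p : Plane × Plane =>
      ((wedge p.2 p.1 / ‖p.2‖ : ℝ) : ℂ) * (ψ p.2 * ψ (p.1 - p.2))) := by
    refine StronglyMeasurable.mul ?_ ?_
    · refine Measurable.stronglyMeasurable ?_
      have := measurable_wedge
      fun_prop
    · exact ((Lp.stronglyMeasurable ψ).comp_measurable measurable_snd).mul
        ((Lp.stronglyMeasurable ψ).comp_measurable (measurable_fst.sub measurable_snd))
  exact (h.integral_prod_right').const_mul _

theorem enorm_wedge_div_le (η ξ : Plane) : ‖((wedge η ξ / ‖η‖ : ℝ) : ℂ)‖ₑ ≤ ‖ξ - η‖ₑ := by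
  rw [← ofReal_norm, ← ofReal_norm, Complex.norm_real, Real.norm_eq_abs]
  exact ENNReal.ofReal_le_ofReal (abs_wedge_div_le η ξ)

theorem enorm_nonlin_le (ψ : L2) (ξ : Plane) : ‖nonlin ψ ξ‖ₑ ≤
    ENNReal.ofReal (2 * Real.pi) * ∫⁻ η, ‖ψ η‖ₑ * (‖ξ - η‖ₑ * ‖ψ (ξ - η)‖ₑ) := by
  have h : ‖(2 * Real.pi : ℂ)‖ₑ = ENNReal.ofReal (2 * Real.pi) := by
    rw [← ofReal_norm]
    simp [abs_of_pos Real.pi_pos]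
  rw [nonlin, enorm_mul, h]
  gcongr
  refine (enorm_integral_le_lintegral_enorm _).trans (lintegral_mono fun η => ?_)
  rw [enorm_mul, enorm_mul, mul_left_comm]
  gcongr
  exact enorm_wedge_div_le η ξ

theorem lintegral_enorm_mul_nonlin_le (ψ : L2) :
    ∫⁻ ξ, ‖ψ ξ‖ₑ * ‖nonlin ψ ξ‖ₑ ≤ ENNReal.ofReal (2 * Real.pi) * absTri ψ := by
  rw [absTri, ← lintegral_const_mul']
  · refine lintegral_mono fun ξ => ?_
    dsimp only
    rw [lintegral_const_mul' _ _ (by simp), mul_left_comm]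
    gcongr
    exact enorm_nonlin_le ψ ξ
  · exact ENNReal.ofReal_ne_top

/-- The contribution of the transport term to the energy with weight `w`. -/
def tri (w : Plane → ℝ) (ψ : L2) : ℝ := ∫ ξ, w ξ * inner ℝ (ψ ξ) (nonlin ψ ξ)

/-- The contribution of the dissipation to the energy with weight `w`. -/
def dis (μ ν α β : ℝ) (w : Plane → ℝ) (ψ : L2) : ℝ :=
  ∫ ξ, w ξ * (dissip μ ν α β ξ * ‖ψ ξ‖ ^ 2)

theorem integrable_inner_nonlin {ψ : L2} (h : absTri ψ < ∞) :
    Integrable (fun ξ => inner ℝ (ψ ξ) (nonlin ψ ξ)) := by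
  refine ⟨(Lp.aestronglyMeasurable ψ).inner (stronglyMeasurable_nonlin ψ).aestronglyMeasurable, ?_⟩
  refine lt_of_le_of_lt (lintegral_mono fun ξ => ?_)
    ((lintegral_enorm_mul_nonlin_le ψ).trans_lt (ENNReal.mul_lt_top ENNReal.ofReal_lt_top h))
  rw [← ofReal_norm, ← ofReal_norm, ← ofReal_norm, ← ENNReal.ofReal_mul (norm_nonneg _)]
  exact ENNReal.ofReal_le_ofReal (norm_inner_le_norm _ _)

theorem integral_norm_inner_nonlin_le {ψ : L2} (h : absTri ψ < ∞) :
    ∫ ξ, ‖inner ℝ (ψ ξ) (nonlin ψ ξ)‖ ≤ 2 * Real.pi * (absTri ψ).toReal := by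
  rw [integral_norm_eq_lintegral_enorm (integrable_inner_nonlin h).1]
  have h1 : ∫⁻ ξ, ‖inner ℝ (ψ ξ) (nonlin ψ ξ)‖ₑ ≤ ENNReal.ofReal (2 * Real.pi) * absTri ψ := by
    refine (lintegral_mono fun ξ => ?_).trans (lintegral_enorm_mul_nonlin_le ψ)
    rw [← ofReal_norm, ← ofReal_norm, ← ofReal_norm, ← ENNReal.ofReal_mul (norm_nonneg _)]
    exact ENNReal.ofReal_le_ofReal (norm_inner_le_norm _ _)
  have h2 := ENNReal.toReal_mono (ENNReal.mul_lt_top ENNReal.ofReal_lt_top h).ne h1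
  rwa [ENNReal.toReal_mul, ENNReal.toReal_ofReal (by positivity)] at h2

theorem lintegral_dissip_le {C : ℝ} (hC0 : 0 ≤ C)
    (hC : ∀ ξ, dissip μ ν α β ξ ≤ C * (1 + ‖ξ‖ ^ 2) ^ s) (ψ : L2) :
    ∫⁻ ξ, ENNReal.ofReal (dissip μ ν α β ξ * ‖ψ ξ‖ ^ 2) ≤ ENNReal.ofReal C * sob s ψ := by
  rw [sob, ← lintegral_const_mul' _ _ (by simp)]
  refine lintegral_mono fun ξ => ?_
  dsimp only
  rw [← ofReal_norm, ← ENNReal.ofReal_pow (norm_nonneg _), ← ENNReal.ofReal_mul (by positivity),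
    ← ENNReal.ofReal_mul hC0, ← mul_assoc]
  gcongr
  exact hC ξ

theorem measurable_dissip : Measurable (dissip μ ν α β) := by
  unfold dissip
  fun_prop

theorem integrable_dissip (hμ : 0 ≤ μ) (hν : 0 ≤ ν) {C : ℝ} (hC0 : 0 ≤ C)
    (hC : ∀ ξ, dissip μ ν α β ξ ≤ C * (1 + ‖ξ‖ ^ 2) ^ s) {ψ : L2} (h : sob s ψ < ∞) :
    Integrable (fun ξ => dissip μ ν α β ξ * ‖ψ ξ‖ ^ 2) ∧
      ∫ ξ, dissip μ ν α β ξ * ‖ψ ξ‖ ^ 2 ≤ C * (sob s ψ).toReal := by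
  have hm : AEStronglyMeasurable (fun ξ => dissip μ ν α β ξ * ‖ψ ξ‖ ^ 2) volume :=
    measurable_dissip.aestronglyMeasurable.mul ((Lp.aestronglyMeasurable ψ).norm.pow 2)
  have h0 : ∀ ξ, 0 ≤ dissip μ ν α β ξ * ‖ψ ξ‖ ^ 2 := fun ξ =>
    mul_nonneg (dissip_nonneg hμ hν ξ) (by positivity)
  have h1 := lintegral_dissip_le hC0 hC ψ
  have hlt : ENNReal.ofReal C * sob s ψ < ∞ := ENNReal.mul_lt_top (by simp) h
  refine ⟨⟨hm, ?_⟩, ?_⟩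
  · rw [hasFiniteIntegral_iff_ofReal (Eventually.of_forall h0)]
    exact h1.trans_lt hlt
  · rw [integral_eq_lintegral_of_nonneg_ae (Eventually.of_forall h0) hm]
    refine (ENNReal.toReal_mono hlt.ne h1).trans_eq ?_
    rw [ENNReal.toReal_mul, ENNReal.toReal_ofReal hC0]

/-- The weighted energy. -/
def energy (w : Plane → ℝ) (ψ : L2) : ℝ := ∫ ξ, w ξ * ‖ψ ξ‖ ^ 2

theorem integrable_norm_sq (ψ : L2) : Integrable (fun ξ => ‖ψ ξ‖ ^ 2) :=
  (Lp.memLp ψ).integrable_norm_pow two_ne_zero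

theorem tendsto_integral_cutoff {w g : Plane → ℝ} (hw : Measurable w) {C : ℝ}
    (hw0 : ∀ ξ, 0 ≤ w ξ) (hwC : ∀ ξ, w ξ ≤ C) (hg : Integrable g) :
    Tendsto (fun n : ℕ => ∫ ξ, (Metric.closedBall 0 (n : ℝ)).indicator w ξ * g ξ) atTop
      (𝓝 (∫ ξ, w ξ * g ξ)) := by
  refine tendsto_integral_of_dominated_convergence (fun ξ => C * ‖g ξ‖)
    (fun n => (hw.indicator measurableSet_closedBall).aestronglyMeasurable.mul hg.1)
    (hg.norm.const_mul C) (fun n => Eventually.of_forall fun ξ => ?_)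
    (Eventually.of_forall fun ξ => ?_)
  · rw [norm_mul]
    gcongr
    rw [Real.norm_of_nonneg (Set.indicator_nonneg (fun ξ _ => hw0 ξ) ξ)]
    exact (Set.indicator_le_self' (fun ξ _ => hw0 ξ) ξ).trans (hwC ξ)
  · obtain ⟨N, hN⟩ := exists_nat_ge ‖ξ‖
    refine tendsto_const_nhds.congr' ?_
    filter_upwards [eventually_ge_atTop N] with n hn
    rw [Set.indicator_of_mem]
    rw [mem_closedBall_zero_iff]
    exact hN.trans (by exact_mod_cast hn)

theorem norm_integral_weight_le {w g : Plane → ℝ} {C : ℝ}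
    (hw0 : ∀ ξ, 0 ≤ w ξ) (hwC : ∀ ξ, w ξ ≤ C) (hg : Integrable g) :
    ‖∫ ξ, w ξ * g ξ‖ ≤ C * ∫ ξ, ‖g ξ‖ := by
  rw [← integral_const_mul]
  refine norm_integral_le_of_norm_le (hg.norm.const_mul C) (Eventually.of_forall fun ξ => ?_)
  rw [norm_mul, Real.norm_of_nonneg (hw0 ξ)]
  gcongr
  exact hwC ξ

theorem weight_mul_integrable {w g : Plane → ℝ} (hw : Measurable w) {C : ℝ}
    (hw0 : ∀ ξ, 0 ≤ w ξ) (hwC : ∀ ξ, w ξ ≤ C) (hg : Integrable g) :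
    Integrable (fun ξ => w ξ * g ξ) :=
  hg.bdd_mul (c := C) hw.aestronglyMeasurable (Eventually.of_forall fun ξ => by
    rw [Real.norm_of_nonneg (hw0 ξ)]
    exact hwC ξ)

/-- On a bounded set of frequencies the dissipation symbol is bounded, so the functional is the
squared norm of the image of ψ under the bounded multiplier √(w · dissip). -/
theorem continuousOn_dis_of_compact {ψ : ℝ → L2} {S : Set ℝ} (hψ : ContinuousOn ψ S)
    (hμ : 0 ≤ μ) (hν : 0 ≤ ν) (hα : 0 ≤ α) (hβ : 0 ≤ β)
    {w : Plane → ℝ} (hw : Measurable w) (hw0 : ∀ ξ, 0 ≤ w ξ)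
    {C K : ℝ} (hwC : ∀ ξ, w ξ ≤ C) (hwK : ∀ ξ, K < ‖ξ‖ → w ξ = 0) :
    ContinuousOn (fun τ => dis μ ν α β w (ψ τ)) S := by
  obtain ⟨B, hB⟩ := (isCompact_closedBall (0 : Plane) K).exists_bound_of_continuousOn
    (continuous_dissip (μ := μ) (ν := ν) hα hβ).continuousOn
  have hv : MemLp (fun ξ => (Real.sqrt (w ξ * dissip μ ν α β ξ) : ℂ)) ∞ (volume : Measure Plane) := by
    refine memLp_top_of_bound (C := Real.sqrt (C * B)) ?_ (Eventually.of_forall fun ξ => ?_)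
    · exact (Complex.measurable_ofReal.comp (hw.mul measurable_dissip).sqrt).aestronglyMeasurable
    · rw [Complex.norm_real, Real.norm_of_nonneg (Real.sqrt_nonneg _)]
      by_cases hξ : K < ‖ξ‖
      · simp [hwK ξ hξ]
      · have h1 := hB ξ (by rw [mem_closedBall_zero_iff]; exact not_lt.1 hξ)
        rw [Real.norm_of_nonneg (dissip_nonneg hμ hν ξ)] at h1
        exact Real.sqrt_le_sqrt (mul_le_mul (hwC ξ) h1 (dissip_nonneg hμ hν ξ)
          ((hw0 ξ).trans (hwC ξ)))
  have e : ∀ ψ : L2, dis μ ν α β w ψ = ‖mulOp hv ψ‖ ^ 2 := by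
    intro ψ
    rw [← real_inner_self_eq_norm_sq, L2.inner_def, dis]
    refine integral_congr_ae ?_
    filter_upwards [mulOp_coeFn hv ψ] with ξ h1
    rw [h1, real_inner_self_eq_norm_sq, norm_mul, mul_pow, Complex.norm_real,
      Real.norm_of_nonneg (Real.sqrt_nonneg _),
      Real.sq_sqrt (mul_nonneg (hw0 ξ) (dissip_nonneg hμ hν ξ)), mul_assoc]
  simp only [e]
  exact ((mulOp hv).continuous.comp_continuousOn hψ).norm.pow 2

/-- The energy identity for a bounded weight. -/
theorem IsGlobalSolution.energy_eq (hs : 1 < s) (h : IsGlobalSolution μ ν α β s θ)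
    (hμ : 0 ≤ μ) (hν : 0 ≤ ν) (hα : 0 ≤ α) (hβ : 0 ≤ β) (hα1 : α ≤ 1) (hβ1 : β ≤ 1)
    {w : Plane → ℝ} (hw : Measurable w) (hw0 : ∀ ξ, 0 ≤ w ξ)
    {C : ℝ} (hwC : ∀ ξ, w ξ ≤ C) {t₀ t : ℝ} (ht₀ : 0 ≤ t₀) (ht : t₀ ≤ t) :
    IntervalIntegrable (fun τ => tri w (𝓕 (θ τ))) volume t₀ t ∧
    IntervalIntegrable (fun τ => dis μ ν α β w (𝓕 (θ τ))) volume t₀ t ∧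
    energy w (𝓕 (θ t)) - energy w (𝓕 (θ t₀)) =
      ∫ τ in t₀..t, 2 * (tri w (𝓕 (θ τ)) - dis μ ν α β w (𝓕 (θ τ))) := by
  obtain ⟨M, hM, hMb⟩ := h.exists_sobolev_bound (by linarith) t
  obtain ⟨Cd, hCd0, hCd⟩ := exists_dissip_le hμ hν hα hβ (hα1.trans hs.le) (hβ1.trans hs.le)
  have hsub : Set.Icc t₀ t ⊆ Set.Ici 0 := fun τ hτ => ht₀.trans hτ.1
  have hψ := (h.continuousOn_fourier (by linarith)).mono hsub
  have hC0 : 0 ≤ C := (hw0 0).trans (hwC 0)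
  have hfin : ∀ τ ∈ Set.Icc t₀ t, sob s (𝓕 (θ τ)) < ∞ := fun τ hτ =>
    (hMb τ ⟨hsub hτ, hτ.2⟩).trans_lt hM
  -- The localized identity applies to the weight cut off at radius n; the limit n → ∞ uses bounds
  -- uniform in n and τ.
  set wn : ℕ → Plane → ℝ := fun n => (Metric.closedBall 0 (n : ℝ)).indicator w with hwn
  have hwn_meas : ∀ n, Measurable (wn n) := fun n => hw.indicator measurableSet_closedBall
  have hwn0 : ∀ n ξ, 0 ≤ wn n ξ := fun n ξ => Set.indicator_nonneg (fun ξ _ => hw0 ξ) ξ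
  have hwnC : ∀ n ξ, wn n ξ ≤ C := fun n ξ =>
    (Set.indicator_le_self' (fun ξ _ => hw0 ξ) ξ).trans (hwC ξ)
  have hwnK : ∀ (n : ℕ) ξ, (n : ℝ) < ‖ξ‖ → wn n ξ = 0 := by
    intro n ξ hξ
    refine Set.indicator_of_notMem ?_ _
    rw [mem_closedBall_zero_iff]
    exact not_le.2 hξ
  set A : ℝ := C * (Cd * M.toReal) with hA
  have hDb : ∀ n, ∀ τ ∈ Set.Icc t₀ t, ‖dis μ ν α β (wn n) (𝓕 (θ τ))‖ ≤ A := by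
    intro n τ hτ
    obtain ⟨h1, h2⟩ := integrable_dissip hμ hν hCd0 hCd (hfin τ hτ)
    refine (norm_integral_weight_le (hwn0 n) (hwnC n) h1).trans (mul_le_mul_of_nonneg_left ?_ hC0)
    have h3 : ∀ ξ, ‖dissip μ ν α β ξ * ‖(𝓕 (θ τ) : L2) ξ‖ ^ 2‖ =
        dissip μ ν α β ξ * ‖(𝓕 (θ τ) : L2) ξ‖ ^ 2 := fun ξ =>
      Real.norm_of_nonneg (mul_nonneg (dissip_nonneg hμ hν ξ) (by positivity))
    simp only [h3]
    refine h2.trans ?_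
    gcongr
    · exact hM.ne
    · exact hMb τ ⟨hsub hτ, hτ.2⟩
  set N : ℝ≥0∞ := (∫⁻ ξ : Plane, ENNReal.ofReal ((1 + ‖ξ‖ ^ 2) ^ (-s))) * M ^ 3 with hN
  have hNlt : N < ∞ := ENNReal.mul_lt_top (lintegral_bracket_lt_top hs) (ENNReal.pow_lt_top hM)
  -- The square of `absTri` is at most N, and x ≤ 1 + x² gives a bound without a square root.
  set A' : ℝ := C * (2 * Real.pi * (1 + N.toReal)) with hA'
  have htri : ∀ τ ∈ Set.Icc t₀ t, absTri (𝓕 (θ τ)) < ∞ := fun τ hτ =>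
    absTri_lt_top hs _ (hfin τ hτ)
  have hTb : ∀ n, ∀ τ ∈ Set.Icc t₀ t, ‖tri (wn n) (𝓕 (θ τ))‖ ≤ A' := by
    intro n τ hτ
    refine (norm_integral_weight_le (hwn0 n) (hwnC n) (integrable_inner_nonlin (htri τ hτ))).trans
      (mul_le_mul_of_nonneg_left ?_ hC0)
    refine (integral_norm_inner_nonlin_le (htri τ hτ)).trans ?_
    gcongr
    have h1 : absTri (𝓕 (θ τ)) ^ 2 ≤ N := by
      refine (absTri_sq_le hs _).trans ?_
      rw [hN]
      gcongr
      exact hMb τ ⟨hsub hτ, hτ.2⟩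
    have h2 := ENNReal.toReal_mono hNlt.ne h1
    rw [ENNReal.toReal_pow] at h2
    nlinarith [sq_nonneg ((absTri (𝓕 (θ τ))).toReal - 1)]
  have hDlim : ∀ τ ∈ Set.Icc t₀ t, Tendsto (fun n => dis μ ν α β (wn n) (𝓕 (θ τ))) atTop
      (𝓝 (dis μ ν α β w (𝓕 (θ τ)))) := fun τ hτ =>
    tendsto_integral_cutoff hw hw0 hwC (integrable_dissip hμ hν hCd0 hCd (hfin τ hτ)).1
  have hTlim : ∀ τ ∈ Set.Icc t₀ t, Tendsto (fun n => tri (wn n) (𝓕 (θ τ))) atTop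
      (𝓝 (tri w (𝓕 (θ τ)))) := fun τ hτ =>
    tendsto_integral_cutoff hw hw0 hwC (integrable_inner_nonlin (htri τ hτ))
  have hDc : ∀ n, ContinuousOn (fun τ => dis μ ν α β (wn n) (𝓕 (θ τ))) (Set.Icc t₀ t) := fun n =>
    continuousOn_dis_of_compact hψ hμ hν hα hβ (hwn_meas n) (hwn0 n) (hwnC n) (hwnK n)
  have hloc := fun n => h.energy_local (by linarith) hα hβ (hwn_meas n) (hwn0 n) (hwnC n) (hwnK n)
    ht₀ ht
  have hsplit : ∀ n, ∀ τ ∈ Set.Icc t₀ t, ∫ ξ, wn n ξ * inner ℝ ((𝓕 (θ τ) : L2) ξ)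
      (nonlin (𝓕 (θ τ)) ξ - dissip μ ν α β ξ * (𝓕 (θ τ) : L2) ξ) =
      tri (wn n) (𝓕 (θ τ)) - dis μ ν α β (wn n) (𝓕 (θ τ)) := by
    intro n τ hτ
    rw [tri, dis, ← integral_sub
      (weight_mul_integrable (hwn_meas n) (hwn0 n) (hwnC n) (integrable_inner_nonlin (htri τ hτ)))
      (weight_mul_integrable (hwn_meas n) (hwn0 n) (hwnC n)
        (integrable_dissip hμ hν hCd0 hCd (hfin τ hτ)).1)]
    congr 1
    ext ξ
    rw [inner_sub_right, ← Complex.real_smul, real_inner_smul_right, real_inner_self_eq_norm_sq]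
    ring
  -- Only the difference of transport and dissipation is known to be continuous from the localized
  -- identity; adding back the continuous dissipation isolates the transport term.
  have hTc : ∀ n, ContinuousOn (fun τ => tri (wn n) (𝓕 (θ τ))) (Set.Icc t₀ t) := by
    intro n
    refine ((hloc n).1.add (hDc n)).congr fun τ hτ => ?_
    simp only [Pi.add_apply, hsplit n τ hτ]
    ring
  have hioc : Set.uIoc t₀ t ⊆ Set.Icc t₀ t := by
    rw [Set.uIoc_of_le ht]
    exact Set.Ioc_subset_Icc_self
  have hae : ∀ {p : ℝ → Prop}, (∀ τ ∈ Set.Icc t₀ t, p τ) →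
      ∀ᵐ τ ∂(volume.restrict (Set.uIoc t₀ t)), p τ := fun hp =>
    (ae_restrict_iff' measurableSet_uIoc).2 (Eventually.of_forall fun τ hτ => hp τ (hioc hτ))
  have hmeas : ∀ {F : ℕ → ℝ → ℝ} {f : ℝ → ℝ}, (∀ n, ContinuousOn (F n) (Set.Icc t₀ t)) →
      (∀ τ ∈ Set.Icc t₀ t, Tendsto (fun n => F n τ) atTop (𝓝 (f τ))) →
      AEStronglyMeasurable f (volume.restrict (Set.uIoc t₀ t)) := fun hF hf =>
    aestronglyMeasurable_of_tendsto_ae atTop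
      (fun n => ((hF n).mono hioc).aestronglyMeasurable measurableSet_uIoc) (hae hf)
  have hint : ∀ {F : ℕ → ℝ → ℝ} {f : ℝ → ℝ} {B : ℝ}, (∀ n, ContinuousOn (F n) (Set.Icc t₀ t)) →
      (∀ n, ∀ τ ∈ Set.Icc t₀ t, ‖F n τ‖ ≤ B) →
      (∀ τ ∈ Set.Icc t₀ t, Tendsto (fun n => F n τ) atTop (𝓝 (f τ))) →
      IntervalIntegrable f volume t₀ t := by
    intro F f B hF hB hf
    refine (intervalIntegrable_const (c := B)).mono_fun (hmeas hF hf) (hae fun τ hτ => ?_)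
    refine (le_of_tendsto (hf τ hτ).norm (Eventually.of_forall fun n => hB n τ hτ)).trans ?_
    exact le_abs_self B
  refine ⟨hint hTc hTb hTlim, hint hDc hDb hDlim, ?_⟩
  have hElim : ∀ τ, Tendsto (fun n => energy (wn n) (𝓕 (θ τ))) atTop (𝓝 (energy w (𝓕 (θ τ)))) :=
    fun τ => tendsto_integral_cutoff hw hw0 hwC (integrable_norm_sq _)
  have hRlim : Tendsto (fun n => ∫ τ in t₀..t,
      2 * (tri (wn n) (𝓕 (θ τ)) - dis μ ν α β (wn n) (𝓕 (θ τ)))) atTop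
      (𝓝 (∫ τ in t₀..t, 2 * (tri w (𝓕 (θ τ)) - dis μ ν α β w (𝓕 (θ τ))))) := by
    refine intervalIntegral.tendsto_integral_filter_of_dominated_convergence (fun _ => 2 * (A' + A))
      (Eventually.of_forall fun n => ?_) (Eventually.of_forall fun n => ?_)
      intervalIntegrable_const ?_
    · exact ((continuousOn_const.mul ((hTc n).sub (hDc n))).mono hioc).aestronglyMeasurable
        measurableSet_uIoc
    · refine Eventually.of_forall fun τ hτ => ?_
      rw [norm_mul, Real.norm_of_nonneg (by norm_num : (0 : ℝ) ≤ 2)]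
      gcongr
      exact (norm_sub_le _ _).trans (add_le_add (hTb n τ (hioc hτ)) (hDb n τ (hioc hτ)))
    · exact Eventually.of_forall fun τ hτ =>
        ((hTlim τ (hioc hτ)).sub (hDlim τ (hioc hτ))).const_mul 2
  refine tendsto_nhds_unique ((hElim t).sub (hElim t₀)) (hRlim.congr fun n => ?_)
  rw [energy, energy, (hloc n).2]
  refine intervalIntegral.integral_congr fun τ hτ => ?_
  rw [Set.uIcc_of_le ht] at hτ
  simp only [hsplit n τ hτ]


/-! ### Pointwise bounds for the commutator kernel -/

/-- The profile `min (r, R)^s` of the truncated homogeneous weight. -/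
def prof (s R r : ℝ) : ℝ := min r R ^ s

theorem prof_nonneg {s R r : ℝ} (hR : 0 ≤ R) (hr : 0 ≤ r) : 0 ≤ prof s R r :=
  Real.rpow_nonneg (le_min hr hR) s

theorem prof_mono {s R r r' : ℝ} (hs : 0 ≤ s) (hR : 0 ≤ R) (hr : 0 ≤ r) (h : r ≤ r') :
    prof s R r ≤ prof s R r' :=
  Real.rpow_le_rpow (le_min hr hR) (min_le_min_right R h) hs

theorem prof_le_two_mul {s R r r' : ℝ} (hs : 0 ≤ s) (hR : 0 ≤ R) (hr : 0 ≤ r) (hr' : 0 ≤ r')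
    (h : r' ≤ 2 * r) : prof s R r' ≤ 2 ^ s * prof s R r := by
  rw [prof, prof, ← Real.mul_rpow (by norm_num) (le_min hr hR)]
  refine Real.rpow_le_rpow (le_min hr' hR) ?_ hs
  rcases le_total r R with h1 | h1
  · rw [min_eq_left h1]
    exact (min_le_left _ _).trans h
  · rw [min_eq_right h1]
    exact (min_le_right _ _).trans (by linarith)

/-- Relative Lipschitz bound for the squared profile. -/
theorem prof_sq_sub_le {s R r r' : ℝ} (hs : 1 ≤ s) (hR : 0 < R) (hr : 0 ≤ r) (h : r ≤ r')
    (hr' : 0 < r') :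
    prof s R r' ^ 2 - prof s R r ^ 2 ≤ 2 * s * prof s R r' ^ 2 * ((r' - r) / r') := by
  have hρ' : 0 < min r' R := lt_min hr' hR
  have hρ : 0 ≤ min r R := le_min hr hR.le
  have e : ∀ x : ℝ, 0 ≤ x → (x ^ s) ^ 2 = x ^ (2 * s) := by
    intro x hx
    rw [← Real.rpow_natCast, ← Real.rpow_mul hx]
    congr 1
    push_cast
    ring
  rw [prof, prof, e _ hρ, e _ hρ'.le]
  -- Truncation at R can only bring the two radii closer in ratio.
  have h1 : r / r' ≤ min r R / min r' R := by
    rw [div_le_div_iff₀ hr' hρ']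
    rcases le_total r' R with h2 | h2
    · rw [min_eq_left h2, min_eq_left (h.trans h2)]
    · rw [min_eq_right h2]
      rcases le_total r R with h3 | h3
      · rw [min_eq_left h3]
        exact mul_le_mul_of_nonneg_left h2 hr
      · rw [min_eq_right h3, mul_comm]
        exact mul_le_mul_of_nonneg_left h hR.le
  -- Bernoulli's inequality with exponent 2s ≥ 1 at the ratio of the truncated radii.
  have h2 := one_add_mul_self_le_rpow_one_add (s := min r R / min r' R - 1)
    (by linarith [div_nonneg hρ hρ'.le]) (p := 2 * s) (by linarith)
  rw [add_sub_cancel, Real.div_rpow hρ hρ'.le, le_div_iff₀ (by positivity)] at h2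
  have h3 : (r' - r) / r' = 1 - r / r' := by field_simp
  have h4 : 0 < min r' R ^ (2 * s) := by positivity
  have h5 : 2 * s * (r / r') * min r' R ^ (2 * s) ≤
      2 * s * (min r R / min r' R) * min r' R ^ (2 * s) := by gcongr
  rw [h3]
  nlinarith

theorem abs_prof_sq_sub_le {s R r r' N : ℝ} (hs : 1 ≤ s) (hR : 0 < R) (hr : 0 ≤ r) (hr' : 0 ≤ r')
    (hN : N = max r r') (hN0 : 0 < N) :
    |prof s R r ^ 2 - prof s R r' ^ 2| ≤ 2 * s * prof s R N ^ 2 * (|r - r'| / N) := by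
  subst hN
  wlog h : r ≤ r' generalizing r r'
  · rw [abs_sub_comm, abs_sub_comm r, max_comm]
    exact this hr' hr (by rwa [max_comm]) (le_of_not_ge h)
  rw [max_eq_right h] at hN0 ⊢
  have h1 : prof s R r ^ 2 ≤ prof s R r' ^ 2 :=
    pow_le_pow_left₀ (prof_nonneg hR.le hr) (prof_mono (by linarith) hR.le hr h) 2
  rw [abs_sub_comm, abs_of_nonneg (sub_nonneg.2 h1), abs_sub_comm, abs_of_nonneg (sub_nonneg.2 h)]
  exact prof_sq_sub_le hs hR hr h hN0

/-- The kernel that pairs the coordinate `i` dissipation with the low-frequency factor. -/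
def kern (i : Fin 2) (a : ℝ) (x y : Plane) : ℝ :=
  (if |x i| ≤ 4 * |y i| then |x i| * |y i| ^ (-(2 * a)) else 0) +
    (if ‖x‖ ≤ ‖y‖ then ‖x‖ * ‖y‖ ^ (-(2 * a)) else 0)

theorem kern_nonneg (i : Fin 2) (a : ℝ) (x y : Plane) : 0 ≤ kern i a x y := by
  unfold kern
  positivity

/-- Each of the two products in x ∧ y contains exactly one i-th coordinate; only the other factor is
bounded by a norm. This is why dissipation in the single direction i can suffice. -/
theorem abs_wedge_le_coord (i : Fin 2) (x y : Plane) :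
    |wedge x y| ≤ |x i| * ‖y‖ + ‖x‖ * |y i| := by
  have h0 : ∀ (x : Plane) j, |x j| ≤ ‖x‖ := fun x j => PiLp.norm_apply_le x j
  have h1 : |wedge x y| ≤ |x 0| * |y 1| + |x 1| * |y 0| := by
    rw [wedge, ← abs_mul, ← abs_mul]
    exact abs_sub _ _
  fin_cases i
  · refine h1.trans ?_
    simp only [Fin.zero_eta]
    gcongr
    · exact h0 y 1
    · exact h0 x 1
  · refine h1.trans ?_
    rw [add_comm]
    simp only [Fin.mk_one]
    gcongr
    · exact h0 y 0
    · exact h0 x 0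

/-- Let r, Y, Z be the moduli of the i-th coordinates of x, y, z; each is at most the sum of the
other two. If 4Y < r, then Z is comparable to r and the kernel in (x, z) absorbs the bound r + Y. If
4Z < r, the kernel in (x, y) does so in the same way. Otherwise Y ≤ r + Z ≤ 5Z, and the expanded
wedge r + |x| Y / |y| is matched term by term with the two summands of `kern` in (x, y). -/
theorem wedge_div_le_kern {a : ℝ} (ha0 : 0 < a) (ha : a ≤ 1 / 2) (i : Fin 2) {x y z : Plane}
    (hxyz : x + y + z = 0) (hxy : ‖x‖ ≤ ‖y‖) :
    |wedge x y| / ‖y‖ ≤ 5 * (kern i a x y * (|y i| ^ a * (|z i| ^ a + |x i| ^ a)) +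
      kern i a x z * (|z i| ^ a * (|y i| ^ a + |x i| ^ a))) := by
  have hwz : |wedge x z| = |wedge x y| := by
    have hz : z = -x - y := by
      rw [← sub_eq_zero, ← hxyz]
      abel
    rw [hz, ← abs_neg]
    congr 1
    simp only [wedge, PiLp.sub_apply, PiLp.neg_apply]
    ring
  have hsum : x i + y i + z i = 0 := by
    have := congrArg (fun v : Plane => v i) hxyz
    simpa using this
  have h0 : ∀ (x : Plane) j, |x j| ≤ ‖x‖ := fun x j => PiLp.norm_apply_le x j
  set r := |x i| with hr
  set Y := |y i| with hY
  set Z := |z i| with hZ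
  have hr0 : 0 ≤ r := abs_nonneg _
  have hY0 : 0 ≤ Y := abs_nonneg _
  have hZ0 : 0 ≤ Z := abs_nonneg _
  have hYrZ : Y ≤ r + Z := by
    have : y i = -(x i) - z i := by linarith
    rw [hY, this]
    exact (abs_sub _ _).trans_eq (by rw [abs_neg])
  have hZrY : Z ≤ r + Y := by
    have : z i = -(x i) - y i := by linarith
    rw [hZ, this]
    exact (abs_sub _ _).trans_eq (by rw [abs_neg])
  have hrYZ : r ≤ Y + Z := by
    have : x i = -(y i) - z i := by linarith
    rw [hr, this]
    exact (abs_sub _ _).trans_eq (by rw [abs_neg])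
  have hrhs0 : 0 ≤ kern i a x y * (Y ^ a * (Z ^ a + r ^ a)) :=
    mul_nonneg (kern_nonneg _ _ _ _) (by positivity)
  have hrhs1 : 0 ≤ kern i a x z * (Z ^ a * (Y ^ a + r ^ a)) :=
    mul_nonneg (kern_nonneg _ _ _ _) (by positivity)
  rcases (norm_nonneg y).eq_or_lt with hy0 | hy0
  · rw [← hy0, div_zero]
    positivity
  have hz_le : ‖z‖ ≤ 2 * ‖y‖ := by
    have : z = -x - y := by
      rw [← sub_eq_zero, ← hxyz]
      abel
    rw [this]
    refine (norm_sub_le _ _).trans ?_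
    rw [norm_neg]
    linarith
  have hAy : |wedge x y| / ‖y‖ ≤ r + ‖x‖ * Y / ‖y‖ := by
    rw [div_le_iff₀ hy0, add_mul, div_mul_cancel₀ _ hy0.ne']
    exact abs_wedge_le_coord i x y
  have hAy' : |wedge x y| / ‖y‖ ≤ r + Y := by
    refine hAy.trans ?_
    gcongr
    rw [div_le_iff₀ hy0, mul_comm]
    gcongr
  have hAz' : |wedge x y| / ‖y‖ ≤ 2 * (r + Z) := by
    rw [div_le_iff₀ hy0, ← hwz]
    refine (abs_wedge_le_coord i x z).trans ?_
    nlinarith [h0 x i, norm_nonneg x]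
  by_cases h4Y : 4 * Y < r
  · have hZpos : 0 < Z := by linarith
    have hrpos : 0 < r := by linarith
    have hk : r * Z ^ (-(2 * a)) ≤ kern i a x z := by
      rw [kern, if_pos (by rw [← hr, ← hZ]; linarith)]
      exact le_add_of_nonneg_right (by positivity)
    have h1 : 4 / 5 * r ≤ kern i a x z * (Z ^ a * (Y ^ a + r ^ a)) := by
      calc 4 / 5 * r ≤ r * (4 / 5 : ℝ) ^ a := by
            rw [mul_comm]
            gcongr
            exact Real.self_le_rpow_of_le_one (by norm_num) (by norm_num) (by linarith)
        _ ≤ r * (r / Z) ^ a := by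
            have h45 : 4 / 5 ≤ r / Z := by
              rw [div_le_div_iff₀ (by norm_num) hZpos]
              linarith
            exact mul_le_mul_of_nonneg_left (Real.rpow_le_rpow (by norm_num) h45 ha0.le) hr0
        _ = r * Z ^ (-(2 * a)) * (Z ^ a * r ^ a) := by
            rw [Real.div_rpow hr0 hZ0, Real.rpow_neg hZ0, two_mul, Real.rpow_add hZpos]
            field_simp
        _ ≤ kern i a x z * (Z ^ a * (Y ^ a + r ^ a)) := by
            have h46 : r ^ a ≤ Y ^ a + r ^ a := le_add_of_nonneg_left (Real.rpow_nonneg hY0 a)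
            exact mul_le_mul hk (mul_le_mul_of_nonneg_left h46 (Real.rpow_nonneg hZ0 a))
              (by positivity) (kern_nonneg _ _ _ _)
    linarith
  by_cases h4Z : 4 * Z < r
  · have hYpos : 0 < Y := by linarith
    have hrpos : 0 < r := by linarith
    have hk : r * Y ^ (-(2 * a)) ≤ kern i a x y := by
      rw [kern, if_pos (by rw [← hr, ← hY]; linarith)]
      exact le_add_of_nonneg_right (by positivity)
    have h1 : 4 / 5 * r ≤ kern i a x y * (Y ^ a * (Z ^ a + r ^ a)) := by
      calc 4 / 5 * r ≤ r * (4 / 5 : ℝ) ^ a := by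
            rw [mul_comm]
            gcongr
            exact Real.self_le_rpow_of_le_one (by norm_num) (by norm_num) (by linarith)
        _ ≤ r * (r / Y) ^ a := by
            have h45 : 4 / 5 ≤ r / Y := by
              rw [div_le_div_iff₀ (by norm_num) hYpos]
              linarith
            exact mul_le_mul_of_nonneg_left (Real.rpow_le_rpow (by norm_num) h45 ha0.le) hr0
        _ = r * Y ^ (-(2 * a)) * (Y ^ a * r ^ a) := by
            rw [Real.div_rpow hr0 hY0, Real.rpow_neg hY0, two_mul, Real.rpow_add hYpos]
            field_simp
        _ ≤ kern i a x y * (Y ^ a * (Z ^ a + r ^ a)) := by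
            have h46 : r ^ a ≤ Z ^ a + r ^ a := le_add_of_nonneg_left (Real.rpow_nonneg hZ0 a)
            exact mul_le_mul hk (mul_le_mul_of_nonneg_left h46 (Real.rpow_nonneg hY0 a))
              (by positivity) (kern_nonneg _ _ _ _)
    linarith
  rw [not_lt] at h4Y h4Z
  rcases hY0.eq_or_lt with hYe | hYpos
  · have : r = 0 := by linarith
    linarith
  have hk : r * Y ^ (-(2 * a)) + ‖x‖ * ‖y‖ ^ (-(2 * a)) ≤ kern i a x y := by
    rw [kern, if_pos h4Y, if_pos hxy]
  have h1 : 1 / 5 * (r + ‖x‖ * Y / ‖y‖) ≤ kern i a x y * (Y ^ a * (Z ^ a + r ^ a)) := by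
    calc 1 / 5 * (r + ‖x‖ * Y / ‖y‖) ≤ (1 / 5 : ℝ) ^ a * (r + ‖x‖ * (Y / ‖y‖) ^ (2 * a)) := by
          rw [mul_div_assoc]
          -- The hypothesis a ≤ 1/2 enters here: a number in [0, 1] is at most its power 2a.
          have h5 : Y / ‖y‖ ≤ (Y / ‖y‖) ^ (2 * a) :=
            Real.self_le_rpow_of_le_one (by positivity) (div_le_one_of_le₀ (h0 y i) hy0.le)
              (by linarith)
          have h6 : (1 / 5 : ℝ) ≤ (1 / 5 : ℝ) ^ a :=
            Real.self_le_rpow_of_le_one (by norm_num) (by norm_num) (by linarith)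
          gcongr
      _ = (r * Y ^ (-(2 * a)) + ‖x‖ * ‖y‖ ^ (-(2 * a))) * (Y ^ a * (Y / 5) ^ a) := by
          rw [Real.div_rpow hY0 hy0.le, Real.div_rpow hY0 (by norm_num), Real.rpow_neg hY0,
            Real.rpow_neg hy0.le, Real.div_rpow (by norm_num) (by norm_num), Real.one_rpow,
            two_mul, Real.rpow_add hYpos]
          field_simp
      _ ≤ kern i a x y * (Y ^ a * (Z ^ a + r ^ a)) := by
          have h7 : (Y / 5) ^ a ≤ Z ^ a := Real.rpow_le_rpow (by positivity) (by linarith) ha0.le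
          have h8 : (Y / 5) ^ a ≤ Z ^ a + r ^ a := h7.trans (le_add_of_nonneg_right (by positivity))
          gcongr
          exact kern_nonneg _ _ _ _
  linarith

/-- The symmetric bound for the commutator kernel. -/
def qker (s R : ℝ) (i : Fin 2) (a : ℝ) (x y z : Plane) : ℝ :=
  ‖x‖ ^ (-s) * kern i a x y * (prof s R ‖x‖ * prof s R ‖y‖ * prof s R ‖z‖) *
    (|y i| ^ a * (|z i| ^ a + |x i| ^ a))

theorem qker_nonneg {s R : ℝ} (hR : 0 ≤ R) (i : Fin 2) (a : ℝ) (x y z : Plane) :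
    0 ≤ qker s R i a x y z := by
  have h1 := kern_nonneg i a x y
  have h2 := prof_nonneg (s := s) hR (norm_nonneg x)
  have h3 := prof_nonneg (s := s) hR (norm_nonneg y)
  have h4 := prof_nonneg (s := s) hR (norm_nonneg z)
  unfold qker
  positivity

/-- Below the truncation |x|^{-s} times the profile of x equals 1, so a third profile can be
inserted at no cost and the bound becomes a trilinear form in the weighted function. -/
theorem prof_mul_wedge_le {s R a : ℝ} (hR : 0 < R) (ha0 : 0 < a) (ha : a ≤ 1 / 2)
    (i : Fin 2) {x y z : Plane}
    (hxyz : x + y + z = 0) (hxy : ‖x‖ ≤ ‖y‖) (hxR : ‖x‖ ≤ R) :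
    prof s R ‖y‖ * prof s R ‖z‖ * (|wedge x y| / ‖y‖) ≤
      5 * (qker s R i a x y z + qker s R i a x z y) := by
  have hq0 := qker_nonneg (s := s) hR.le i a x y z
  have hq1 := qker_nonneg (s := s) hR.le i a x z y
  rcases eq_or_ne x 0 with rfl | hx
  · have : wedge 0 y = 0 := by simp [wedge]
    rw [this]
    simp only [abs_zero, zero_div, mul_zero]
    linarith
  have hx0 : 0 < ‖x‖ := norm_pos_iff.2 hx
  have hone : ‖x‖ ^ (-s) * prof s R ‖x‖ = 1 := by
    rw [prof, min_eq_left hxR, ← Real.rpow_add hx0]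
    simp
  have h1 := wedge_div_le_kern ha0 ha i hxyz hxy
  have h3 := prof_nonneg (s := s) hR.le (norm_nonneg y)
  have h4 := prof_nonneg (s := s) hR.le (norm_nonneg z)
  refine (mul_le_mul_of_nonneg_left h1 (mul_nonneg h3 h4)).trans_eq ?_
  rw [qker, qker]
  linear_combination (-5 * (prof s R ‖y‖ * prof s R ‖z‖ *
    (kern i a x y * (|y i| ^ a * (|z i| ^ a + |x i| ^ a)) +
      kern i a x z * (|z i| ^ a * (|y i| ^ a + |x i| ^ a))))) * hone


/-- Here x is the shortest side of the triangle and y, z are comparable to N = max(|A|, |C|). If |x|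
> R, both profiles are saturated and the difference vanishes. Otherwise the Lipschitz bound gains
||A| - |C|| / N ≤ |B| / N, which cancels the singular factor 1/|B| even when B is the shortest side.
The constant collects 2s from Lipschitz, 2 from |y| ≤ 2N, two doublings 2^s of the profile, and 5
from the wedge estimate. -/
theorem commutator_le_of_min {s R a : ℝ} (hs : 1 ≤ s) (hR : 0 < R) (ha0 : 0 < a) (ha : a ≤ 1 / 2)
    (i : Fin 2) {A B C x y z : Plane} (hABC : A + B + C = 0) (hxyz : x + y + z = 0)
    (hw : |wedge A B| = |wedge x y|) (hA0 : 0 < max ‖A‖ ‖C‖) (hAy : max ‖A‖ ‖C‖ ≤ 2 * ‖y‖)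
    (hAz : max ‖A‖ ‖C‖ ≤ 2 * ‖z‖) (hy : ‖y‖ ≤ 2 * max ‖A‖ ‖C‖) (hxy : ‖x‖ ≤ ‖y‖)
    (hxA : ‖x‖ ≤ ‖A‖) (hxC : ‖x‖ ≤ ‖C‖) :
    |prof s R ‖A‖ ^ 2 - prof s R ‖C‖ ^ 2| * (|wedge A B| / ‖B‖) ≤
      20 * s * (2 ^ s) ^ 2 * (qker s R i a x y z + qker s R i a x z y) := by
  have hs0 : 0 ≤ s := by linarith
  have hq0 := qker_nonneg (s := s) hR.le i a x y z
  have hq1 := qker_nonneg (s := s) hR.le i a x z y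
  by_cases hxR : R < ‖x‖
  · have h1 : prof s R ‖A‖ = prof s R ‖C‖ := by
      rw [prof, prof, min_eq_right (hxR.le.trans hxA), min_eq_right (hxR.le.trans hxC)]
    rw [h1, sub_self, abs_zero, zero_mul]
    positivity
  rw [not_lt] at hxR
  set N := max ‖A‖ ‖C‖ with hN
  have hpN := prof_nonneg (s := s) hR.le hA0.le
  have hpy := prof_nonneg (s := s) hR.le (norm_nonneg y)
  have hpz := prof_nonneg (s := s) hR.le (norm_nonneg z)
  have hB : |‖A‖ - ‖C‖| ≤ ‖B‖ := by
    have hB' : B = -(A + C) := by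
      rw [← sub_eq_zero, ← hABC]
      abel
    have := abs_norm_sub_norm_le A (-C)
    rwa [norm_neg, sub_neg_eq_add, ← norm_neg (A + C), ← hB'] at this
  have hy0 : 0 < ‖y‖ := by linarith
  have h1 := abs_prof_sq_sub_le (s := s) hs hR (norm_nonneg A) (norm_nonneg C) hN hA0
  have h2 : |‖A‖ - ‖C‖| / N * (|wedge A B| / ‖B‖) ≤ |wedge A B| / N := by
    calc |‖A‖ - ‖C‖| / N * (|wedge A B| / ‖B‖) = |wedge A B| / N * (|‖A‖ - ‖C‖| / ‖B‖) := by
          rw [div_mul_div_comm, div_mul_div_comm, mul_comm |wedge A B|]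
      _ ≤ |wedge A B| / N :=
          mul_le_of_le_one_right (by positivity) (div_le_one_of_le₀ hB (norm_nonneg _))
  have h3 : |wedge A B| / N ≤ 2 * (|wedge x y| / ‖y‖) := by
    rw [hw, ← mul_div_assoc, div_le_div_iff₀ hA0 hy0]
    nlinarith [abs_nonneg (wedge x y)]
  have h4 : prof s R N ^ 2 ≤ (2 ^ s) ^ 2 * (prof s R ‖y‖ * prof s R ‖z‖) := by
    have e1 := prof_le_two_mul (s := s) hs0 hR.le (norm_nonneg y) hA0.le hAy
    have e2 := prof_le_two_mul (s := s) hs0 hR.le (norm_nonneg z) hA0.le hAz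
    calc prof s R N ^ 2 = prof s R N * prof s R N := sq _
      _ ≤ (2 ^ s * prof s R ‖y‖) * (2 ^ s * prof s R ‖z‖) := by gcongr
      _ = _ := by ring
  have h5 := prof_mul_wedge_le (s := s) hR ha0 ha i hxyz hxy hxR
  calc |prof s R ‖A‖ ^ 2 - prof s R ‖C‖ ^ 2| * (|wedge A B| / ‖B‖)
      ≤ (2 * s * prof s R N ^ 2 * (|‖A‖ - ‖C‖| / N)) * (|wedge A B| / ‖B‖) := by gcongr
    _ = 2 * s * prof s R N ^ 2 * (|‖A‖ - ‖C‖| / N * (|wedge A B| / ‖B‖)) := by ring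
    _ ≤ 2 * s * ((2 ^ s) ^ 2 * (prof s R ‖y‖ * prof s R ‖z‖)) * (2 * (|wedge x y| / ‖y‖)) := by
        exact mul_le_mul (mul_le_mul_of_nonneg_left h4 (by positivity)) (h2.trans h3)
          (by positivity) (by positivity)
    _ = 4 * s * (2 ^ s) ^ 2 * (prof s R ‖y‖ * prof s R ‖z‖ * (|wedge x y| / ‖y‖)) := by ring
    _ ≤ 4 * s * (2 ^ s) ^ 2 * (5 * (qker s R i a x y z + qker s R i a x z y)) := by gcongr
    _ = _ := by ring

/-- The sum of `qker` over all orderings of three vectors. -/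
def qsum (s R : ℝ) (i : Fin 2) (a : ℝ) (x y z : Plane) : ℝ :=
  (qker s R i a x y z + qker s R i a x z y) + (qker s R i a y x z + qker s R i a y z x) +
    (qker s R i a z x y + qker s R i a z y x)

theorem commutator_le {s R a : ℝ} (hs : 1 ≤ s) (hR : 0 < R) (ha0 : 0 < a) (ha : a ≤ 1 / 2)
    (i : Fin 2) {A B C : Plane} (hABC : A + B + C = 0) :
    |prof s R ‖A‖ ^ 2 - prof s R ‖C‖ ^ 2| * (|wedge A B| / ‖B‖) ≤
      20 * s * (2 ^ s) ^ 2 * qsum s R i a A B C := by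
  have hq := qker_nonneg (s := s) hR.le i a
  have hc : 0 ≤ 20 * s * (2 ^ s) ^ 2 := by positivity
  have eA : ‖A‖ ≤ ‖B‖ + ‖C‖ := by
    have : A = -B - C := by
      rw [← sub_eq_zero, ← hABC]; abel
    rw [this]
    exact (norm_sub_le _ _).trans_eq (by rw [norm_neg])
  have eB : ‖B‖ ≤ ‖A‖ + ‖C‖ := by
    have : B = -A - C := by
      rw [← sub_eq_zero, ← hABC]; abel
    rw [this]
    exact (norm_sub_le _ _).trans_eq (by rw [norm_neg])
  have eC : ‖C‖ ≤ ‖A‖ + ‖B‖ := by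
    have : C = -A - B := by
      rw [← sub_eq_zero, ← hABC]; abel
    rw [this]
    exact (norm_sub_le _ _).trans_eq (by rw [norm_neg])
  rcases (le_max_of_le_left (norm_nonneg A) : 0 ≤ max ‖A‖ ‖C‖).eq_or_lt with h0 | h0
  · have h1 : ‖A‖ = 0 := le_antisymm (h0 ▸ le_max_left _ _) (norm_nonneg _)
    have h2 : ‖C‖ = 0 := le_antisymm (h0 ▸ le_max_right _ _) (norm_nonneg _)
    rw [h1, h2, sub_self, abs_zero, zero_mul]
    unfold qsum
    have := hq A B C; have := hq A C B; have := hq B A C; have := hq B C A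
    have := hq C A B; have := hq C B A
    positivity
  -- The alternatives below take A, B and C in turn as the shortest side; the triangle inequality
  -- makes the other two comparable up to a factor 2.
  rcases le_total ‖A‖ ‖B‖ with hAB | hAB <;> rcases le_total ‖B‖ ‖C‖ with hBC | hBC <;>
    rcases le_total ‖A‖ ‖C‖ with hAC | hAC
  all_goals first
    | (refine (commutator_le_of_min (x := A) (y := B) (z := C) hs hR ha0 ha i hABC hABC rfl h0
        (max_le (by linarith) (by linarith)) (max_le (by linarith) (by linarith))
        (by linarith [le_max_left ‖A‖ ‖C‖, le_max_right ‖A‖ ‖C‖]) (by linarith)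
        (by linarith) (by linarith)).trans (mul_le_mul_of_nonneg_left ?_ hc)
       unfold qsum
       linarith [hq B A C, hq B C A, hq C A B, hq C B A])
    | (refine (commutator_le_of_min (x := B) (y := A) (z := C) hs hR ha0 ha i hABC
        (by rw [← hABC]; abel)
        (by rw [← abs_neg]; congr 1; simp only [wedge]; ring) h0
        (max_le (by linarith) (by linarith)) (max_le (by linarith) (by linarith))
        (by linarith [le_max_left ‖A‖ ‖C‖, le_max_right ‖A‖ ‖C‖]) (by linarith)
        (by linarith) (by linarith)).trans (mul_le_mul_of_nonneg_left ?_ hc)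
       unfold qsum
       linarith [hq A B C, hq A C B, hq C A B, hq C B A])
    | (refine (commutator_le_of_min (x := C) (y := A) (z := B) hs hR ha0 ha i hABC
        (by rw [← hABC]; abel)
        (by
          have hC : C = -A - B := by
            rw [← sub_eq_zero, ← hABC]; abel
          rw [hC]
          congr 1
          simp only [wedge, PiLp.sub_apply, PiLp.neg_apply]
          ring) h0
        (max_le (by linarith) (by linarith)) (max_le (by linarith) (by linarith))
        (by linarith [le_max_left ‖A‖ ‖C‖, le_max_right ‖A‖ ‖C‖]) (by linarith)
        (by linarith) (by linarith)).trans (mul_le_mul_of_nonneg_left ?_ hc)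
       unfold qsum
       linarith [hq A B C, hq A C B, hq B A C, hq B C A])

theorem qsum_neg (s R : ℝ) (i : Fin 2) (a : ℝ) (x y z : Plane) :
    qsum s R i a x (-y) (-z) = qsum s R i a x y z := by
  simp [qsum, qker, kern]

/-- The commutator kernel is controlled by the symmetric kernel. -/
theorem commutator_kernel_le {s R a : ℝ} (hs : 1 ≤ s) (hR : 0 < R) (ha0 : 0 < a) (ha : a ≤ 1 / 2)
    (i : Fin 2) (ξ η : Plane) :
    |prof s R ‖ξ‖ ^ 2 - prof s R ‖ξ - η‖ ^ 2| * |wedge η ξ / ‖η‖| ≤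
      20 * s * (2 ^ s) ^ 2 * qsum s R i a ξ η (ξ - η) := by
  have h := commutator_le (s := s) hs hR ha0 ha i (A := ξ) (B := -η) (C := -(ξ - η)) (by abel)
  rw [qsum_neg, norm_neg, norm_neg] at h
  refine le_trans (le_of_eq ?_) h
  rw [abs_div, abs_norm]
  congr 3
  simp only [wedge, PiLp.neg_apply]
  ring


/-! ### Scale-invariant L² bound for the low-frequency kernel -/

/-- A radial majorant, integrable on the plane for `1 < s < 2`. -/
def radial (s r : ℝ) : ℝ := if r ≤ 1 then r ^ (2 - 2 * s) else r ^ (-(2 * s))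

theorem radial_nonneg (s : ℝ) {r : ℝ} (hr : 0 ≤ r) : 0 ≤ radial s r := by
  unfold radial
  split_ifs <;> positivity

theorem measurable_radial (s : ℝ) : Measurable (radial s) :=
  Measurable.ite measurableSet_Iic (by fun_prop) (by fun_prop)

/-- In polar coordinates the integrand is r^{3-2s} near 0 and r^{1-2s} at infinity: s < 2 and s > 1
are what is needed, that is a > 0 and a < 1/2 when s = 2 - 2a. -/
theorem integrable_radial {s : ℝ} (hs1 : 1 < s) (hs2 : s < 2) :
    Integrable (fun x : Plane => radial s ‖x‖) := by
  rw [integrable_fun_norm_addHaar volume, ← Set.Ioc_union_Ioi_eq_Ioi zero_le_one]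
  refine IntegrableOn.union ?_ ?_
  · have h : IntegrableOn (fun y : ℝ => y ^ (3 - 2 * s)) (Set.Ioc 0 1) := by
      rw [← intervalIntegrable_iff_integrableOn_Ioc_of_le zero_le_one]
      exact intervalIntegral.intervalIntegrable_rpow' (by linarith)
    refine h.congr_fun (fun y hy => ?_) measurableSet_Ioc
    have e : (3 - 2 * s : ℝ) = 1 + (2 - 2 * s) := by ring
    simp only [radial, if_pos hy.2, finrank_euclideanSpace, Fintype.card_fin, smul_eq_mul]
    rw [e, Real.rpow_add hy.1]
    norm_num
  · have h : IntegrableOn (fun y : ℝ => y ^ (1 - 2 * s)) (Set.Ioi 1) :=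
      integrableOn_Ioi_rpow_of_lt (by linarith) one_pos
    refine h.congr_fun (fun y hy => ?_) measurableSet_Ioi
    have e : (1 - 2 * s : ℝ) = 1 + (-(2 * s)) := by ring
    have hy' : 1 < y := hy
    simp only [radial, if_neg (not_le.2 hy'), finrank_euclideanSpace, Fintype.card_fin, smul_eq_mul]
    rw [e, Real.rpow_add (by linarith)]
    norm_num

theorem lintegral_scale (f : Plane → ℝ≥0∞) (hf : Measurable f) {l : ℝ} (hl : 0 < l) :
    ∫⁻ x, ENNReal.ofReal (l ^ 2)⁻¹ * f (l⁻¹ • x) = ∫⁻ x, f x := by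
  have hm : Measurable (fun x : Plane => l⁻¹ • x) := by fun_prop
  rw [lintegral_const_mul _ (show Measurable (fun x => f (l⁻¹ • x)) from hf.comp hm), ← lintegral_map hf hm,
    Measure.map_addHaar_smul volume (inv_ne_zero hl.ne'), lintegral_smul_measure, smul_eq_mul,
    ← mul_assoc, ← ENNReal.ofReal_mul (by positivity)]
  simp only [finrank_euclideanSpace, Fintype.card_fin]
  rw [abs_of_pos (by positivity), inv_pow, inv_inv, inv_mul_cancel₀ (by positivity)]
  simp

/-- The expression n^{-s} t l^{-2a} is homogeneous of degree 1 - s - 2a = -1 at the critical index,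
so its square is l^{-2} times a function of n/l and t/l. The ratio u = t/l is then bounded by ρ =
n/l when ρ ≤ 1 and by 1 otherwise. -/
theorem sq_le_radial {s a l t n : ℝ} (hsa : s = 2 - 2 * a) (hl : 0 < l) (ht : 0 ≤ t)
    (htn : t ≤ n) (htl : t ≤ l) :
    (n ^ (-s) * (t * l ^ (-(2 * a)))) ^ 2 ≤ (l ^ 2)⁻¹ * radial s (l⁻¹ * n) := by
  rcases ht.eq_or_lt with rfl | ht0
  · have : 0 ≤ radial s (l⁻¹ * n) := radial_nonneg s (by positivity)
    rw [zero_mul, mul_zero, zero_pow two_ne_zero]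
    exact mul_nonneg (by positivity) this
  have hn : 0 < n := ht0.trans_le htn
  obtain ⟨ρ, hρ, rfl⟩ : ∃ ρ, 0 < ρ ∧ n = l * ρ := ⟨n / l, by positivity, by field_simp⟩
  obtain ⟨u, hu, rfl⟩ : ∃ u, 0 < u ∧ t = l * u := ⟨t / l, by positivity, by field_simp⟩
  have hu1 : u ≤ 1 := by nlinarith
  have huρ : u ≤ ρ := le_of_mul_le_mul_left htn hl
  rw [inv_mul_cancel_left₀ hl.ne']
  have e1 : ((l * ρ) ^ (-s) * (l * u * l ^ (-(2 * a)))) = l⁻¹ * (ρ ^ (-s) * u) := by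
    rw [Real.mul_rpow hl.le hρ.le]
    have : l ^ (-s) * (l * l ^ (-(2 * a))) = l⁻¹ := by
      calc l ^ (-s) * (l * l ^ (-(2 * a))) = l ^ (-s) * (l ^ (1 : ℝ) * l ^ (-(2 * a))) := by
            rw [Real.rpow_one]
        _ = l ^ (-1 : ℝ) := by
            rw [← Real.rpow_add hl, ← Real.rpow_add hl]
            congr 1
            linarith
        _ = l⁻¹ := Real.rpow_neg_one l
    calc _ = (l ^ (-s) * (l * l ^ (-(2 * a)))) * (ρ ^ (-s) * u) := by ring
      _ = _ := by rw [this]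
  rw [e1, mul_pow, inv_pow]
  gcongr
  have e2 : (ρ ^ (-s)) ^ 2 = ρ ^ (-(2 * s)) := by
    rw [← Real.rpow_natCast, ← Real.rpow_mul hρ.le]
    congr 1
    push_cast
    ring
  rw [mul_pow, e2, radial]
  split_ifs with h
  · calc ρ ^ (-(2 * s)) * u ^ 2 ≤ ρ ^ (-(2 * s)) * ρ ^ 2 := by gcongr
      _ = ρ ^ (2 - 2 * s) := by
        rw [← Real.rpow_natCast ρ 2, ← Real.rpow_add hρ]
        congr 1
        push_cast
        ring
  · exact mul_le_of_le_one_right (by positivity) (pow_le_one₀ hu.le hu1)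

/-- The low-frequency factor in the trilinear estimate. -/
def lowKer (s : ℝ) (i : Fin 2) (a : ℝ) (x y : Plane) : ℝ := ‖x‖ ^ (-s) * kern i a x y

theorem lowKer_nonneg (s : ℝ) (i : Fin 2) (a : ℝ) (x y : Plane) : 0 ≤ lowKer s i a x y :=
  mul_nonneg (by positivity) (kern_nonneg i a x y)

theorem measurable_lowKer (s : ℝ) (i : Fin 2) (a : ℝ) :
    Measurable (fun p : Plane × Plane => lowKer s i a p.1 p.2) := by
  unfold lowKer kern
  refine Measurable.mul (by fun_prop) (Measurable.add ?_ ?_)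
  · exact Measurable.ite (measurableSet_le (by fun_prop) (by fun_prop)) (by fun_prop) (by fun_prop)
  · exact Measurable.ite (measurableSet_le (by fun_prop) (by fun_prop)) (by fun_prop) (by fun_prop)

/-- The two summands of `kern` are dominated by dilates of one radial majorant, at scales 4|y i| and
|y|. These dilates preserve the integral, so the bound does not depend on y. -/
theorem exists_lowKer_bound {s a : ℝ} (hsa : s = 2 - 2 * a) (ha0 : 0 < a) (ha : a < 1 / 2)
    (i : Fin 2) :
    ∃ C : ℝ≥0∞, C < ∞ ∧ ∀ y : Plane, ∫⁻ x, ENNReal.ofReal (lowKer s i a x y) ^ 2 ≤ C := by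
  have hs1 : 1 < s := by linarith
  have hs2 : s < 2 := by linarith
  set I : ℝ≥0∞ := ∫⁻ x : Plane, ENNReal.ofReal (radial s ‖x‖) with hI
  have hIlt : I < ∞ := (integrable_radial hs1 hs2).lintegral_lt_top
  set f : Plane → ℝ≥0∞ := fun x => ENNReal.ofReal (radial s ‖x‖) with hf
  have hfm : Measurable f := ((measurable_radial s).comp measurable_norm).ennreal_ofReal
  have hgen : ∀ l : ℝ, 0 < l → ∫⁻ x : Plane, ENNReal.ofReal ((l ^ 2)⁻¹ * radial s (l⁻¹ * ‖x‖)) = I := by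
    intro l hl
    rw [hI, ← lintegral_scale f hfm hl]
    refine lintegral_congr fun x => ?_
    rw [ENNReal.ofReal_mul (by positivity), hf]
    simp only [norm_smul, norm_inv, Real.norm_of_nonneg hl.le]
  -- The price of replacing |y i|^{-2a} by (4|y i|)^{-2a} and squaring.
  set c : ℝ := (4 ^ (2 * a)) ^ 2 with hc
  have hpt1 : ∀ x y : Plane, (‖x‖ ^ (-s) *
      (if |x i| ≤ 4 * |y i| then |x i| * |y i| ^ (-(2 * a)) else 0)) ^ 2 ≤
      if 0 < |y i| then c * (((4 * |y i|) ^ 2)⁻¹ * radial s ((4 * |y i|)⁻¹ * ‖x‖)) else 0 := by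
    intro x y
    have hxi : |x i| ≤ ‖x‖ := PiLp.norm_apply_le x i
    by_cases hy : 0 < |y i|
    · rw [if_pos hy]
      have hr : 0 ≤ radial s ((4 * |y i|)⁻¹ * ‖x‖) := radial_nonneg s (by positivity)
      split_ifs with h
      · have := sq_le_radial hsa (l := 4 * |y i|) (by positivity) (abs_nonneg (x i)) hxi h
        refine le_trans (le_of_eq ?_) (mul_le_mul_of_nonneg_left this (by positivity : 0 ≤ c))
        rw [hc, ← mul_pow, Real.mul_rpow (by norm_num) hy.le, Real.rpow_neg (by norm_num : (0:ℝ) ≤ 4)]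
        field_simp
      · rw [mul_zero, zero_pow two_ne_zero]
        positivity
    · rw [if_neg hy]
      have hy0 : |y i| = 0 := le_antisymm (not_lt.1 hy) (abs_nonneg _)
      split_ifs with h
      · have : |x i| = 0 := by linarith [abs_nonneg (x i)]
        simp [this]
      · simp
  have hpt2 : ∀ x y : Plane, (‖x‖ ^ (-s) *
      (if ‖x‖ ≤ ‖y‖ then ‖x‖ * ‖y‖ ^ (-(2 * a)) else 0)) ^ 2 ≤
      if 0 < ‖y‖ then (‖y‖ ^ 2)⁻¹ * radial s (‖y‖⁻¹ * ‖x‖) else 0 := by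
    intro x y
    by_cases hy : 0 < ‖y‖
    · rw [if_pos hy]
      have hr : 0 ≤ radial s (‖y‖⁻¹ * ‖x‖) := radial_nonneg s (by positivity)
      split_ifs with h
      · exact sq_le_radial hsa hy (norm_nonneg x) le_rfl h
      · rw [mul_zero, zero_pow two_ne_zero]
        positivity
    · rw [if_neg hy]
      have hy0 : ‖y‖ = 0 := le_antisymm (not_lt.1 hy) (norm_nonneg _)
      split_ifs with h
      · have : ‖x‖ = 0 := by linarith [norm_nonneg x]
        simp [this]
      · simp
  refine ⟨ENNReal.ofReal 2 * (ENNReal.ofReal c * I) + ENNReal.ofReal 2 * I, ?_, fun y => ?_⟩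
  · exact ENNReal.add_lt_top.2 ⟨ENNReal.mul_lt_top (by simp)
      (ENNReal.mul_lt_top ENNReal.ofReal_lt_top hIlt), ENNReal.mul_lt_top (by simp) hIlt⟩
  · have hpt : ∀ x, ENNReal.ofReal (lowKer s i a x y) ^ 2 ≤
        ENNReal.ofReal 2 * ENNReal.ofReal (if 0 < |y i| then
          c * (((4 * |y i|) ^ 2)⁻¹ * radial s ((4 * |y i|)⁻¹ * ‖x‖)) else 0) +
        ENNReal.ofReal 2 * ENNReal.ofReal (if 0 < ‖y‖ then (‖y‖ ^ 2)⁻¹ * radial s (‖y‖⁻¹ * ‖x‖) else 0) := by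
      intro x
      rw [← ENNReal.ofReal_pow (lowKer_nonneg s i a x y)]
      have h1 := hpt1 x y
      have h2 := hpt2 x y
      have h10 := (sq_nonneg _).trans h1
      have h20 := (sq_nonneg _).trans h2
      rw [← ENNReal.ofReal_mul (by norm_num), ← ENNReal.ofReal_mul (by norm_num),
        ← ENNReal.ofReal_add (by positivity) (by positivity)]
      refine ENNReal.ofReal_le_ofReal ?_
      rw [lowKer, kern, mul_add]
      refine (add_sq_le).trans ?_
      linarith
    refine (lintegral_mono hpt).trans ?_
    rw [lintegral_add_left, lintegral_const_mul', lintegral_const_mul']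
    · gcongr
      · split_ifs with hy
        · simp_rw [ENNReal.ofReal_mul (by positivity : 0 ≤ c)]
          rw [lintegral_const_mul' _ _ ENNReal.ofReal_ne_top, hgen _ (by positivity)]
        · simp
      · split_ifs with hy
        · rw [hgen _ hy]
        · simp
    · simp
    · simp
    · refine Measurable.const_mul ?_ _
      refine Measurable.ennreal_ofReal ?_
      split_ifs
      · have := measurable_radial s
        fun_prop
      · fun_prop

theorem measurePreserving_fst_sub :
    MeasurePreserving (fun p : Plane × Plane => (p.1, p.1 - p.2)) (volume.prod volume)
      (volume.prod volume) :=
  (MeasurePreserving.id volume).skew_product (g := fun x y : Plane => x - y) (by fun_prop)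
    (Eventually.of_forall fun x => (Measure.measurePreserving_sub_left volume x).map_eq)

/-- The integrand is grouped as (l F) · (H K). Each group depends on only two of the three
frequencies, and such a pair is a measure-preserving choice of coordinates; the first square is
integrated in x before y, the second is a product. -/
theorem trilinear_cauchy_schwarz {X Y Z : Plane × Plane → Plane}
    (hXY : MeasurePreserving (fun p => (X p, Y p)) (volume.prod volume) (volume.prod volume))
    (hZX : MeasurePreserving (fun p => (Z p, X p)) (volume.prod volume) (volume.prod volume))
    {l : Plane → Plane → ℝ≥0∞} (hl : Measurable (fun p : Plane × Plane => l p.1 p.2)) {C : ℝ≥0∞}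
    (hC : ∀ y, ∫⁻ x, l x y ^ 2 ≤ C) {F H K : Plane → ℝ≥0∞} (hF : Measurable F) (hH : Measurable H)
    (hK : Measurable K) :
    (∫⁻ p, l (X p) (Y p) * F (Y p) * (H (Z p) * K (X p)) ∂(volume.prod volume)) ^ 2 ≤
      (C * ∫⁻ x, F x ^ 2) * ((∫⁻ x, H x ^ 2) * ∫⁻ x, K x ^ 2) := by
  have hlF : Measurable (fun q : Plane × Plane => l q.1 q.2 * F q.2) := hl.mul (hF.comp measurable_snd)
  have hHK : Measurable (fun q : Plane × Plane => H q.1 * K q.2) :=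
    (hH.comp measurable_fst).mul (hK.comp measurable_snd)
  refine (lintegral_mul_sq_le (hlF.comp hXY.measurable).aemeasurable
    (hHK.comp hZX.measurable).aemeasurable).trans ?_
  have e1 := hXY.lintegral_comp (hlF.pow_const 2)
  have e2 := hZX.lintegral_comp (hHK.pow_const 2)
  simp only [Function.comp_def]
  rw [e1, e2]
  gcongr
  · rw [lintegral_prod_symm _ (hlF.pow_const 2).aemeasurable, ← lintegral_const_mul _ (hF.pow_const 2)]
    refine lintegral_mono fun y => ?_
    simp only [mul_pow]
    rw [lintegral_mul_const]
    · gcongr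
      exact hC y
    · exact (hl.comp (measurable_id.prodMk measurable_const)).pow_const 2
  · simp only [mul_pow]
    rw [lintegral_prod_mul (hH.pow_const 2).aemeasurable (hK.pow_const 2).aemeasurable]


/-! ### Symmetrization of the transport term -/

/-- The integrand of the transport term as a function of both frequencies. -/
def triKer (w : Plane → ℝ) (ψ : L2) (p : Plane × Plane) : ℝ :=
  w p.1 * (2 * Real.pi * (wedge p.2 p.1 / ‖p.2‖ * inner ℝ (ψ p.1) (ψ p.2 * ψ (p.1 - p.2))))

theorem measurable_triKer {w : Plane → ℝ} (hw : Measurable w) (ψ : L2) :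
    Measurable (triKer w ψ) := by
  have h := (Lp.stronglyMeasurable ψ).measurable
  have h1 := measurable_wedge
  unfold triKer
  refine (hw.comp measurable_fst).mul (Measurable.const_mul (Measurable.mul (by fun_prop) ?_) _)
  exact (h.comp measurable_fst).inner
    ((h.comp measurable_snd).mul (h.comp (measurable_fst.sub measurable_snd)))

theorem integrable_triKer {w : Plane → ℝ} (hw : Measurable w) {C : ℝ} (hw0 : ∀ ξ, 0 ≤ w ξ)
    (hwC : ∀ ξ, w ξ ≤ C) {ψ : L2} (h : absTri ψ < ∞) :
    Integrable (triKer w ψ) (volume.prod volume) := by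
  have hm := measurable_enorm_L2 ψ
  have hC : 0 ≤ C := (hw0 0).trans (hwC 0)
  refine ⟨(measurable_triKer hw ψ).aestronglyMeasurable, ?_⟩
  have hlt : ENNReal.ofReal (C * (2 * Real.pi)) * absTri ψ < ∞ :=
    ENNReal.mul_lt_top ENNReal.ofReal_lt_top h
  refine lt_of_le_of_lt ?_ hlt
  have hm2 : Measurable (fun p : Plane × Plane => ‖ψ (p.1 - p.2)‖ₑ) :=
    hm.comp (measurable_fst.sub measurable_snd)
  have hm3 : Measurable (fun p : Plane × Plane => ‖p.1 - p.2‖ₑ) := by fun_prop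
  have hm4 : Measurable (fun p : Plane × Plane =>
      ‖ψ p.1‖ₑ * (‖ψ p.2‖ₑ * (‖p.1 - p.2‖ₑ * ‖ψ (p.1 - p.2)‖ₑ))) :=
    (hm.comp measurable_fst).mul ((hm.comp measurable_snd).mul (hm3.mul hm2))
  have e : absTri ψ = ∫⁻ p : Plane × Plane, ‖ψ p.1‖ₑ * (‖ψ p.2‖ₑ * (‖p.1 - p.2‖ₑ * ‖ψ (p.1 - p.2)‖ₑ))
      ∂(volume.prod volume) := by
    rw [lintegral_prod _ hm4.aemeasurable, absTri]
  rw [e, ← lintegral_const_mul _ hm4]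
  refine lintegral_mono fun p => ?_
  simp only [← ofReal_norm]
  rw [← ENNReal.ofReal_mul (norm_nonneg _), ← ENNReal.ofReal_mul (norm_nonneg _),
    ← ENNReal.ofReal_mul (norm_nonneg _), ← ENNReal.ofReal_mul (by positivity)]
  refine ENNReal.ofReal_le_ofReal ?_
  rw [triKer, norm_mul, norm_mul (2 * Real.pi), norm_mul (_ / _), Real.norm_of_nonneg (hw0 _),
    Real.norm_of_nonneg (by positivity : 0 ≤ 2 * Real.pi), Real.norm_eq_abs (wedge _ _ / _)]
  have h1 := abs_wedge_div_le p.2 p.1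
  have h2 : ‖inner ℝ (ψ p.1) (ψ p.2 * ψ (p.1 - p.2))‖ ≤ ‖ψ p.1‖ * (‖ψ p.2‖ * ‖ψ (p.1 - p.2)‖) := by
    rw [← norm_mul]
    exact norm_inner_le_norm _ _
  calc w p.1 * (2 * Real.pi * (|wedge p.2 p.1 / ‖p.2‖| * ‖inner ℝ (ψ p.1) (ψ p.2 * ψ (p.1 - p.2))‖))
      ≤ C * (2 * Real.pi * (‖p.1 - p.2‖ * (‖ψ p.1‖ * (‖ψ p.2‖ * ‖ψ (p.1 - p.2)‖)))) := by
        gcongr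
        exact hwC _
    _ = _ := by ring

theorem tri_eq_integral_prod {w : Plane → ℝ} (hw : Measurable w) {C : ℝ} (hw0 : ∀ ξ, 0 ≤ w ξ)
    (hwC : ∀ ξ, w ξ ≤ C) {ψ : L2} (h : absTri ψ < ∞) :
    tri w ψ = ∫ p, triKer w ψ p ∂(volume.prod volume) := by
  rw [integral_prod _ (integrable_triKer hw hw0 hwC h), tri]
  refine integral_congr_ae (Eventually.of_forall fun ξ => ?_)
  have hint : Integrable (fun η => ((wedge η ξ / ‖η‖ : ℝ) : ℂ) * (ψ η * ψ (ξ - η))) := by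
    refine (integrable_mul_reflect ψ ψ ξ).bdd_mul (c := ‖ξ‖) ?_ (Eventually.of_forall fun η => ?_)
    · refine Measurable.aestronglyMeasurable ?_
      have := measurable_wedge
      have h2 : Measurable (fun η : Plane => wedge η ξ) :=
        this.comp (measurable_const.prodMk measurable_id : Measurable (fun η : Plane => (ξ, η)))
      fun_prop
    · rw [Complex.norm_real]
      exact abs_wedge_div_le' η ξ
  have hin : ∀ (c : ℂ) (k : ℝ) (z : ℂ), inner ℝ c ((k : ℂ) * z) = k * inner ℝ c z := by
    intro c k z
    rw [← Complex.real_smul, real_inner_smul_right]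
  dsimp only [triKer]
  rw [integral_const_mul, integral_const_mul, nonlin]
  congr 1
  have e : (2 * Real.pi : ℂ) = ((2 * Real.pi : ℝ) : ℂ) := by push_cast; rfl
  rw [e, hin, ← integral_inner hint]
  congr 1
  refine integral_congr_ae (Eventually.of_forall fun η => ?_)
  exact hin _ _ _

/-- The measure-preserving substitution (ξ, η) ↦ (ξ - η, -η) exchanges ξ and ξ - η and changes the
sign of the wedge, while Hermitian symmetry leaves the inner product unchanged. Averaging both
expressions turns w(ξ) into half the difference w(ξ) - w(ξ - η). -/
theorem enorm_tri_le {w : Plane → ℝ} (hw : Measurable w) {C : ℝ} (hw0 : ∀ ξ, 0 ≤ w ξ)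
    (hwC : ∀ ξ, w ξ ≤ C) {ψ : L2} (h : absTri ψ < ∞)
    (hψ : ∀ᵐ ξ, ψ (-ξ) = star (ψ ξ)) :
    ‖tri w ψ‖ₑ ≤ ENNReal.ofReal Real.pi * ∫⁻ p : Plane × Plane,
      ENNReal.ofReal (|w p.1 - w (p.1 - p.2)| * |wedge p.2 p.1 / ‖p.2‖|) *
        (‖ψ p.1‖ₑ * (‖ψ p.2‖ₑ * ‖ψ (p.1 - p.2)‖ₑ)) ∂(volume.prod volume) := by
  have hΦ : MeasurePreserving (fun p : Plane × Plane => (p.1 - p.2, -p.2)) (volume.prod volume)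
      (volume.prod volume) :=
    ((MeasurePreserving.id volume).prod (Measure.measurePreserving_neg volume)).comp
      (measurePreserving_sub_prod volume volume)
  have hint := integrable_triKer hw hw0 hwC h
  have hint2 : Integrable (fun p : Plane × Plane => triKer w ψ (p.1 - p.2, -p.2))
      (volume.prod volume) := hΦ.integrable_comp_of_integrable hint
  have e1 : ∫ p, triKer w ψ (p.1 - p.2, -p.2) ∂(volume.prod volume) = tri w ψ := by
    rw [tri_eq_integral_prod hw hw0 hwC h]
    conv_rhs => rw [← hΦ.map_eq]
    rw [integral_map hΦ.measurable.aemeasurable (measurable_triKer hw ψ).aestronglyMeasurable]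
  have e2 : 2 * tri w ψ = ∫ p : Plane × Plane, (w p.1 - w (p.1 - p.2)) *
      (2 * Real.pi * (wedge p.2 p.1 / ‖p.2‖ * inner ℝ (ψ p.1) (ψ p.2 * ψ (p.1 - p.2))))
      ∂(volume.prod volume) := by
    rw [two_mul]
    nth_rw 1 [tri_eq_integral_prod hw hw0 hwC h]
    rw [← e1, ← integral_add hint hint2]
    refine integral_congr_ae ?_
    filter_upwards [Measure.quasiMeasurePreserving_snd.ae hψ] with p hp
    have hwed : wedge (-p.2) (p.1 - p.2) = - wedge p.2 p.1 := by
      simp only [wedge, PiLp.sub_apply, PiLp.neg_apply]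
      ring
    simp only [triKer]
    rw [hp, hwed, norm_neg, sub_neg_eq_add, sub_add_cancel]
    have hin : inner ℝ (ψ (p.1 - p.2)) (star (ψ p.2) * ψ p.1) =
        inner ℝ (ψ p.1) (ψ p.2 * ψ (p.1 - p.2)) := by
      simp only [Complex.inner, Complex.star_def, Complex.mul_re, Complex.mul_im, Complex.conj_re,
        Complex.conj_im]
      ring
    rw [hin]
    ring
  have e3 : ‖2 * tri w ψ‖ₑ = 2 * ‖tri w ψ‖ₑ := by
    rw [enorm_mul]
    congr 1
    rw [← ofReal_norm]
    simp
  have e4 : ENNReal.ofReal Real.pi = 2⁻¹ * ENNReal.ofReal (2 * Real.pi) := by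
    rw [ENNReal.ofReal_mul two_pos.le, ← mul_assoc, ENNReal.ofReal_ofNat, ENNReal.inv_mul_cancel
      (by simp) (by simp), one_mul]
  have key : 2 * ‖tri w ψ‖ₑ ≤ ENNReal.ofReal (2 * Real.pi) * ∫⁻ p : Plane × Plane,
      ENNReal.ofReal (|w p.1 - w (p.1 - p.2)| * |wedge p.2 p.1 / ‖p.2‖|) *
        (‖ψ p.1‖ₑ * (‖ψ p.2‖ₑ * ‖ψ (p.1 - p.2)‖ₑ)) ∂(volume.prod volume) := by
    rw [← e3, e2, ← lintegral_const_mul' _ _ ENNReal.ofReal_ne_top]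
    refine (enorm_integral_le_lintegral_enorm _).trans (lintegral_mono fun p => ?_)
    simp only [← ofReal_norm]
    rw [← ENNReal.ofReal_mul (norm_nonneg _), ← ENNReal.ofReal_mul (norm_nonneg _),
      ← ENNReal.ofReal_mul (by positivity), ← ENNReal.ofReal_mul (by positivity)]
    refine ENNReal.ofReal_le_ofReal ?_
    rw [norm_mul, norm_mul (2 * Real.pi), norm_mul (_ / _), Real.norm_eq_abs,
      Real.norm_of_nonneg (by positivity : 0 ≤ 2 * Real.pi), Real.norm_eq_abs (wedge _ _ / _)]
    have h2 : ‖inner ℝ (ψ p.1) (ψ p.2 * ψ (p.1 - p.2))‖ ≤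
        ‖ψ p.1‖ * (‖ψ p.2‖ * ‖ψ (p.1 - p.2)‖) := by
      rw [← norm_mul]
      exact norm_inner_le_norm _ _
    calc _ ≤ |w p.1 - w (p.1 - p.2)| * (2 * Real.pi * (|wedge p.2 p.1 / ‖p.2‖| *
          (‖ψ p.1‖ * (‖ψ p.2‖ * ‖ψ (p.1 - p.2)‖)))) := by gcongr
      _ = _ := by ring
  rw [e4, mul_assoc]
  calc ‖tri w ψ‖ₑ = 2⁻¹ * (2 * ‖tri w ψ‖ₑ) := by
        rw [← mul_assoc, ENNReal.inv_mul_cancel (by simp) (by simp), one_mul]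
    _ ≤ _ := by gcongr

/-- A constant weight has no commutator: the usual L² cancellation of divergence-free transport. -/
theorem tri_one {ψ : L2} (h : absTri ψ < ∞) (hψ : ∀ᵐ ξ, ψ (-ξ) = star (ψ ξ)) :
    tri (fun _ => 1) ψ = 0 := by
  have := enorm_tri_le (w := fun _ => 1) measurable_const (C := 1) (fun _ => zero_le_one)
    (fun _ => le_rfl) h hψ
  simpa using this


/-! ### The critical trilinear estimate -/

/-- The modulus of `ψ` weighted by the profile. -/
def profMod (s R : ℝ) (ψ : L2) (x : Plane) : ℝ≥0∞ := ENNReal.ofReal (prof s R ‖x‖) * ‖ψ x‖ₑ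

/-- The modulus of `ψ` weighted by the profile and a power of one coordinate. -/
def coordMod (s R : ℝ) (i : Fin 2) (a : ℝ) (ψ : L2) (x : Plane) : ℝ≥0∞ :=
  ENNReal.ofReal (|x i| ^ a) * profMod s R ψ x

theorem measurable_prof (s R : ℝ) : Measurable (prof s R) := by
  unfold prof
  fun_prop

theorem measurable_profMod (s R : ℝ) (ψ : L2) : Measurable (profMod s R ψ) :=
  ((measurable_prof s R).comp measurable_norm).ennreal_ofReal.mul (measurable_enorm_L2 ψ)

theorem measurable_coordMod (s R : ℝ) (i : Fin 2) (a : ℝ) (ψ : L2) :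
    Measurable (coordMod s R i a ψ) :=
  (by fun_prop : Measurable (fun x : Plane => ENNReal.ofReal (|x i| ^ a))).mul
    (measurable_profMod s R ψ)

/-- Each of the two terms carries two `coordMod` factors, to be absorbed by the dissipation, and one
`profMod` factor, which contributes the square root of the energy. -/
theorem ofReal_qker_mul {s R : ℝ} (hR : 0 ≤ R) (i : Fin 2) (a : ℝ) (ψ : L2) (x y z : Plane) :
    ENNReal.ofReal (qker s R i a x y z) * (‖ψ x‖ₑ * (‖ψ y‖ₑ * ‖ψ z‖ₑ)) =
      ENNReal.ofReal (lowKer s i a x y) * coordMod s R i a ψ y *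
          (coordMod s R i a ψ z * profMod s R ψ x) +
        ENNReal.ofReal (lowKer s i a x y) * coordMod s R i a ψ y *
          (profMod s R ψ z * coordMod s R i a ψ x) := by
  have hp : ∀ x : Plane, 0 ≤ prof s R ‖x‖ := fun x => prof_nonneg hR (norm_nonneg x)
  have h1 := lowKer_nonneg s i a x y
  have e : qker s R i a x y z = lowKer s i a x y * (prof s R ‖x‖ * (prof s R ‖y‖ * (prof s R ‖z‖ *
      (|y i| ^ a * (|z i| ^ a + |x i| ^ a))))) := by
    rw [qker, lowKer]
    ring
  have hx := hp x
  have hy := hp y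
  have hz := hp z
  rw [e, ENNReal.ofReal_mul h1, ENNReal.ofReal_mul hx, ENNReal.ofReal_mul hy, ENNReal.ofReal_mul hz,
    ENNReal.ofReal_mul (by positivity), ENNReal.ofReal_add (by positivity) (by positivity)]
  simp only [coordMod, profMod]
  ring

theorem le_rpow_half_of_sq_le {a b : ℝ≥0∞} (h : a ^ 2 ≤ b) : a ≤ b ^ (1 / 2 : ℝ) := by
  rw [one_div, ENNReal.le_rpow_inv_iff two_pos, ENNReal.rpow_two]
  exact h

theorem lintegral_qker_le {s R a : ℝ} (hR : 0 ≤ R) (i : Fin 2) (ψ : L2)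
    {X Y Z : Plane × Plane → Plane}
    (hXY : MeasurePreserving (fun p => (X p, Y p)) (volume.prod volume) (volume.prod volume))
    (hZX : MeasurePreserving (fun p => (Z p, X p)) (volume.prod volume) (volume.prod volume))
    {C : ℝ≥0∞} (hC : ∀ y : Plane, ∫⁻ x, ENNReal.ofReal (lowKer s i a x y) ^ 2 ≤ C) :
    Measurable (fun p => ENNReal.ofReal (qker s R i a (X p) (Y p) (Z p)) *
      (‖ψ (X p)‖ₑ * (‖ψ (Y p)‖ₑ * ‖ψ (Z p)‖ₑ))) ∧
    ∫⁻ p, ENNReal.ofReal (qker s R i a (X p) (Y p) (Z p)) *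
      (‖ψ (X p)‖ₑ * (‖ψ (Y p)‖ₑ * ‖ψ (Z p)‖ₑ)) ∂(volume.prod volume) ≤
      2 * ((C * ∫⁻ x, coordMod s R i a ψ x ^ 2) *
        ((∫⁻ x, coordMod s R i a ψ x ^ 2) * ∫⁻ x, profMod s R ψ x ^ 2)) ^ (1 / 2 : ℝ) := by
  have hl := (measurable_lowKer s i a).ennreal_ofReal
  have hF := measurable_coordMod s R i a ψ
  have hG := measurable_profMod s R ψ
  have h1 := le_rpow_half_of_sq_le (trilinear_cauchy_schwarz hXY hZX hl hC hF hF hG)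
  have h2 := le_rpow_half_of_sq_le (trilinear_cauchy_schwarz hXY hZX hl hC hF hG hF)
  rw [mul_comm (∫⁻ x, profMod s R ψ x ^ 2)] at h2
  have hX : Measurable X := measurable_fst.comp hXY.measurable
  have hY : Measurable Y := measurable_snd.comp hXY.measurable
  have hZ : Measurable Z := measurable_fst.comp hZX.measurable
  have hlF : Measurable (fun p => ENNReal.ofReal (lowKer s i a (X p) (Y p)) *
      coordMod s R i a ψ (Y p)) := (hl.comp hXY.measurable).mul (hF.comp hY)
  have hm1 : Measurable (fun p => ENNReal.ofReal (lowKer s i a (X p) (Y p)) *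
      coordMod s R i a ψ (Y p) * (coordMod s R i a ψ (Z p) * profMod s R ψ (X p))) :=
    hlF.mul ((hF.comp hZ).mul (hG.comp hX))
  have hm2 : Measurable (fun p => ENNReal.ofReal (lowKer s i a (X p) (Y p)) *
      coordMod s R i a ψ (Y p) * (profMod s R ψ (Z p) * coordMod s R i a ψ (X p))) :=
    hlF.mul ((hG.comp hZ).mul (hF.comp hX))
  simp only [ofReal_qker_mul hR]
  refine ⟨hm1.add hm2, ?_⟩
  rw [lintegral_add_left hm1, two_mul]
  exact add_le_add h1 h2

theorem lintegral_qsum_le {s R a : ℝ} (hR : 0 ≤ R) (i : Fin 2) (ψ : L2)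
    {C : ℝ≥0∞} (hC : ∀ y : Plane, ∫⁻ x, ENNReal.ofReal (lowKer s i a x y) ^ 2 ≤ C) :
    ∫⁻ p : Plane × Plane, ENNReal.ofReal (qsum s R i a p.1 p.2 (p.1 - p.2)) *
      (‖ψ p.1‖ₑ * (‖ψ p.2‖ₑ * ‖ψ (p.1 - p.2)‖ₑ)) ∂(volume.prod volume) ≤
      12 * ((C * ∫⁻ x, coordMod s R i a ψ x ^ 2) *
        ((∫⁻ x, coordMod s R i a ψ x ^ 2) * ∫⁻ x, profMod s R ψ x ^ 2)) ^ (1 / 2 : ℝ) := by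
  have m12 : MeasurePreserving (fun p : Plane × Plane => (p.1, p.2)) (volume.prod volume)
      (volume.prod volume) := MeasurePreserving.id _
  have m21 : MeasurePreserving (fun p : Plane × Plane => (p.2, p.1)) (volume.prod volume)
      (volume.prod volume) := Measure.measurePreserving_swap
  have m13 := measurePreserving_fst_sub
  have m31 : MeasurePreserving (fun p : Plane × Plane => (p.1 - p.2, p.1)) (volume.prod volume)
      (volume.prod volume) := Measure.measurePreserving_swap.comp m13
  have m32 : MeasurePreserving (fun p : Plane × Plane => (p.1 - p.2, p.2)) (volume.prod volume)
      (volume.prod volume) := measurePreserving_sub_prod volume volume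
  have m23 : MeasurePreserving (fun p : Plane × Plane => (p.2, p.1 - p.2)) (volume.prod volume)
      (volume.prod volume) := Measure.measurePreserving_swap.comp m32
  -- The six orderings of ξ, η, ξ - η contribute two terms each, whence the factor 12.
  obtain ⟨a1, b1⟩ := lintegral_qker_le hR i ψ m12 m31 hC
  obtain ⟨a2, b2⟩ := lintegral_qker_le hR i ψ m13 m21 hC
  obtain ⟨a3, b3⟩ := lintegral_qker_le hR i ψ m21 m32 hC
  obtain ⟨a4, b4⟩ := lintegral_qker_le hR i ψ m23 m12 hC
  obtain ⟨a5, b5⟩ := lintegral_qker_le hR i ψ m31 m23 hC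
  obtain ⟨a6, b6⟩ := lintegral_qker_le hR i ψ m32 m13 hC
  set J := ((C * ∫⁻ x, coordMod s R i a ψ x ^ 2) *
        ((∫⁻ x, coordMod s R i a ψ x ^ 2) * ∫⁻ x, profMod s R ψ x ^ 2)) ^ (1 / 2 : ℝ) with hJ
  have q0 := qker_nonneg (s := s) hR i a
  have e : ∀ p : Plane × Plane, ENNReal.ofReal (qsum s R i a p.1 p.2 (p.1 - p.2)) *
      (‖ψ p.1‖ₑ * (‖ψ p.2‖ₑ * ‖ψ (p.1 - p.2)‖ₑ)) =
      ENNReal.ofReal (qker s R i a p.1 p.2 (p.1 - p.2)) *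
        (‖ψ p.1‖ₑ * (‖ψ p.2‖ₑ * ‖ψ (p.1 - p.2)‖ₑ)) +
      (ENNReal.ofReal (qker s R i a p.1 (p.1 - p.2) p.2) *
        (‖ψ p.1‖ₑ * (‖ψ (p.1 - p.2)‖ₑ * ‖ψ p.2‖ₑ)) +
      (ENNReal.ofReal (qker s R i a p.2 p.1 (p.1 - p.2)) *
        (‖ψ p.2‖ₑ * (‖ψ p.1‖ₑ * ‖ψ (p.1 - p.2)‖ₑ)) +
      (ENNReal.ofReal (qker s R i a p.2 (p.1 - p.2) p.1) *
        (‖ψ p.2‖ₑ * (‖ψ (p.1 - p.2)‖ₑ * ‖ψ p.1‖ₑ)) +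
      (ENNReal.ofReal (qker s R i a (p.1 - p.2) p.1 p.2) *
        (‖ψ (p.1 - p.2)‖ₑ * (‖ψ p.1‖ₑ * ‖ψ p.2‖ₑ)) +
      ENNReal.ofReal (qker s R i a (p.1 - p.2) p.2 p.1) *
        (‖ψ (p.1 - p.2)‖ₑ * (‖ψ p.2‖ₑ * ‖ψ p.1‖ₑ)))))) := by
    intro p
    have e0 : qsum s R i a p.1 p.2 (p.1 - p.2) = qker s R i a p.1 p.2 (p.1 - p.2) +
        (qker s R i a p.1 (p.1 - p.2) p.2 + (qker s R i a p.2 p.1 (p.1 - p.2) +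
        (qker s R i a p.2 (p.1 - p.2) p.1 + (qker s R i a (p.1 - p.2) p.1 p.2 +
        qker s R i a (p.1 - p.2) p.2 p.1)))) := by
      rw [qsum]
      ring
    have h56 := add_nonneg (q0 (p.1 - p.2) p.1 p.2) (q0 (p.1 - p.2) p.2 p.1)
    have h4 := add_nonneg (q0 p.2 (p.1 - p.2) p.1) h56
    have h3 := add_nonneg (q0 p.2 p.1 (p.1 - p.2)) h4
    have h2 := add_nonneg (q0 p.1 (p.1 - p.2) p.2) h3
    rw [e0, ENNReal.ofReal_add (q0 _ _ _) h2, ENNReal.ofReal_add (q0 _ _ _) h3,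
      ENNReal.ofReal_add (q0 _ _ _) h4, ENNReal.ofReal_add (q0 _ _ _) h56,
      ENNReal.ofReal_add (q0 _ _ _) (q0 _ _ _)]
    ring
  simp only [e]
  rw [lintegral_add_left a1, lintegral_add_left a2, lintegral_add_left a3, lintegral_add_left a4,
    lintegral_add_left a5]
  refine (add_le_add b1 (add_le_add b2 (add_le_add b3 (add_le_add b4 (add_le_add b5 b6))))).trans_eq ?_
  ring

/-- The square of the profile as a weight on the plane. -/
def profWeight (s R : ℝ) (ξ : Plane) : ℝ := prof s R ‖ξ‖ ^ 2

theorem profWeight_nonneg (s R : ℝ) (ξ : Plane) : 0 ≤ profWeight s R ξ := sq_nonneg _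

theorem measurable_profWeight (s R : ℝ) : Measurable (profWeight s R) :=
  ((measurable_prof s R).comp measurable_norm).pow_const 2

theorem profWeight_le {s R : ℝ} (hs : 0 ≤ s) (hR : 0 ≤ R) (ξ : Plane) :
    profWeight s R ξ ≤ (R ^ s) ^ 2 := by
  have h0 : 0 ≤ min ‖ξ‖ R := le_min (norm_nonneg ξ) hR
  unfold profWeight prof
  gcongr
  exact min_le_right _ _

theorem energy_nonneg {w : Plane → ℝ} (hw0 : ∀ ξ, 0 ≤ w ξ) (ψ : L2) : 0 ≤ energy w ψ :=
  integral_nonneg fun ξ => mul_nonneg (hw0 ξ) (by positivity)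

theorem dis_nonneg {μ ν α β : ℝ} (hμ : 0 ≤ μ) (hν : 0 ≤ ν) {w : Plane → ℝ} (hw0 : ∀ ξ, 0 ≤ w ξ)
    (ψ : L2) : 0 ≤ dis μ ν α β w ψ :=
  integral_nonneg fun ξ => mul_nonneg (hw0 ξ) (mul_nonneg (dissip_nonneg hμ hν ξ) (by positivity))

theorem ofReal_energy {w : Plane → ℝ} (hw : Measurable w) {C : ℝ} (hw0 : ∀ ξ, 0 ≤ w ξ)
    (hwC : ∀ ξ, w ξ ≤ C) (ψ : L2) :
    ENNReal.ofReal (energy w ψ) = ∫⁻ ξ, ENNReal.ofReal (w ξ) * ‖ψ ξ‖ₑ ^ 2 := by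
  rw [energy, ofReal_integral_eq_lintegral_ofReal
    (weight_mul_integrable hw hw0 hwC (integrable_norm_sq ψ))
    (Eventually.of_forall fun ξ => mul_nonneg (hw0 ξ) (by positivity))]
  refine lintegral_congr fun ξ => ?_
  rw [ENNReal.ofReal_mul (hw0 ξ), ENNReal.ofReal_pow (norm_nonneg _), ofReal_norm]

/-- The trilinear estimate at the critical regularity. The constant does not depend on `R`. -/
theorem exists_tri_profWeight_le {μ ν α β s a c₀ : ℝ} (hμ : 0 ≤ μ) (hν : 0 ≤ ν)
    (hsa : s = 2 - 2 * a) (ha0 : 0 < a) (ha : a < 1 / 2) (i : Fin 2) (hc₀ : 0 < c₀)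
    (hdis : ∀ ξ, c₀ * |ξ i| ^ (2 * a) ≤ dissip μ ν α β ξ) :
    ∃ K : ℝ, 0 < K ∧ ∀ R, 0 < R → ∀ ψ : L2, absTri ψ < ∞ → (∀ᵐ ξ, ψ (-ξ) = star (ψ ξ)) →
      Integrable (fun ξ => dissip μ ν α β ξ * ‖ψ ξ‖ ^ 2) →
      |tri (profWeight s R) ψ| ≤
        K * √(energy (profWeight s R) ψ) * dis μ ν α β (profWeight s R) ψ := by
  have hs1 : 1 < s := by linarith
  obtain ⟨C, hClt, hC⟩ := exists_lowKer_bound hsa ha0 ha i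
  set K₀ : ℝ≥0∞ := ENNReal.ofReal Real.pi * (ENNReal.ofReal (20 * s * (2 ^ s) ^ 2) *
    (12 * (C ^ (1 / 2 : ℝ) * ENNReal.ofReal c₀⁻¹))) with hK₀
  have hK₀lt : K₀ ≠ ∞ := by
    refine ENNReal.mul_ne_top ENNReal.ofReal_ne_top (ENNReal.mul_ne_top ENNReal.ofReal_ne_top
      (ENNReal.mul_ne_top (by simp) (ENNReal.mul_ne_top ?_ ENNReal.ofReal_ne_top)))
    exact ENNReal.rpow_ne_top_of_nonneg (by norm_num) hClt.ne
  -- The added 1 only makes the constant positive, so that it can later be inverted.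
  refine ⟨K₀.toReal + 1, by positivity, fun R hR ψ hψ hherm hint => ?_⟩
  set w := profWeight s R with hw
  have hwm : Measurable w := measurable_profWeight s R
  have hw0 : ∀ ξ, 0 ≤ w ξ := profWeight_nonneg s R
  have hwC : ∀ ξ, w ξ ≤ (R ^ s) ^ 2 := profWeight_le (by linarith) hR.le
  set E := energy w ψ with hE
  set D := dis μ ν α β w ψ with hD
  have hE0 : 0 ≤ E := energy_nonneg hw0 ψ
  have hD0 : 0 ≤ D := dis_nonneg hμ hν hw0 ψ
  have hG : ∫⁻ x, profMod s R ψ x ^ 2 = ENNReal.ofReal E := by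
    rw [hE, ofReal_energy hwm hw0 hwC]
    refine lintegral_congr fun x => ?_
    rw [profMod, mul_pow, ← ENNReal.ofReal_pow (prof_nonneg hR.le (norm_nonneg x)), hw, profWeight]
  have hF : ∫⁻ x, coordMod s R i a ψ x ^ 2 ≤ ENNReal.ofReal c₀⁻¹ * ENNReal.ofReal D := by
    rw [hD, dis, ofReal_integral_eq_lintegral_ofReal (weight_mul_integrable hwm hw0 hwC hint)
      (Eventually.of_forall fun ξ => mul_nonneg (hw0 ξ)
        (mul_nonneg (dissip_nonneg hμ hν ξ) (by positivity))),
      ← lintegral_const_mul' _ _ ENNReal.ofReal_ne_top]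
    refine lintegral_mono fun x => ?_
    have hp := prof_nonneg (s := s) hR.le (norm_nonneg x)
    simp only [coordMod, profMod, ← ofReal_norm]
    rw [← ENNReal.ofReal_mul hp, ← ENNReal.ofReal_mul (by positivity),
      ← ENNReal.ofReal_pow (by positivity), ← ENNReal.ofReal_mul (by positivity)]
    refine ENNReal.ofReal_le_ofReal ?_
    have h1 : (|x i| ^ a) ^ 2 ≤ c₀⁻¹ * dissip μ ν α β x := by
      rw [le_inv_mul_iff₀ hc₀]
      refine le_trans (le_of_eq ?_) (hdis x)
      rw [← Real.rpow_natCast, ← Real.rpow_mul (abs_nonneg _), mul_comm a]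
      norm_num
    calc (|x i| ^ a * (prof s R ‖x‖ * ‖ψ x‖)) ^ 2
        = (|x i| ^ a) ^ 2 * (prof s R ‖x‖ ^ 2 * ‖ψ x‖ ^ 2) := by ring
      _ ≤ (c₀⁻¹ * dissip μ ν α β x) * (prof s R ‖x‖ ^ 2 * ‖ψ x‖ ^ 2) := by gcongr
      _ = _ := by
        rw [hw, profWeight]
        ring
  have hmain : ‖tri w ψ‖ₑ ≤ K₀ * (ENNReal.ofReal √E * ENNReal.ofReal D) := by
    calc ‖tri w ψ‖ₑ ≤ _ := enorm_tri_le hwm hw0 hwC hψ hherm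
      _ ≤ ENNReal.ofReal Real.pi * (ENNReal.ofReal (20 * s * (2 ^ s) ^ 2) *
          ∫⁻ p : Plane × Plane, ENNReal.ofReal (qsum s R i a p.1 p.2 (p.1 - p.2)) *
          (‖ψ p.1‖ₑ * (‖ψ p.2‖ₑ * ‖ψ (p.1 - p.2)‖ₑ)) ∂(volume.prod volume)) := by
        gcongr
        rw [← lintegral_const_mul' _ _ ENNReal.ofReal_ne_top]
        refine lintegral_mono fun p => ?_
        dsimp only
        rw [← mul_assoc (ENNReal.ofReal _) (ENNReal.ofReal _), ← ENNReal.ofReal_mul (by positivity)]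
        exact mul_le_mul_left (ENNReal.ofReal_le_ofReal
          (commutator_kernel_le hs1.le hR ha0 ha.le i p.1 p.2)) _
      _ ≤ ENNReal.ofReal Real.pi * (ENNReal.ofReal (20 * s * (2 ^ s) ^ 2) *
          (12 * ((C * (ENNReal.ofReal c₀⁻¹ * ENNReal.ofReal D)) *
          ((ENNReal.ofReal c₀⁻¹ * ENNReal.ofReal D) * ENNReal.ofReal E)) ^ (1 / 2 : ℝ))) := by
        gcongr
        refine (lintegral_qsum_le hR.le i ψ hC).trans ?_
        rw [hG]
        gcongr
      _ = K₀ * (ENNReal.ofReal √E * ENNReal.ofReal D) := by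
        -- The dissipation appears squared under the square root, hence linearly in the result.
        have e : (C * (ENNReal.ofReal c₀⁻¹ * ENNReal.ofReal D)) *
          ((ENNReal.ofReal c₀⁻¹ * ENNReal.ofReal D) * ENNReal.ofReal E) =
          C * (ENNReal.ofReal E * (ENNReal.ofReal c₀⁻¹ * ENNReal.ofReal D) ^ (2 : ℝ)) := by
          rw [ENNReal.rpow_two]
          ring
        rw [e, ENNReal.mul_rpow_of_nonneg _ _ (by norm_num), ENNReal.mul_rpow_of_nonneg _ _
          (by norm_num), ← ENNReal.rpow_mul, ENNReal.ofReal_rpow_of_nonneg hE0 (by norm_num),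
          ← Real.sqrt_eq_rpow]
        norm_num
        rw [hK₀]
        norm_num
        ring
  clear_value K₀
  have h1 := ENNReal.toReal_mono (ENNReal.mul_ne_top hK₀lt
    (ENNReal.mul_ne_top ENNReal.ofReal_ne_top ENNReal.ofReal_ne_top)) hmain
  rw [toReal_enorm, Real.norm_eq_abs, ENNReal.toReal_mul (a := K₀), ENNReal.toReal_mul,
    ENNReal.toReal_ofReal (Real.sqrt_nonneg _), ENNReal.toReal_ofReal hD0] at h1
  have h2 : 0 ≤ √E * D := by positivity
  nlinarith


/-! ### Energy decrease and the 1/t decay of the homogeneous norm -/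

/-- An energy whose growth is controlled by a small multiple of the dissipation decreases. -/
theorem energy_add_integral_le {E T D : ℝ → ℝ} {K : ℝ} (hD0 : ∀ t, 0 ≤ t → 0 ≤ D t)
    (hTi : ∀ t₀ t, 0 ≤ t₀ → t₀ ≤ t → IntervalIntegrable T volume t₀ t)
    (hDi : ∀ t₀ t, 0 ≤ t₀ → t₀ ≤ t → IntervalIntegrable D volume t₀ t)
    (heq : ∀ t₀ t, 0 ≤ t₀ → t₀ ≤ t → E t - E t₀ = ∫ τ in t₀..t, 2 * (T τ - D τ))
    (hT : ∀ t, 0 ≤ t → |T t| ≤ K * √(E t) * D t) (hK : 0 ≤ K) (h0 : K * √(E 0) < 1 / 2)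
    {t₀ t : ℝ} (ht₀ : 0 ≤ t₀) (ht : t₀ ≤ t) : E t + ∫ τ in t₀..t, D τ ≤ E t₀ := by
  -- While K √E ≤ 1/2, the transport contribution 2T is at most D, so 2(T - D) ≤ -D.
  have hdec : ∀ t₀ t, 0 ≤ t₀ → t₀ ≤ t → (∀ τ ∈ Set.Icc t₀ t, K * √(E τ) ≤ 1 / 2) →
      E t + ∫ τ in t₀..t, D τ ≤ E t₀ := by
    intro t₀ t ht₀ ht hsmall
    have h1 : ∫ τ in t₀..t, 2 * (T τ - D τ) ≤ ∫ τ in t₀..t, -D τ := by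
      refine intervalIntegral.integral_mono_on ht
        (((hTi t₀ t ht₀ ht).sub (hDi t₀ t ht₀ ht)).const_mul 2) (hDi t₀ t ht₀ ht).neg
        fun τ hτ => ?_
      have hτ0 : 0 ≤ τ := ht₀.trans hτ.1
      have h2 := (le_abs_self _).trans (hT τ hτ0)
      have h3 := mul_le_mul_of_nonneg_right (hsmall τ hτ) (hD0 τ hτ0)
      linarith
    rw [intervalIntegral.integral_neg] at h1
    have h2 := heq t₀ t ht₀ ht
    linarith
  have hcont : ∀ b, 0 ≤ b → ContinuousOn E (Set.Icc 0 b) := by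
    intro b hb
    have hi := ((hTi 0 b le_rfl hb).sub (hDi 0 b le_rfl hb)).const_mul 2
    have h1 := intervalIntegral.continuousOn_primitive_interval (μ := volume)
      (f := fun τ => 2 * (T τ - D τ)) (a := 0) (b := b)
      (by rwa [← intervalIntegrable_iff', ])
    rw [Set.uIcc_of_le hb] at h1
    refine (h1.const_add (E 0)).congr fun τ hτ => ?_
    have := heq 0 τ le_rfl hτ.1
    dsimp only
    linarith
  -- Continuity argument: the set where E ≤ E(0) is closed, and at each of its points the strict
  -- smallness persists for a short time, during which E decreases.
  have hbound : ∀ b, 0 ≤ b → E b ≤ E 0 := by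
    intro b hb
    have hcb := hcont (b + 1) (by linarith)
    have hsub : Set.Icc 0 (b + 1) ⊆ {t | E t ≤ E 0} := by
      refine IsClosed.Icc_subset_of_forall_mem_nhdsWithin ?_ (by simp) ?_
      · rw [Set.inter_comm]
        exact hcb.preimage_isClosed_of_isClosed isClosed_Icc isClosed_Iic
      · rintro x ⟨hx, hx0, hxb⟩
        have hx : E x ≤ E 0 := hx
        have hlt : K * √(E x) < 1 / 2 := lt_of_le_of_lt (by gcongr) h0
        have hc : ContinuousWithinAt (fun t => K * √(E t)) (Set.Icc 0 (b + 1)) x :=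
          (hcb x ⟨hx0, hxb.le⟩).sqrt.const_mul K
        have hev := hc.eventually_lt_const hlt
        have hev' : ∀ᶠ t in 𝓝[Set.Icc x (b + 1)] x, K * √(E t) < 1 / 2 :=
          nhdsWithin_mono x (Set.Icc_subset_Icc_left hx0) hev
        rw [nhdsWithin_Icc_eq_nhdsGE hxb] at hev'
        obtain ⟨u, hu, huS⟩ := (mem_nhdsGE_iff_exists_Ico_subset).1 hev'
        rw [mem_nhdsGT_iff_exists_Ioo_subset]
        refine ⟨u, hu, fun t ht => ?_⟩
        have h1 := hdec x t hx0 ht.1.le fun τ hτ => (huS ⟨hτ.1, hτ.2.trans_lt ht.2⟩).le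
        have h2 : 0 ≤ ∫ τ in x..t, D τ :=
          intervalIntegral.integral_nonneg ht.1.le fun τ hτ => hD0 τ (hx0.trans hτ.1)
        show E t ≤ E 0
        linarith
    exact hsub ⟨hb, by linarith⟩
  refine hdec t₀ t ht₀ ht fun τ hτ => ?_
  refine le_trans ?_ h0.le
  gcongr
  exact hbound τ (ht₀.trans hτ.1)

theorem IsGlobalSolution.sob_lt_top (h : IsGlobalSolution μ ν α β s θ) (hs : 0 ≤ s) {t : ℝ}
    (ht : 0 ≤ t) : sob s (𝓕 (θ t)) < ∞ :=
  (sob_le_sobolevNorm_sq hs _).trans_lt (ENNReal.pow_lt_top (h.mem_sobolev t ht))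

theorem IsGlobalSolution.absTri_lt_top (h : IsGlobalSolution μ ν α β s θ) (hs : 1 < s) {t : ℝ}
    (ht : 0 ≤ t) : absTri (𝓕 (θ t)) < ∞ :=
  AQG.absTri_lt_top hs _ (h.sob_lt_top (by linarith) ht)

theorem IsGlobalSolution.hermitian (h : IsGlobalSolution μ ν α β s θ) {t : ℝ}
    (ht : 0 ≤ t) : ∀ᵐ ξ : Plane, (𝓕 (θ t) : L2) (-ξ) = star ((𝓕 (θ t) : L2) ξ) :=
  fourier_hermitian (h.real_valued t ht)

theorem IsGlobalSolution.integrable_dissip (h : IsGlobalSolution μ ν α β s θ) (hs : 1 < s)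
    (hμ : 0 ≤ μ) (hν : 0 ≤ ν) (hα : 0 ≤ α) (hβ : 0 ≤ β) (hα1 : α ≤ 1) (hβ1 : β ≤ 1) {t : ℝ}
    (ht : 0 ≤ t) : Integrable (fun ξ => dissip μ ν α β ξ * ‖(𝓕 (θ t) : L2) ξ‖ ^ 2) := by
  obtain ⟨C, hC0, hC⟩ := exists_dissip_le hμ hν hα hβ (hα1.trans hs.le) (hβ1.trans hs.le)
  exact (AQG.integrable_dissip hμ hν hC0 hC (h.sob_lt_top (by linarith) ht)).1

/-- Since the transport term vanishes for the constant weight, the absorption argument applies with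
K = 0 and needs no smallness. -/
theorem IsGlobalSolution.energy_one_le (h : IsGlobalSolution μ ν α β s θ) (hs : 1 < s)
    (hμ : 0 ≤ μ) (hν : 0 ≤ ν) (hα : 0 ≤ α) (hβ : 0 ≤ β) (hα1 : α ≤ 1) (hβ1 : β ≤ 1) {t : ℝ}
    (ht : 0 ≤ t) : energy (fun _ => 1) (𝓕 (θ t)) + ∫ τ in 0..t, dis μ ν α β (fun _ => 1) (𝓕 (θ τ)) ≤
      energy (fun _ => 1) (𝓕 (θ 0)) := by
  have he := fun t₀ t (ht₀ : 0 ≤ t₀) (ht : t₀ ≤ t) => h.energy_eq hs hμ hν hα hβ hα1 hβ1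
    (w := fun _ => 1) measurable_const (fun _ => zero_le_one) (C := 1) (fun _ => le_rfl) ht₀ ht
  refine energy_add_integral_le (K := 0) (E := fun t => energy (fun _ => 1) (𝓕 (θ t)))
    (T := fun t => tri (fun _ => 1) (𝓕 (θ t)))
    (D := fun t => dis μ ν α β (fun _ => 1) (𝓕 (θ t)))
    (fun t ht => dis_nonneg hμ hν (fun _ => zero_le_one) _) (fun t₀ t ht₀ ht => (he t₀ t ht₀ ht).1)
    (fun t₀ t ht₀ ht => (he t₀ t ht₀ ht).2.1) (fun t₀ t ht₀ ht => (he t₀ t ht₀ ht).2.2)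
    (fun t ht => ?_) le_rfl (by norm_num) le_rfl ht
  rw [tri_one (h.absTri_lt_top hs ht) (h.hermitian ht)]
  simp

/-- The dissipation controls the square of the frequency. -/
theorem min_mul_min_le_dissip (hμ : 0 ≤ μ) (hν : 0 ≤ ν) (hα : 0 ≤ α) (hβ : 0 ≤ β) (hα1 : α ≤ 1)
    (hβ1 : β ≤ 1) (ξ : Plane) : min μ ν * min 1 (‖ξ‖ ^ 2) ≤ dissip μ ν α β ξ := by
  have hm0 : 0 ≤ min μ ν := le_min hμ hν
  have hsq : ‖ξ‖ ^ 2 = |ξ 0| ^ 2 + |ξ 1| ^ 2 := by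
    rw [EuclideanSpace.norm_sq_eq, Fin.sum_univ_two]
    simp only [Real.norm_eq_abs]
  have key : ∀ (j : Fin 2) (a : ℝ), 0 ≤ a → a ≤ 1 →
      min 1 (|2 * Real.pi * ξ j| ^ 2) ≤ |2 * Real.pi * ξ j| ^ (2 * a) := by
    intro j a ha ha1
    rcases le_total 1 (|2 * Real.pi * ξ j|) with h | h
    · exact (min_le_left _ _).trans (Real.one_le_rpow h (by linarith))
    · rcases (abs_nonneg (2 * Real.pi * ξ j)).eq_or_lt with h0 | h0
      · rw [← h0]
        refine (min_le_right _ _).trans ?_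
        rw [zero_pow two_ne_zero]
        positivity
      refine (min_le_right _ _).trans ?_
      rw [← Real.rpow_natCast]
      exact Real.rpow_le_rpow_of_exponent_ge h0 h (by push_cast; linarith)
  have key2 : ∀ j : Fin 2, 4 * |ξ j| ^ 2 ≤ |2 * Real.pi * ξ j| ^ 2 := by
    intro j
    rw [abs_mul, mul_pow, abs_of_pos Real.two_pi_pos]
    gcongr
    nlinarith [Real.pi_gt_three]
  have h0 := key 0 α hα hα1
  have h1 := key 1 β hβ hβ1
  have hsum : min 1 (‖ξ‖ ^ 2) ≤ min 1 (|2 * Real.pi * ξ 0| ^ 2) + min 1 (|2 * Real.pi * ξ 1| ^ 2) := by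
    have k0 := key2 0
    have k1 := key2 1
    have p0 : 0 ≤ min 1 (|2 * Real.pi * ξ 0| ^ 2) := by positivity
    have p1 : 0 ≤ min 1 (|2 * Real.pi * ξ 1| ^ 2) := by positivity
    rcases min_cases 1 (|2 * Real.pi * ξ 0| ^ 2) with ⟨e0, _⟩ | ⟨e0, _⟩
    · rw [e0]
      exact (min_le_left _ _).trans (by linarith)
    rcases min_cases 1 (|2 * Real.pi * ξ 1| ^ 2) with ⟨e1, _⟩ | ⟨e1, _⟩
    · rw [e1]
      exact (min_le_left _ _).trans (by linarith)
    rw [e0, e1]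
    refine (min_le_right _ _).trans ?_
    rw [hsq]
    nlinarith [sq_nonneg |ξ 0|, sq_nonneg |ξ 1|]
  calc min μ ν * min 1 (‖ξ‖ ^ 2)
      ≤ min μ ν * (min 1 (|2 * Real.pi * ξ 0| ^ 2) + min 1 (|2 * Real.pi * ξ 1| ^ 2)) := by gcongr
    _ ≤ min μ ν * (|2 * Real.pi * ξ 0| ^ (2 * α) + |2 * Real.pi * ξ 1| ^ (2 * β)) := by gcongr
    _ = min μ ν * |2 * Real.pi * ξ 0| ^ (2 * α) + min μ ν * |2 * Real.pi * ξ 1| ^ (2 * β) := by ring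
    _ ≤ _ := by
        unfold dissip
        gcongr
        · exact min_le_left _ _
        · exact min_le_right _ _

theorem profWeight_le_rpow {R : ℝ} (hs : 0 ≤ s) (hR : 0 ≤ R) (ξ : Plane) :
    profWeight s R ξ ≤ ‖ξ‖ ^ (2 * s) := by
  have h0 : 0 ≤ min ‖ξ‖ R := le_min (norm_nonneg ξ) hR
  have e : ‖ξ‖ ^ (2 * s) = (‖ξ‖ ^ s) ^ 2 := by
    rw [← Real.rpow_natCast, ← Real.rpow_mul (norm_nonneg _), mul_comm]
    norm_num
  rw [e]
  unfold profWeight prof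
  gcongr
  exact min_le_left _ _

/-- For |ξ| ≥ 1 the symbol is bounded below, and the weighted dissipation suffices. For |ξ| ≤ 1 the
weight is at most |ξ|² because s ≥ 1, and the unweighted dissipation suffices. -/
theorem energy_profWeight_le (hμ : 0 < μ) (hν : 0 < ν) (hα : 0 ≤ α) (hβ : 0 ≤ β) (hα1 : α ≤ 1)
    (hβ1 : β ≤ 1) (hs : 1 ≤ s) {R : ℝ} (hR : 0 ≤ R) {ψ : L2}
    (hint : Integrable (fun ξ => dissip μ ν α β ξ * ‖ψ ξ‖ ^ 2)) :
    energy (profWeight s R) ψ ≤ (min μ ν)⁻¹ *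
      (dis μ ν α β (fun _ => 1) ψ + dis μ ν α β (profWeight s R) ψ) := by
  have hm0 : 0 < min μ ν := lt_min hμ hν
  have hi1 := weight_mul_integrable (w := fun _ => 1) measurable_const (C := 1)
    (fun _ => zero_le_one) (fun _ => le_rfl) hint
  have hi2 := weight_mul_integrable (measurable_profWeight s R) (profWeight_nonneg s R)
    (profWeight_le (by linarith) hR) hint
  have hi3 := weight_mul_integrable (measurable_profWeight s R) (profWeight_nonneg s R)
    (profWeight_le (by linarith) hR) (integrable_norm_sq ψ)
  rw [energy, dis, dis, ← integral_add hi1 hi2, ← integral_const_mul]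
  refine integral_mono hi3 ((hi1.add hi2).const_mul _) fun ξ => ?_
  have hw0 := profWeight_nonneg s R ξ
  have h1 : profWeight s R ξ ≤ min 1 (‖ξ‖ ^ 2) * (1 + profWeight s R ξ) := by
    rcases le_total 1 ‖ξ‖ with h | h
    · rw [min_eq_left (one_le_pow₀ h)]
      linarith
    · rw [min_eq_right (pow_le_one₀ (norm_nonneg _) h)]
      have h2 : profWeight s R ξ ≤ ‖ξ‖ ^ 2 := by
        refine (profWeight_le_rpow (by linarith) hR ξ).trans ?_
        rcases (norm_nonneg ξ).eq_or_lt with h0 | h0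
        · rw [← h0, Real.zero_rpow (by linarith)]
          positivity
        rw [← Real.rpow_natCast]
        exact Real.rpow_le_rpow_of_exponent_ge h0 h (by push_cast; linarith)
      nlinarith [sq_nonneg ‖ξ‖]
  have h2 : min 1 (‖ξ‖ ^ 2) ≤ (min μ ν)⁻¹ * dissip μ ν α β ξ := by
    rw [le_inv_mul_iff₀ hm0]
    exact min_mul_min_le_dissip hμ.le hν.le hα hβ hα1 hβ1 ξ
  calc profWeight s R ξ * ‖ψ ξ‖ ^ 2
      ≤ (min 1 (‖ξ‖ ^ 2) * (1 + profWeight s R ξ)) * ‖ψ ξ‖ ^ 2 := by gcongr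
    _ ≤ (((min μ ν)⁻¹ * dissip μ ν α β ξ) * (1 + profWeight s R ξ)) * ‖ψ ξ‖ ^ 2 := by gcongr
    _ = _ := by ring

/-- Decay of the truncated homogeneous norm of small solutions. -/
theorem IsGlobalSolution.mul_energy_profWeight_le (h : IsGlobalSolution μ ν α β s θ) (hs : 1 < s)
    (hμ : 0 < μ) (hν : 0 < ν) (hα : 0 ≤ α) (hβ : 0 ≤ β) (hα1 : α ≤ 1) (hβ1 : β ≤ 1)
    {K R : ℝ} (hK : 0 ≤ K) (hR : 0 < R)
    (htri : ∀ ψ : L2, absTri ψ < ∞ → (∀ᵐ ξ, ψ (-ξ) = star (ψ ξ)) →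
      Integrable (fun ξ => dissip μ ν α β ξ * ‖ψ ξ‖ ^ 2) →
      |tri (profWeight s R) ψ| ≤
        K * √(energy (profWeight s R) ψ) * dis μ ν α β (profWeight s R) ψ)
    (h0 : K * √(energy (profWeight s R) (𝓕 (θ 0))) < 1 / 2) {t : ℝ} (ht : 0 ≤ t) :
    t * energy (profWeight s R) (𝓕 (θ t)) ≤ (min μ ν)⁻¹ *
      (energy (fun _ => 1) (𝓕 (θ 0)) + energy (profWeight s R) (𝓕 (θ 0))) := by
  have hm0 : 0 < min μ ν := lt_min hμ hν
  set w := profWeight s R with hw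
  have hw0 : ∀ ξ, 0 ≤ w ξ := profWeight_nonneg s R
  have he := fun t₀ t (ht₀ : 0 ≤ t₀) (ht : t₀ ≤ t) => h.energy_eq hs hμ.le hν.le hα hβ hα1 hβ1
    (measurable_profWeight s R) hw0 (profWeight_le (by linarith) hR.le) ht₀ ht
  have he1 := (h.energy_eq hs hμ.le hν.le hα hβ hα1 hβ1
    (w := fun _ => 1) measurable_const (fun _ => zero_le_one) (C := 1) (fun _ => le_rfl) le_rfl ht).2.1
  have hint := fun τ (hτ : 0 ≤ τ) => h.integrable_dissip hs hμ.le hν.le hα hβ hα1 hβ1 hτ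
  have hdec : ∀ t₀ t, 0 ≤ t₀ → t₀ ≤ t → energy w (𝓕 (θ t)) + ∫ τ in t₀..t, dis μ ν α β w (𝓕 (θ τ)) ≤
      energy w (𝓕 (θ t₀)) := fun t₀ t ht₀ ht =>
    energy_add_integral_le (E := fun t => energy w (𝓕 (θ t))) (T := fun t => tri w (𝓕 (θ t)))
      (D := fun t => dis μ ν α β w (𝓕 (θ t))) (fun t ht => dis_nonneg hμ.le hν.le hw0 _)
      (fun t₀ t ht₀ ht => (he t₀ t ht₀ ht).1) (fun t₀ t ht₀ ht => (he t₀ t ht₀ ht).2.1)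
      (fun t₀ t ht₀ ht => (he t₀ t ht₀ ht).2.2)
      (fun t ht => htri _ (h.absTri_lt_top hs ht) (h.hermitian ht) (hint t ht)) hK h0 ht₀ ht
  -- Monotonicity bounds E(t) by E(τ), hence by the dissipations at every earlier time τ;
  -- integrating in τ over [0, t] produces the factor t.
  have hmono : ∀ τ ∈ Set.Icc 0 t, energy w (𝓕 (θ t)) ≤ (min μ ν)⁻¹ *
      (dis μ ν α β (fun _ => 1) (𝓕 (θ τ)) + dis μ ν α β w (𝓕 (θ τ))) := by
    intro τ hτ
    have h1 := hdec τ t hτ.1 hτ.2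
    have h2 : 0 ≤ ∫ σ in τ..t, dis μ ν α β w (𝓕 (θ σ)) :=
      intervalIntegral.integral_nonneg hτ.2 fun σ _ => dis_nonneg hμ.le hν.le hw0 _
    have h3 := energy_profWeight_le hμ hν hα hβ hα1 hβ1 hs.le hR.le (hint τ hτ.1)
    linarith
  have h1 : ∫ _ in 0..t, energy w (𝓕 (θ t)) ≤ ∫ τ in 0..t, (min μ ν)⁻¹ *
      (dis μ ν α β (fun _ => 1) (𝓕 (θ τ)) + dis μ ν α β w (𝓕 (θ τ))) :=
    intervalIntegral.integral_mono_on ht intervalIntegrable_const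
      ((he1.add (he 0 t le_rfl ht).2.1).const_mul _) hmono
  rw [intervalIntegral.integral_const, sub_zero, smul_eq_mul, intervalIntegral.integral_const_mul,
    intervalIntegral.integral_add he1 (he 0 t le_rfl ht).2.1] at h1
  refine h1.trans ?_
  have h2 := h.energy_one_le hs hμ.le hν.le hα hβ hα1 hβ1 ht
  have h3 := hdec 0 t le_rfl ht
  have h4 := energy_nonneg (w := fun _ => 1) (fun _ => zero_le_one) (𝓕 (θ t))
  have h5 := energy_nonneg hw0 (𝓕 (θ t))
  gcongr <;> linarith


/-! ### Uniform smallness of the low frequencies -/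

/-- The dissipation near the zero frequency. -/
theorem rpow_le_dissip (hμ : 0 ≤ μ) (hν : 0 ≤ ν) (hα : 0 ≤ α) (hβ : 0 ≤ β) (hα1 : α ≤ 1)
    (hβ1 : β ≤ 1) {ξ : Plane} (hξ : ‖ξ‖ ≤ 1) :
    min μ ν * ‖ξ‖ ^ (2 * max α β) ≤ 4 * dissip μ ν α β ξ := by
  have hm0 : 0 ≤ min μ ν := le_min hμ hν
  set b := max α β with hb
  have hb0 : 0 ≤ b := hα.trans (le_max_left _ _)
  have hb1 : b ≤ 1 := max_le hα1 hβ1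
  have hsq : ‖ξ‖ ^ 2 = |ξ 0| ^ 2 + |ξ 1| ^ 2 := by
    rw [EuclideanSpace.norm_sq_eq, Fin.sum_univ_two]
    simp only [Real.norm_eq_abs]
  have key : ∀ (j : Fin 2) (a : ℝ), 0 ≤ a → a ≤ b →
      |ξ j| ^ (2 * b) ≤ |2 * Real.pi * ξ j| ^ (2 * a) := by
    intro j a ha hab
    have hj : |ξ j| ≤ 1 := (PiLp.norm_apply_le ξ j).trans hξ
    have h1 : |ξ j| ^ (2 * b) ≤ |ξ j| ^ (2 * a) :=
      Real.rpow_le_rpow_of_exponent_ge_of_imp (abs_nonneg _) hj (by linarith)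
        (fun _ h => by linarith)
    refine h1.trans (Real.rpow_le_rpow (abs_nonneg _) ?_ (by positivity))
    rw [abs_mul, abs_of_pos Real.two_pi_pos]
    refine le_mul_of_one_le_left (abs_nonneg _) ?_
    nlinarith [Real.pi_gt_three]
  -- The larger coordinate is at least half the norm; the factor 4 bounds 2^{2b} for b ≤ 1.
  have hmax : ∃ j : Fin 2, ‖ξ‖ ≤ 2 * |ξ j| := by
    by_contra! hcon
    have h0 := hcon 0
    have h1 := hcon 1
    nlinarith [abs_nonneg (ξ 0), abs_nonneg (ξ 1), norm_nonneg ξ]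
  have h0 := key 0 α hα (le_max_left _ _)
  have h1 := key 1 β hβ (le_max_right _ _)
  have hsum : ‖ξ‖ ^ (2 * b) ≤ 4 * (|ξ 0| ^ (2 * b) + |ξ 1| ^ (2 * b)) := by
    obtain ⟨j, hj⟩ := hmax
    have h2 : (2 : ℝ) ^ (2 * b) ≤ 4 := by
      calc (2 : ℝ) ^ (2 * b) ≤ 2 ^ (2 : ℝ) :=
            Real.rpow_le_rpow_of_exponent_le (by norm_num) (by linarith)
        _ = 4 := by norm_num
    have h3 : |ξ j| ^ (2 * b) ≤ |ξ 0| ^ (2 * b) + |ξ 1| ^ (2 * b) := by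
      fin_cases j
      · exact le_add_of_nonneg_right (by positivity)
      · exact le_add_of_nonneg_left (by positivity)
    calc ‖ξ‖ ^ (2 * b) ≤ (2 * |ξ j|) ^ (2 * b) :=
          Real.rpow_le_rpow (norm_nonneg _) hj (by positivity)
      _ = 2 ^ (2 * b) * |ξ j| ^ (2 * b) := Real.mul_rpow (by norm_num) (abs_nonneg _)
      _ ≤ 4 * (|ξ 0| ^ (2 * b) + |ξ 1| ^ (2 * b)) := by gcongr
  calc min μ ν * ‖ξ‖ ^ (2 * b) ≤ min μ ν * (4 * (|ξ 0| ^ (2 * b) + |ξ 1| ^ (2 * b))) := by gcongr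
    _ ≤ min μ ν * (4 * (|2 * Real.pi * ξ 0| ^ (2 * α) + |2 * Real.pi * ξ 1| ^ (2 * β))) := by gcongr
    _ = 4 * (min μ ν * |2 * Real.pi * ξ 0| ^ (2 * α) +
        min μ ν * |2 * Real.pi * ξ 1| ^ (2 * β)) := by ring
    _ ≤ _ := by
        unfold dissip
        gcongr
        · exact min_le_left _ _
        · exact min_le_right _ _

/-- The cutoff to low frequencies. -/
def lowWeight (δ : ℝ) : Plane → ℝ := (Metric.ball 0 δ).indicator fun _ => 1

theorem measurable_lowWeight (δ : ℝ) : Measurable (lowWeight δ) :=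
  measurable_const.indicator measurableSet_ball

theorem lowWeight_nonneg (δ : ℝ) (ξ : Plane) : 0 ≤ lowWeight δ ξ :=
  Set.indicator_nonneg (fun _ _ => zero_le_one) ξ

theorem lowWeight_le_one (δ : ℝ) (ξ : Plane) : lowWeight δ ξ ≤ 1 :=
  Set.indicator_le_self' (fun _ _ => zero_le_one) ξ

/-- The mass of `‖ξ‖ ^ (-2 b)` on a ball. -/
def ballMass (b δ : ℝ) : ℝ≥0∞ :=
  ∫⁻ ξ in Metric.ball (0 : Plane) δ, ENNReal.ofReal (‖ξ‖ ^ (-b)) ^ 2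

theorem ballMass_one_lt_top {b : ℝ} (hb : b < 1) : ballMass b 1 < ∞ := by
  -- The left endpoint -1 merely keeps 0 inside the interval, so that the integrands agree at the
  -- origin too. In polar coordinates r^{1-2b} is integrable at 0 because b < 1.
  have h1 : Integrable (fun x : Plane => (Set.Ioo (-1 : ℝ) 1).indicator (fun r => r ^ (-(2 * b))) ‖x‖) := by
    rw [integrable_fun_norm_addHaar volume (f := (Set.Ioo (-1 : ℝ) 1).indicator fun r => r ^ (-(2 * b)))]
    have h : IntegrableOn (fun y : ℝ => y ^ (1 - 2 * b)) (Set.Ioc 0 1) := by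
      rw [← intervalIntegrable_iff_integrableOn_Ioc_of_le zero_le_one]
      exact intervalIntegral.intervalIntegrable_rpow' (by linarith)
    have h' : IntegrableOn (fun y : ℝ => y ^ (1 - 2 * b)) (Set.Ioo 0 1) := h.mono_set Set.Ioo_subset_Ioc_self
    rw [← integrable_indicator_iff measurableSet_Ioo] at h'
    rw [← integrable_indicator_iff measurableSet_Ioi]
    refine h'.congr (Eventually.of_forall fun y => ?_)
    by_cases hy : 0 < y
    · rw [Set.indicator_of_mem (Set.mem_Ioi.2 hy)]
      by_cases hy1 : y < 1
      · rw [Set.indicator_of_mem (s := Set.Ioo (0 : ℝ) 1) ⟨hy, hy1⟩,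
          Set.indicator_of_mem (s := Set.Ioo (-1 : ℝ) 1) ⟨by linarith, hy1⟩]
        have e : (1 - 2 * b : ℝ) = 1 + (-(2 * b)) := by ring
        rw [e, Real.rpow_add hy]
        simp
      · rw [Set.indicator_of_notMem (fun h => hy1 h.2), Set.indicator_of_notMem (fun h => hy1 h.2)]
        simp
    · rw [Set.indicator_of_notMem (fun h => hy h.1), Set.indicator_of_notMem (show y ∉ Set.Ioi 0 from hy)]
  refine lt_of_le_of_lt (le_of_eq ?_) h1.lintegral_lt_top
  rw [ballMass, ← lintegral_indicator measurableSet_ball]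
  refine lintegral_congr fun x => ?_
  by_cases hx : ‖x‖ < 1
  · rw [Set.indicator_of_mem (by simpa using hx), Set.indicator_of_mem (s := Set.Ioo (-1 : ℝ) 1)
      ⟨by linarith [norm_nonneg x], hx⟩,
      ← ENNReal.ofReal_pow (by positivity), ← Real.rpow_natCast, ← Real.rpow_mul (norm_nonneg _)]
    congr 2
    push_cast
    ring
  · rw [Set.indicator_of_notMem (by simpa using hx), Set.indicator_of_notMem (fun h => hx h.2)]
    simp

theorem tendsto_volume_ball_zero :
    Tendsto (fun δ : ℝ => volume (Metric.ball (0 : Plane) δ)) (𝓝[>] 0) (𝓝 0) := by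
  simp only [EuclideanSpace.volume_ball]
  have h : Tendsto (fun δ : ℝ => ENNReal.ofReal δ ^ Fintype.card (Fin 2)) (𝓝[>] 0) (𝓝 0) := by
    have h1 : Tendsto (fun δ : ℝ => ENNReal.ofReal δ) (𝓝[>] 0) (𝓝 0) := by
      have := (ENNReal.continuous_ofReal.tendsto 0).mono_left (nhdsWithin_le_nhds (s := Set.Ioi (0 : ℝ)))
      simpa using this
    simpa using ENNReal.Tendsto.pow (n := 2) h1
  have := ENNReal.Tendsto.mul_const (b := ENNReal.ofReal
    (√Real.pi ^ Fintype.card (Fin 2) / Real.Gamma ((Fintype.card (Fin 2) : ℝ) / 2 + 1))) h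
    (Or.inr ENNReal.ofReal_ne_top)
  simpa using this

theorem tendsto_setLIntegral_ball {f : Plane → ℝ≥0∞} (hf : ∫⁻ x in Metric.ball 0 1, f x < ∞) :
    Tendsto (fun δ : ℝ => ∫⁻ x in Metric.ball (0 : Plane) δ, f x) (𝓝[>] 0) (𝓝 0) := by
  have h1 : ∫⁻ x, (Metric.ball (0 : Plane) 1).indicator f x ≠ ∞ := by
    rw [lintegral_indicator measurableSet_ball]
    exact hf.ne
  refine (tendsto_setLIntegral_zero h1 tendsto_volume_ball_zero).congr' ?_
  filter_upwards [Ioc_mem_nhdsGT (one_pos : (0 : ℝ) < 1)] with δ hδ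
  refine setLIntegral_congr_fun measurableSet_ball fun x hx => ?_
  exact Set.indicator_of_mem (Metric.ball_subset_ball hδ.2 hx) _

/-- For |ξ| ≤ 1 the kernel is bounded both by 1 and by |ξ - η|. The minimum of the two, once
squared, is controlled by the dissipation symbol, so Cauchy–Schwarz costs one L² norm and only half
a power of the dissipation. -/
theorem enorm_nonlin_sq_le (ψ : L2) {ξ : Plane} (hξ : ‖ξ‖ ≤ 1) : ‖nonlin ψ ξ‖ₑ ^ 2 ≤
    ENNReal.ofReal (2 * Real.pi) ^ 2 * ((∫⁻ η, ‖ψ η‖ₑ ^ 2) *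
      ∫⁻ ζ, ENNReal.ofReal (min 1 (‖ζ‖ ^ 2)) * ‖ψ ζ‖ₑ ^ 2) := by
  have hm := measurable_enorm_L2 ψ
  have h : ‖(2 * Real.pi : ℂ)‖ₑ = ENNReal.ofReal (2 * Real.pi) := by
    rw [← ofReal_norm]
    simp [abs_of_pos Real.pi_pos]
  rw [nonlin, enorm_mul, h, mul_pow]
  gcongr
  set g : Plane → ℝ≥0∞ := fun ζ => ENNReal.ofReal (min 1 ‖ζ‖) * ‖ψ ζ‖ₑ with hg
  have hgm : Measurable g :=
    (by fun_prop : Measurable (fun ζ : Plane => ENNReal.ofReal (min 1 ‖ζ‖))).mul hm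
  have hgm' : Measurable (fun η => g (ξ - η)) := hgm.comp (measurable_const.sub measurable_id)
  have h1 : ‖∫ η, ((wedge η ξ / ‖η‖ : ℝ) : ℂ) * (ψ η * ψ (ξ - η))‖ₑ ≤ ∫⁻ η, ‖ψ η‖ₑ * g (ξ - η) := by
    refine (enorm_integral_le_lintegral_enorm _).trans (lintegral_mono fun η => ?_)
    rw [enorm_mul, enorm_mul, mul_left_comm]
    refine mul_le_mul_right (mul_le_mul_left ?_ _) _
    rw [← ofReal_norm, Complex.norm_real, Real.norm_eq_abs]
    exact ENNReal.ofReal_le_ofReal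
      (le_min ((abs_wedge_div_le' η ξ).trans hξ) (abs_wedge_div_le η ξ))
  calc _ ≤ (∫⁻ η, ‖ψ η‖ₑ * g (ξ - η)) ^ 2 := by gcongr
    _ ≤ (∫⁻ η, ‖ψ η‖ₑ ^ 2) * ∫⁻ η, g (ξ - η) ^ 2 :=
        lintegral_mul_sq_le hm.aemeasurable hgm'.aemeasurable
    _ = _ := by
        rw [lintegral_sub_left_eq_self (fun ζ => g ζ ^ 2) ξ]
        congr 1
        refine lintegral_congr fun ζ => ?_
        rw [hg]
        dsimp only
        rw [mul_pow, ← ENNReal.ofReal_pow (by positivity)]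
        congr 2
        rcases le_total 1 ‖ζ‖ with h | h
        · rw [min_eq_left h, min_eq_left (one_le_pow₀ h), one_pow]
        · rw [min_eq_right h, min_eq_right (pow_le_one₀ (norm_nonneg _) h)]

/-- Cauchy–Schwarz with the factors |ξ|^{-b} and |ξ|^b; the second produces a weight that the
dissipation dominates near the origin. -/
theorem setLIntegral_ball_sq_le (ψ : L2) (b δ : ℝ) :
    (∫⁻ ξ in Metric.ball 0 δ, ‖ψ ξ‖ₑ) ^ 2 ≤ ballMass b δ *
      ∫⁻ ξ in Metric.ball 0 δ, ENNReal.ofReal (‖ξ‖ ^ (2 * b)) * ‖ψ ξ‖ₑ ^ 2 := by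
  have hm := measurable_enorm_L2 ψ
  have hg : Measurable (fun ξ : Plane => ENNReal.ofReal (‖ξ‖ ^ b) * ‖ψ ξ‖ₑ) :=
    (by fun_prop : Measurable (fun ξ : Plane => ENNReal.ofReal (‖ξ‖ ^ b))).mul hm
  have hf : Measurable (fun ξ : Plane => ENNReal.ofReal (‖ξ‖ ^ (-b))) := by fun_prop
  have h := lintegral_mul_sq_le (μ := volume.restrict (Metric.ball (0 : Plane) δ))
    hf.aemeasurable hg.aemeasurable
  have e1 : ∫⁻ ξ in Metric.ball 0 δ, ENNReal.ofReal (‖ξ‖ ^ (-b)) * (ENNReal.ofReal (‖ξ‖ ^ b) * ‖ψ ξ‖ₑ) =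
      ∫⁻ ξ in Metric.ball 0 δ, ‖ψ ξ‖ₑ := by
    refine lintegral_congr_ae (ae_restrict_of_ae ?_)
    filter_upwards [compl_mem_ae_iff.2 (measure_singleton (0 : Plane))] with ξ hξ
    have hξ0 : 0 < ‖ξ‖ := norm_pos_iff.2 hξ
    rw [← mul_assoc, ← ENNReal.ofReal_mul (by positivity), ← Real.rpow_add hξ0]
    simp
  rw [e1] at h
  refine h.trans_eq ?_
  rw [ballMass]
  congr 1
  refine lintegral_congr fun ξ => ?_
  rw [mul_pow, ← ENNReal.ofReal_pow (by positivity), ← Real.rpow_natCast,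
    ← Real.rpow_mul (norm_nonneg _), mul_comm b]
  norm_num

/-- The transport term is small compared to the dissipation at low frequencies. -/
theorem abs_tri_lowWeight_le (hμ : 0 < μ) (hν : 0 < ν) (hα : 0 ≤ α) (hβ : 0 ≤ β) (hα1 : α < 1)
    (hβ1 : β < 1) {δ : ℝ} (hδ1 : δ ≤ 1) {ψ : L2}
    (hint : Integrable (fun ξ => dissip μ ν α β ξ * ‖ψ ξ‖ ^ 2)) :
    |tri (lowWeight δ) ψ| ≤ 2 * Real.pi * (4 / min μ ν) * √(ballMass (max α β) δ).toReal *
      √(energy (fun _ => 1) ψ) * dis μ ν α β (fun _ => 1) ψ := by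
  have hm0 : 0 < min μ ν := lt_min hμ hν
  have hm := measurable_enorm_L2 ψ
  set b := max α β with hb
  set J := ballMass b δ with hJ
  set E := energy (fun _ => 1) ψ with hE
  set D := dis μ ν α β (fun _ => 1) ψ with hD
  have hE0 : 0 ≤ E := energy_nonneg (fun _ => zero_le_one) ψ
  have hD0 : 0 ≤ D := dis_nonneg hμ.le hν.le (fun _ => zero_le_one) ψ
  have hJlt : J ≠ ∞ := by
    refine ((lintegral_mono_set (Metric.ball_subset_ball hδ1)).trans_lt
      (ballMass_one_lt_top (max_lt hα1 hβ1))).ne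
  have hEe : ∫⁻ ξ, ‖ψ ξ‖ₑ ^ 2 = ENNReal.ofReal E := by
    rw [hE, ofReal_energy measurable_const (C := 1) (fun _ => zero_le_one) (fun _ => le_rfl)]
    simp
  set c := 4 / min μ ν with hc
  have hc0 : 0 ≤ c := by positivity
  have hDe : ∀ (S : Set Plane) (hS : MeasurableSet S) (g : Plane → ℝ),
      (∀ ξ ∈ S, g ξ ≤ c * dissip μ ν α β ξ) →
      ∫⁻ ξ in S, ENNReal.ofReal (g ξ) * ‖ψ ξ‖ₑ ^ 2 ≤ ENNReal.ofReal (c * D) := by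
    intro S hS g hg
    have h1 : ENNReal.ofReal (c * D) = ∫⁻ ξ, ENNReal.ofReal (c * (dissip μ ν α β ξ * ‖ψ ξ‖ ^ 2)) := by
      rw [hD, dis, ← integral_const_mul, ofReal_integral_eq_lintegral_ofReal]
      · simp only [one_mul]
      · simpa using hint.const_mul c
      · refine Eventually.of_forall fun ξ => ?_
        have := dissip_nonneg hμ.le hν.le (α := α) (β := β) ξ
        dsimp only
        positivity
    rw [h1]
    refine le_trans ?_ (setLIntegral_le_lintegral S _)
    refine setLIntegral_mono' hS fun ξ hξ => ?_
    have h2 := dissip_nonneg hμ.le hν.le (α := α) (β := β) ξ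
    rw [← mul_assoc, ENNReal.ofReal_mul (by positivity), ENNReal.ofReal_pow (norm_nonneg _), ofReal_norm]
    gcongr
    exact hg ξ hξ
  have hN : ∀ ξ ∈ Metric.ball (0 : Plane) δ, ‖nonlin ψ ξ‖ₑ ≤
      ENNReal.ofReal (2 * Real.pi * √(E * (c * D))) := by
    intro ξ hξ
    have hξ1 : ‖ξ‖ ≤ 1 := (mem_ball_zero_iff.1 hξ).le.trans hδ1
    have h1 := enorm_nonlin_sq_le ψ hξ1
    have h2 := hDe Set.univ MeasurableSet.univ (fun ζ => min 1 (‖ζ‖ ^ 2)) (fun ζ _ => by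
      have := min_mul_min_le_dissip hμ.le hν.le hα hβ hα1.le hβ1.le ζ
      have h3 := dissip_nonneg hμ.le hν.le (α := α) (β := β) ζ
      rw [hc, div_mul_eq_mul_div, le_div_iff₀ hm0]
      linarith)
    rw [setLIntegral_univ] at h2
    have h3 : ‖nonlin ψ ξ‖ₑ ^ 2 ≤ ENNReal.ofReal (2 * Real.pi * √(E * (c * D))) ^ 2 := by
      refine h1.trans ?_
      rw [hEe, ENNReal.ofReal_mul (q := √(E * (c * D))) (by positivity), mul_pow (ENNReal.ofReal (2 * Real.pi)),
        ← ENNReal.ofReal_pow (Real.sqrt_nonneg _),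
        Real.sq_sqrt (by positivity), ENNReal.ofReal_mul hE0]
      gcongr
    exact (ENNReal.pow_le_pow_left_iff two_ne_zero).1 h3
  have hL : ∫⁻ ξ in Metric.ball 0 δ, ‖ψ ξ‖ₑ ≤ ENNReal.ofReal √(J.toReal * (c * D)) := by
    have h1 := setLIntegral_ball_sq_le ψ b δ
    have h2 := hDe (Metric.ball 0 δ) measurableSet_ball (fun ξ => ‖ξ‖ ^ (2 * b)) (fun ξ hξ => by
      have := rpow_le_dissip hμ.le hν.le hα hβ hα1.le hβ1.le
        ((mem_ball_zero_iff.1 hξ).le.trans hδ1)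
      rw [hc, div_mul_eq_mul_div, le_div_iff₀ hm0]
      linarith)
    refine (ENNReal.pow_le_pow_left_iff two_ne_zero).1 (h1.trans ?_)
    rw [← ENNReal.ofReal_pow (Real.sqrt_nonneg _), Real.sq_sqrt (by positivity),
      ENNReal.ofReal_mul (by positivity), ENNReal.ofReal_toReal hJlt]
    exact mul_le_mul_right h2 _
  -- Both ψ and the nonlinearity contribute half a power of D; together they give exactly one, as
  -- integration in time requires.
  have hmain : ‖tri (lowWeight δ) ψ‖ₑ ≤ ENNReal.ofReal
      (√(J.toReal * (c * D)) * (2 * Real.pi * √(E * (c * D)))) := by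
    calc ‖tri (lowWeight δ) ψ‖ₑ ≤ ∫⁻ ξ in Metric.ball 0 δ, ‖ψ ξ‖ₑ * ‖nonlin ψ ξ‖ₑ := by
          rw [tri, ← lintegral_indicator measurableSet_ball]
          refine (enorm_integral_le_lintegral_enorm _).trans (lintegral_mono fun ξ => ?_)
          by_cases hξ : ξ ∈ Metric.ball (0 : Plane) δ
          · rw [Set.indicator_of_mem hξ, lowWeight, Set.indicator_of_mem hξ, one_mul,
              ← ofReal_norm, ← ofReal_norm, ← ofReal_norm, ← ENNReal.ofReal_mul (norm_nonneg _)]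
            exact ENNReal.ofReal_le_ofReal (norm_inner_le_norm _ _)
          · rw [lowWeight, Set.indicator_of_notMem hξ, Set.indicator_of_notMem hξ]
            simp
      _ ≤ ∫⁻ ξ in Metric.ball 0 δ, ‖ψ ξ‖ₑ * ENNReal.ofReal (2 * Real.pi * √(E * (c * D))) := by
          refine setLIntegral_mono' measurableSet_ball fun ξ hξ => ?_
          gcongr
          exact hN ξ hξ
      _ ≤ _ := by
          rw [lintegral_mul_const _ hm, ENNReal.ofReal_mul (Real.sqrt_nonneg _)]
          gcongr
  have h1 := ENNReal.toReal_mono ENNReal.ofReal_ne_top hmain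
  rw [toReal_enorm, Real.norm_eq_abs, ENNReal.toReal_ofReal (by positivity)] at h1
  refine h1.trans_eq ?_
  have hcD : 0 ≤ c * D := by positivity
  rw [Real.sqrt_mul ENNReal.toReal_nonneg, Real.sqrt_mul hE0]
  calc _ = 2 * Real.pi * √J.toReal * √E * (√(c * D) * √(c * D)) := by ring
    _ = _ := by
      rw [Real.mul_self_sqrt hcD]
      ring

/-- The low-frequency energy is small uniformly in time. -/
theorem IsGlobalSolution.energy_lowWeight_le (h : IsGlobalSolution μ ν α β s θ) (hs : 1 < s)
    (hμ : 0 < μ) (hν : 0 < ν) (hα : 0 ≤ α) (hβ : 0 ≤ β) (hα1 : α < 1) (hβ1 : β < 1)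
    {δ : ℝ} (hδ1 : δ ≤ 1) {t : ℝ} (ht : 0 ≤ t) :
    energy (lowWeight δ) (𝓕 (θ t)) ≤ energy (lowWeight δ) (𝓕 (θ 0)) +
      2 * (2 * Real.pi * (4 / min μ ν) * √(ballMass (max α β) δ).toReal *
        √(energy (fun _ => 1) (𝓕 (θ 0)))) * energy (fun _ => 1) (𝓕 (θ 0)) := by
  have hm0 : 0 < min μ ν := lt_min hμ hν
  obtain ⟨hTi, hDi, he⟩ := h.energy_eq hs hμ.le hν.le hα hβ hα1.le hβ1.le
    (measurable_lowWeight δ) (lowWeight_nonneg δ) (lowWeight_le_one δ) le_rfl ht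
  have he1 := (h.energy_eq hs hμ.le hν.le hα hβ hα1.le hβ1.le
    (w := fun _ => 1) measurable_const (fun _ => zero_le_one) (C := 1) (fun _ => le_rfl) le_rfl ht).2.1
  set Q := 2 * Real.pi * (4 / min μ ν) * √(ballMass (max α β) δ).toReal *
        √(energy (fun _ => 1) (𝓕 (θ 0))) with hQ
  have hE0 := energy_nonneg (w := fun _ => 1) (fun _ => zero_le_one)
  have hD0 := dis_nonneg (α := α) (β := β) hμ.le hν.le (w := fun _ => 1) (fun _ => zero_le_one)
  have hQ0 : 0 ≤ Q := by positivity
  have hmass := fun τ (hτ : 0 ≤ τ) => h.energy_one_le hs hμ.le hν.le hα hβ hα1.le hβ1.le hτ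
  -- The low-frequency dissipation has a favourable sign and is dropped; the total dissipation on
  -- the right is integrable in time.
  have h1 : ∫ τ in 0..t, 2 * (tri (lowWeight δ) (𝓕 (θ τ)) - dis μ ν α β (lowWeight δ) (𝓕 (θ τ))) ≤
      ∫ τ in 0..t, 2 * Q * dis μ ν α β (fun _ => 1) (𝓕 (θ τ)) := by
    refine intervalIntegral.integral_mono_on ht ((hTi.sub hDi).const_mul 2) (he1.const_mul _)
      fun τ hτ => ?_
    have h2 := (le_abs_self _).trans (abs_tri_lowWeight_le hμ hν hα hβ hα1 hβ1 hδ1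
      (h.integrable_dissip hs hμ.le hν.le hα hβ hα1.le hβ1.le hτ.1))
    have h3 := dis_nonneg (α := α) (β := β) hμ.le hν.le (lowWeight_nonneg δ) (𝓕 (θ τ))
    have h4 : energy (fun _ => 1) (𝓕 (θ τ)) ≤ energy (fun _ => 1) (𝓕 (θ 0)) := by
      have h5 := hmass τ hτ.1
      have h6 : 0 ≤ ∫ σ in 0..τ, dis μ ν α β (fun _ => 1) (𝓕 (θ σ)) :=
        intervalIntegral.integral_nonneg hτ.1 fun σ _ => hD0 _
      linarith
    have h5 : 2 * Real.pi * (4 / min μ ν) * √(ballMass (max α β) δ).toReal *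
        √(energy (fun _ => 1) (𝓕 (θ τ))) * dis μ ν α β (fun _ => 1) (𝓕 (θ τ)) ≤
        Q * dis μ ν α β (fun _ => 1) (𝓕 (θ τ)) := by
      rw [hQ]
      have := hD0 (𝓕 (θ τ))
      gcongr
    linarith
  rw [intervalIntegral.integral_const_mul (2 * Q)] at h1
  have h2 := hmass t ht
  have h3 := hE0 (𝓕 (θ t))
  have h4 : 2 * Q * ∫ τ in 0..t, dis μ ν α β (fun _ => 1) (𝓕 (θ τ)) ≤
      2 * Q * energy (fun _ => 1) (𝓕 (θ 0)) := by
    gcongr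
    linarith
  linarith


/-! ### Removing the truncation and conclusion -/

/-- The squared homogeneous Sobolev norm on the Fourier side. -/
def homSob (s : ℝ) (ψ : L2) : ℝ≥0∞ := ∫⁻ ξ, ENNReal.ofReal (‖ξ‖ ^ (2 * s)) * ‖ψ ξ‖ₑ ^ 2

/-- Fatou's lemma along R = n + 1 → ∞; this is where uniformity in R is used. -/
theorem homSob_le_of_energy_le (hs : 0 ≤ s) {ψ : L2} {B : ℝ}
    (hB : ∀ R, 0 < R → energy (profWeight s R) ψ ≤ B) : homSob s ψ ≤ ENNReal.ofReal B := by
  set f : ℕ → Plane → ℝ≥0∞ := fun n ξ => ENNReal.ofReal (profWeight s (n + 1) ξ) * ‖ψ ξ‖ₑ ^ 2 with hf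
  have hfm : ∀ n, Measurable (f n) := fun n =>
    (measurable_profWeight s _).ennreal_ofReal.mul ((measurable_enorm_L2 ψ).pow_const 2)
  have hlim : ∀ ξ, liminf (fun n => f n ξ) atTop = ENNReal.ofReal (‖ξ‖ ^ (2 * s)) * ‖ψ ξ‖ₑ ^ 2 := by
    intro ξ
    refine Tendsto.liminf_eq (tendsto_const_nhds.congr' ?_)
    obtain ⟨N, hN⟩ := exists_nat_ge ‖ξ‖
    filter_upwards [eventually_ge_atTop N] with n hn
    have h1 : ‖ξ‖ ≤ n + 1 := by
      have : (N : ℝ) ≤ n := by exact_mod_cast hn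
      linarith
    rw [hf]
    dsimp only
    rw [profWeight, prof, min_eq_left h1, ← Real.rpow_natCast, ← Real.rpow_mul (norm_nonneg _),
      mul_comm s]
    norm_num
  have h1 : homSob s ψ = ∫⁻ ξ, liminf (fun n => f n ξ) atTop := by
    simp only [hlim, homSob]
  rw [h1]
  refine (lintegral_liminf_le hfm).trans (liminf_le_of_frequently_le' (Frequently.of_forall fun n => ?_))
  have hn : (0 : ℝ) < n + 1 := by positivity
  rw [hf]
  dsimp only
  rw [← ofReal_energy (measurable_profWeight s _) (profWeight_nonneg s _) (profWeight_le hs hn.le)]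
  exact ENNReal.ofReal_le_ofReal (hB _ hn)

theorem ofReal_energy_profWeight_le {R : ℝ} (hs : 0 ≤ s) (hR : 0 ≤ R) (ψ : L2) :
    ENNReal.ofReal (energy (profWeight s R) ψ) ≤ homSob s ψ := by
  rw [ofReal_energy (measurable_profWeight s _) (profWeight_nonneg s _) (profWeight_le hs hR), homSob]
  refine lintegral_mono fun ξ => ?_
  dsimp only
  gcongr
  exact profWeight_le_rpow hs hR ξ

theorem homSob_le_homSobolevNorm_sq (hs : 0 ≤ s) (f : L2) :
    homSob s (𝓕 f) ≤ homSobolevNorm s f ^ 2 := by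
  rw [homSobolevNorm, eLpNorm_two_sq, homSob]
  refine lintegral_mono fun ξ => ?_
  dsimp only
  rw [enorm_mul, mul_pow]
  gcongr
  rw [← ofReal_norm, ← ENNReal.ofReal_pow (norm_nonneg _), Complex.norm_real,
    Real.norm_of_nonneg (by positivity), ← Real.rpow_natCast, ← Real.rpow_mul (by positivity),
    mul_comm s]
  refine ENNReal.ofReal_le_ofReal ?_
  push_cast
  refine Real.rpow_le_rpow (norm_nonneg _) ?_ (by positivity)
  refine le_mul_of_one_le_left (norm_nonneg _) ?_
  nlinarith [Real.pi_gt_three]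

theorem sobolevNorm_sq_le (hs : 0 ≤ s) (f : L2) : sobolevNorm s f ^ 2 ≤
    ENNReal.ofReal (2 ^ s * (2 * Real.pi) ^ (2 * s)) *
      ((∫⁻ ξ, ‖(𝓕 f : L2) ξ‖ₑ ^ 2) + homSob s (𝓕 f)) := by
  have hm := measurable_enorm_L2 (𝓕 f)
  rw [sobolevNorm_sq, homSob, ← lintegral_add_left (hm.pow_const 2),
    ← lintegral_const_mul' _ _ ENNReal.ofReal_ne_top]
  refine lintegral_mono fun ξ => ?_
  dsimp only
  have h2π : 1 ≤ (2 * Real.pi) ^ (2 * s) :=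
    Real.one_le_rpow (by nlinarith [Real.pi_gt_three]) (by linarith)
  have key : (1 + (2 * Real.pi * ‖ξ‖) ^ 2) ^ s ≤
      2 ^ s * (2 * Real.pi) ^ (2 * s) * (1 + ‖ξ‖ ^ (2 * s)) := by
    set x := (2 * Real.pi * ‖ξ‖) ^ 2 with hx
    have hx0 : 0 ≤ x := by positivity
    have hxs : x ^ s = (2 * Real.pi) ^ (2 * s) * ‖ξ‖ ^ (2 * s) := by
      rw [hx, ← Real.mul_rpow (by positivity) (norm_nonneg _), ← Real.rpow_natCast,
        ← Real.rpow_mul (by positivity)]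
      norm_num
    have h0 : 0 ≤ ‖ξ‖ ^ (2 * s) := by positivity
    have h2s : (0 : ℝ) ≤ 2 ^ s := by positivity
    have h1 : (1 + x) ^ s ≤ 2 ^ s * (1 + x ^ s) := by
      rcases le_total x 1 with h | h
      · calc (1 + x) ^ s ≤ 2 ^ s := Real.rpow_le_rpow (by positivity) (by linarith) hs
          _ ≤ 2 ^ s * (1 + x ^ s) := le_mul_of_one_le_right h2s
              (le_add_of_nonneg_right (by positivity))
      · calc (1 + x) ^ s ≤ (2 * x) ^ s := Real.rpow_le_rpow (by positivity) (by linarith) hs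
          _ = 2 ^ s * x ^ s := Real.mul_rpow (by norm_num) hx0
          _ ≤ 2 ^ s * (1 + x ^ s) := by
              gcongr
              linarith
    calc (1 + x) ^ s ≤ 2 ^ s * (1 + x ^ s) := h1
      _ ≤ 2 ^ s * ((2 * Real.pi) ^ (2 * s) + (2 * Real.pi) ^ (2 * s) * ‖ξ‖ ^ (2 * s)) := by
          rw [hxs]
          gcongr
      _ = _ := by ring
  have e : ‖(𝓕 f : L2) ξ‖ₑ ^ 2 + ENNReal.ofReal (‖ξ‖ ^ (2 * s)) * ‖(𝓕 f : L2) ξ‖ₑ ^ 2 =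
      ENNReal.ofReal (1 + ‖ξ‖ ^ (2 * s)) * ‖(𝓕 f : L2) ξ‖ₑ ^ 2 := by
    rw [ENNReal.ofReal_add zero_le_one (by positivity), ENNReal.ofReal_one]
    ring
  rw [e, ← mul_assoc, ← ENNReal.ofReal_mul (by positivity)]
  gcongr

/-- Outside the ball of radius δ, δ^{-2s} |ξ|^{2s} is at least 1. -/
theorem lintegral_enorm_sq_le_low_add (hs : 0 ≤ s) {δ : ℝ} (hδ : 0 < δ) (ψ : L2) :
    ∫⁻ ξ, ‖ψ ξ‖ₑ ^ 2 ≤ ENNReal.ofReal (energy (lowWeight δ) ψ) +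
      ENNReal.ofReal (δ ^ (-(2 * s))) * homSob s ψ := by
  have hm := (measurable_enorm_L2 ψ).pow_const 2
  rw [ofReal_energy (measurable_lowWeight δ) (lowWeight_nonneg δ) (lowWeight_le_one δ), homSob,
    ← lintegral_const_mul' _ _ ENNReal.ofReal_ne_top,
    ← lintegral_add_left (show Measurable (fun ξ => ENNReal.ofReal (lowWeight δ ξ) * ‖ψ ξ‖ₑ ^ 2) from
      (measurable_lowWeight δ).ennreal_ofReal.mul hm)]
  refine lintegral_mono fun ξ => ?_
  dsimp only
  rw [← mul_assoc, ← add_mul]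
  refine le_mul_of_one_le_left zero_le ?_
  by_cases hξ : ξ ∈ Metric.ball (0 : Plane) δ
  · rw [lowWeight, Set.indicator_of_mem hξ, ENNReal.ofReal_one]
    exact le_self_add
  · rw [mem_ball_zero_iff, not_lt] at hξ
    refine le_trans ?_ le_add_self
    rw [← ENNReal.ofReal_mul (by positivity), ENNReal.one_le_ofReal, Real.rpow_neg hδ.le,
      ← div_eq_inv_mul, one_le_div (by positivity)]
    exact Real.rpow_le_rpow hδ.le hξ (by positivity)

theorem tendsto_ofReal_energy_lowWeight (ψ : L2) :
    Tendsto (fun δ => ENNReal.ofReal (energy (lowWeight δ) ψ)) (𝓝[>] 0) (𝓝 0) := by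
  have h1 : ∫⁻ ξ in Metric.ball (0 : Plane) 1, ‖ψ ξ‖ₑ ^ 2 < ∞ := by
    refine (setLIntegral_le_lintegral _ _).trans_lt ?_
    rw [← eLpNorm_two_sq]
    exact ENNReal.pow_lt_top (Lp.eLpNorm_lt_top ψ)
  refine (tendsto_setLIntegral_ball h1).congr fun δ => ?_
  rw [ofReal_energy (measurable_lowWeight δ) (lowWeight_nonneg δ) (lowWeight_le_one δ),
    ← lintegral_indicator measurableSet_ball]
  refine lintegral_congr fun ξ => ?_
  by_cases hξ : ξ ∈ Metric.ball (0 : Plane) δ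
  · rw [lowWeight, Set.indicator_of_mem hξ, Set.indicator_of_mem hξ]
    simp
  · rw [lowWeight, Set.indicator_of_notMem hξ, Set.indicator_of_notMem hξ]
    simp

/-- A global solution whose homogeneous norm decays tends to zero. -/
theorem IsGlobalSolution.tendsto_sobolevNorm (h : IsGlobalSolution μ ν α β s θ) (hs : 1 < s)
    (hμ : 0 < μ) (hν : 0 < ν) (hα : 0 ≤ α) (hβ : 0 ≤ β) (hα1 : α < 1) (hβ1 : β < 1)
    {B : ℝ} (hB : ∀ t, 0 < t → homSob s (𝓕 (θ t)) ≤ ENNReal.ofReal (B / t)) :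
    Tendsto (fun t => sobolevNorm s (θ t)) atTop (𝓝 0) := by
  set Ks : ℝ≥0∞ := ENNReal.ofReal (2 ^ s * (2 * Real.pi) ^ (2 * s)) with hKs
  have hKs' : Ks ≠ ∞ := ENNReal.ofReal_ne_top
  set E₀ := energy (fun _ => 1) (𝓕 (θ 0)) with hE₀
  set F : ℝ → ℝ := fun δ => 2 * (2 * Real.pi * (4 / min μ ν) * √(ballMass (max α β) δ).toReal *
        √E₀) * E₀ with hF
  set L : ℝ → ℝ≥0∞ := fun δ => ENNReal.ofReal (energy (lowWeight δ) (𝓕 (θ 0))) +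
    ENNReal.ofReal (F δ) with hL
  have hLlim : Tendsto (fun δ => Ks * L δ) (𝓝[>] 0) (𝓝 0) := by
    have hFlim : Tendsto F (𝓝[>] 0) (𝓝 0) := by
      have h1 : Tendsto (fun δ => (ballMass (max α β) δ).toReal) (𝓝[>] 0) (𝓝 0) := by
        have := tendsto_setLIntegral_ball (ballMass_one_lt_top (max_lt hα1 hβ1))
        exact (ENNReal.tendsto_toReal ENNReal.zero_ne_top).comp this
      have h2 := h1.sqrt
      rw [Real.sqrt_zero] at h2
      have h3 := (((h2.const_mul (2 * Real.pi * (4 / min μ ν))).mul_const √E₀).const_mul 2).mul_const E₀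
      simpa using h3
    have h1 := (tendsto_ofReal_energy_lowWeight (𝓕 (θ 0))).add (ENNReal.tendsto_ofReal hFlim)
    have h2 := ENNReal.Tendsto.const_mul (a := Ks) h1 (Or.inr hKs')
    simpa using h2
  have hbound : ∀ δ, 0 < δ → δ ≤ 1 → ∀ t, 0 < t → sobolevNorm s (θ t) ^ 2 ≤
      Ks * L δ + Ks * ((ENNReal.ofReal (δ ^ (-(2 * s))) + 1) * ENNReal.ofReal (B / t)) := by
    intro δ hδ hδ1 t ht
    refine (sobolevNorm_sq_le (by linarith) _).trans ?_
    rw [← mul_add]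
    refine mul_le_mul_right ?_ Ks
    have h1 := lintegral_enorm_sq_le_low_add (s := s) (by linarith) hδ (𝓕 (θ t))
    have h2 : ENNReal.ofReal (energy (lowWeight δ) (𝓕 (θ t))) ≤ L δ :=
      (ENNReal.ofReal_le_ofReal
        (h.energy_lowWeight_le hs hμ hν hα hβ hα1 hβ1 hδ1 ht.le)).trans ENNReal.ofReal_add_le
    calc _ ≤ (L δ + ENNReal.ofReal (δ ^ (-(2 * s))) * ENNReal.ofReal (B / t)) +
          ENNReal.ofReal (B / t) := by
          refine add_le_add (h1.trans (add_le_add h2 ?_)) (hB t ht)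
          gcongr
          exact hB t ht
      _ = _ := by ring
  have hsq : Tendsto (fun t => sobolevNorm s (θ t) ^ 2) atTop (𝓝 0) := by
    rw [ENNReal.tendsto_nhds_zero]
    intro ε hε
    have hε2 : 0 < ε / 2 := ENNReal.half_pos hε.ne'
    -- First δ is fixed to make the time-uniform low-frequency part small; afterwards t → ∞ removes
    -- the rest, whose constant depends on δ.
    obtain ⟨δ, hδL, hδ⟩ := ((ENNReal.tendsto_nhds_zero.1 hLlim (ε / 2) hε2).and
      (Ioc_mem_nhdsGT (one_pos : (0 : ℝ) < 1))).exists
    have hBt : Tendsto (fun t : ℝ => ENNReal.ofReal (B / t)) atTop (𝓝 0) := by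
      simpa using ENNReal.tendsto_ofReal (tendsto_const_nhds.div_atTop tendsto_id : Tendsto
        (fun t : ℝ => B / t) atTop (𝓝 0))
    have h1 := ENNReal.Tendsto.const_mul (a := Ks) (ENNReal.Tendsto.const_mul
      (a := ENNReal.ofReal (δ ^ (-(2 * s))) + 1) hBt (Or.inr (by simp))) (Or.inr hKs')
    rw [mul_zero, mul_zero] at h1
    filter_upwards [ENNReal.tendsto_nhds_zero.1 h1 (ε / 2) hε2, eventually_gt_atTop 0] with t ht ht0
    calc _ ≤ _ := hbound δ hδ.1 hδ.2 t ht0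
      _ ≤ ε / 2 + ε / 2 := add_le_add hδL ht
      _ = ε := ENNReal.add_halves ε
  have h1 := hsq.ennrpow_const (1 / 2 : ℝ)
  rw [ENNReal.zero_rpow_of_pos (by norm_num)] at h1
  refine h1.congr fun t => ?_
  rw [← ENNReal.rpow_natCast, ← ENNReal.rpow_mul]
  norm_num

/-- The direction with the smaller exponent is chosen, since s = 2 - 2 min α β is the critical index
for precisely that exponent. -/
theorem min_mul_rpow_le_dissip (hμ : 0 ≤ μ) (hν : 0 ≤ ν) (hα : 0 ≤ α) (hβ : 0 ≤ β) :
    ∃ i : Fin 2, ∀ ξ, min μ ν * |ξ i| ^ (2 * min α β) ≤ dissip μ ν α β ξ := by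
  have key : ∀ (j : Fin 2) (a : ℝ), 0 ≤ a → ∀ ξ : Plane,
      |ξ j| ^ (2 * a) ≤ |2 * Real.pi * ξ j| ^ (2 * a) := by
    intro j a ha ξ
    refine Real.rpow_le_rpow (abs_nonneg _) ?_ (by positivity)
    rw [abs_mul, abs_of_pos Real.two_pi_pos]
    refine le_mul_of_one_le_left (abs_nonneg _) ?_
    nlinarith [Real.pi_gt_three]
  rcases le_total α β with hab | hab
  · refine ⟨0, fun ξ => ?_⟩
    rw [min_eq_left hab]
    have h1 : 0 ≤ ν * |2 * Real.pi * ξ 1| ^ (2 * β) := by positivity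
    have h2 : min μ ν * |ξ 0| ^ (2 * α) ≤ μ * |2 * Real.pi * ξ 0| ^ (2 * α) :=
      mul_le_mul (min_le_left _ _) (key 0 α hα ξ) (by positivity) hμ
    unfold dissip
    linarith
  · refine ⟨1, fun ξ => ?_⟩
    rw [min_eq_right hab]
    have h1 : 0 ≤ μ * |2 * Real.pi * ξ 0| ^ (2 * α) := by positivity
    have h2 : min μ ν * |ξ 1| ^ (2 * β) ≤ ν * |2 * Real.pi * ξ 1| ^ (2 * β) :=
      mul_le_mul (min_le_right _ _) (key 1 β hβ ξ) (by positivity) hν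
    unfold dissip
    linarith

theorem exists_small_data_decay (hα : α ∈ Set.Ioo (0 : ℝ) 1) (hβ : β ∈ Set.Ioo (0 : ℝ) 1)
    (hαβ : min α β < 1 / 2) (hμ : 0 < μ) (hν : 0 < ν) (hsa : s = 2 - 2 * min α β) :
    ∃ c : ℝ, 0 < c ∧ ∀ θ : ℝ → L2, IsGlobalSolution μ ν α β s θ →
      homSobolevNorm s (θ 0) < ENNReal.ofReal c →
      Tendsto (fun t : ℝ => sobolevNorm s (θ t)) atTop (𝓝 0) := by
  have hs : 1 < s := by linarith
  have hm0 : 0 < min μ ν := lt_min hμ hν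
  obtain ⟨i, hi⟩ := min_mul_rpow_le_dissip hμ.le hν.le hα.1.le hβ.1.le
  obtain ⟨K, hK, htri⟩ := exists_tri_profWeight_le hμ.le hν.le hsa (lt_min hα.1 hβ.1) hαβ i hm0 hi
  -- This makes K √E(0) ≤ 1/4 < 1/2 for every R at once, because K does not depend on R.
  refine ⟨1 / (4 * K), by positivity, fun θ h h0 => ?_⟩
  set c := 1 / (4 * K) with hc
  have hc0 : 0 < c := by positivity
  have hE0 : ∀ R, 0 < R → energy (profWeight s R) (𝓕 (θ 0)) ≤ c ^ 2 := by
    intro R hR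
    rw [← ENNReal.ofReal_le_ofReal_iff (by positivity), ENNReal.ofReal_pow hc0.le]
    refine (ofReal_energy_profWeight_le (by linarith) hR.le _).trans
      ((homSob_le_homSobolevNorm_sq (by linarith) _).trans ?_)
    gcongr
  refine h.tendsto_sobolevNorm hs hμ hν hα.1.le hβ.1.le hα.2 hβ.2
    (B := (min μ ν)⁻¹ * (energy (fun _ => 1) (𝓕 (θ 0)) + c ^ 2)) fun t ht =>
    homSob_le_of_energy_le (by linarith) fun R hR => ?_
  rw [le_div_iff₀ ht, mul_comm]
  refine (h.mul_energy_profWeight_le hs hμ hν hα.1.le hβ.1.le hα.2.le hβ.2.le hK.le hR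
    (htri R hR) ?_ ht.le).trans ?_
  · have h1 : √(energy (profWeight s R) (𝓕 (θ 0))) ≤ c := by
      rw [Real.sqrt_le_left hc0.le]
      exact hE0 R hR
    calc K * √(energy (profWeight s R) (𝓕 (θ 0))) ≤ K * c := by gcongr
      _ = 1 / 4 := by
        rw [hc]
        field_simp
      _ < 1 / 2 := by norm_num
  · gcongr
    exact hE0 R hR

end AQG
end

theorem theorem1p3 (α β μ ν : ℝ) (hα : α ∈ Set.Ioo (0 : ℝ) 1) (hβ : β ∈ Set.Ioo (0 : ℝ) 1)
    (hαβ : min α β < 1 / 2) (hμ : 0 < μ) (hν : 0 < ν) :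
    ∃ c : ℝ, 0 < c ∧ ∀ θ : ℝ → AQG.L2,
      AQG.IsGlobalSolution μ ν α β (max (2 - 2 * α) (2 - 2 * β)) θ →
      AQG.homSobolevNorm (max (2 - 2 * α) (2 - 2 * β)) (θ 0) < ENNReal.ofReal c →
      Tendsto (fun t : ℝ => AQG.sobolevNorm (max (2 - 2 * α) (2 - 2 * β)) (θ t))
        atTop (𝓝 0) := by
  refine AQG.exists_small_data_decay hα hβ hαβ hμ hν ?_
  rcases le_total α β with h | h
  · rw [min_eq_left h, max_eq_left (by linarith)]
  · rw [min_eq_right h, max_eq_right (by linarith)]
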